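/- Let $\tfrac12<\alpha<1$, $\lambda\in\{1,-1\}$, $w(x)=\lambda|x|^{-\alpha}$ on $\mathbb R^3$, $\langle y\rangle=(1+|y|^2)^{1/2}$. For $f=f(t,x,v)$ put $\rho_f(t,x)=\int_{\mathbb R^3} f(t,x,v)\,dv$ and $\mathbf E_f(t,x)=-\int_{\mathbb R^3}\nabla w(x-y)\rho_f(t,y)\,dy$, and consider the Vlasov–Riesz system $$\partial_t f+v\cdot\nabla_x f+\mathbf E_f\cdot\nabla_v f=0,\qquad f(0)=f_0 .$$ For every $C_0>0$ there exist $\eta_0>0$ and $C>0$, depending only on $\alpha,\lambda,C_0$, such that the following holds for every $0<\eta_*\le\eta_0$. Let $f_0\ge0$ satisfy $$\|\langle x\rangle f_0\|_{W^{1,1}_{x,v}\cap W^{1,\infty}_{x,v}(\mathbb R^6)}+\|\langle x\rangle f_0\|_{W^{1,1}_x W^{1,\infty}_v\cap W^{1,1}_vW^{1,\infty}_x}\le\eta_*,$$ where the norm of an intersection is the sum of the two norms and $$\|u\|_{W^{1,p}_xW^{1,q}_v}=\sum_{|m|\le1,\,|m'|\le1}\|\nabla_x^m\nabla_v^{m'}u\|_{L^p_x(\mathbb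 R^3;L^q_v(\mathbb R^3))},$$ with $\|u\|_{W^{1,p}_vW^{1,q}_x}$ defined by exchanging the roles of $x$ and $v$. Let $f$ be a global solution of the system (in the sense of distributions on phase space) with initial datum $f_0$ in the class $C([0,\infty);L^1\cap L^\infty(\mathbb R^6))\cap L^\infty_{\rm loc}([0,\infty);W^{1,1}\cap W^{1,\infty}(\mathbb R^6))$ (in particular any solution in $C([0,\infty);W^{1,1}\cap W^{1,\infty}(\mathbb R^6))$) such that $$\sup_{t\ge0}\Big(\langle t\rangle^{1+\alpha}\|\mathbf E_f(t)\|_{L^\infty}+\langle t\rangle^{2+\alpha}\|\nabla\mathbf E_f(t)\|_{L^\infty}+\langle t\rangle^{3}\|\nabla^2\mathbf E_f(t)\|_{L^\infty}\Big)\le C_0\,\eta_* .$$ Let $(\mathcal X,\mathcal V)(t,0,x,v)$ be the characteristic flow, $\partial_t\mathcal X=\mathcal V$, $\partial_t\mathcal V=\mathbf E_f(t,\mathcal X)$ for $t\ge 0$, $(\mathcal X,\mathcal V)(0,0,x,v)=(x,v)$, and set $$\mathbf A_t(v)=-\iint_{\mathbb R^6}\nabla w\big(v-\mathcal V(t,0,\tilde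 x,\tilde v)\big)f_0(\tilde x,\tilde v)\,d\tilde x\,d\tilde v,\qquad \tilde\Phi^{\rm ref}(t)(x,v)=\Big(x+tv-\tfrac{t^{1-\alpha}-1}{1-\alpha}\mathbf A_t(v),\,v\Big).$$ Then the modified distribution $g(t,x,v)=f\big(t,\tilde\Phi^{\rm ref}(t)(x,v)\big)$ is weakly differentiable in $(x,v)$ for every $t\ge1$ and satisfies $$\sup_{t\ge1}\Big(\|\langle x\rangle g(t)\|_{L^\infty_{x,v}}+\|\langle x\rangle\nabla_x g(t)\|_{L^\infty_{x,v}}+\frac1{t^{1-\alpha}}\|\langle x\rangle\nabla_v g(t)\|_{L^\infty_{x,v}}\Big)\le C\,\eta_* .$$ The $L^\infty$ norms of $\nabla\mathbf E_f$, $\nabla^2\mathbf E_f$, $\nabla_x g$ and $\nabla_v g$ are the sums of the norms of their (weak) partial derivatives. -/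

import Mathlib

open MeasureTheory Filter Topology
open scoped ENNReal ContDiff

namespace VlasovRiesz

/-- Position space and velocity space. -/
abbrev E3 := EuclideanSpace ℝ (Fin 3)

/-- Phase space; a point is a pair `(x, v)`. -/
abbrev Phase := E3 × E3

/-- The Japanese bracket `⟨y⟩ = (1 + |y|²)^(1/2)`, for numbers and for vectors. -/
noncomputable def jap {F : Type*} [Norm F] (y : F) : ℝ := Real.sqrt (1 + ‖y‖ ^ 2)

/-! ### Weak derivatives and Sobolev norms -/

section Weak

variable {F : Type*} [NormedAddCommGroup F] [NormedSpace ℝ F]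
variable {G : Type*} [NormedAddCommGroup G] [NormedSpace ℝ G]

/-- The iterated classical directional derivative of `φ` along the directions listed in `l`. -/
noncomputable def dirDeriv (l : List F) (φ : F → ℝ) : F → ℝ :=
  l.foldr (fun e ψ z => fderiv ℝ ψ z e) φ

/-- `g` is the weak derivative of `u` along the directions listed in `l`. For the empty list this
says that `g = u` almost everywhere. -/
def IsWeakDeriv [MeasureSpace F] (l : List F) (u g : F → G) : Prop :=
  LocallyIntegrable u volume ∧ LocallyIntegrable g volume ∧
    ∀ φ : F → ℝ, ContDiff ℝ ∞ φ → HasCompactSupport φ →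
      ∫ z, dirDeriv l φ z • u z = (-1 : ℝ) ^ l.length • ∫ z, φ z • g z

/-- The norm `N`, which does not see null sets, of the weak derivative of `u` along `l`. The weak
derivative is unique almost everywhere; the value is `∞` if it does not exist. -/
noncomputable def weakDerivNorm [MeasureSpace F] (N : (F → G) → ℝ≥0∞) (l : List F)
    (u : F → G) : ℝ≥0∞ :=
  ⨅ (g : F → G) (_ : IsWeakDeriv l u g), N g

end Weak

/-- The coordinate directions of `ℝ³`. -/
noncomputable def dir (i : Fin 3) : E3 := EuclideanSpace.single i (1 : ℝ)

/-- The `x`-coordinate directions of phase space. -/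
noncomputable def dirX (i : Fin 3) : Phase := (dir i, 0)

/-- The `v`-coordinate directions of phase space. -/
noncomputable def dirV (i : Fin 3) : Phase := (0, dir i)

/-- The norm of `W^{1,p}_{x,v}(ℝ⁶)`. -/
noncomputable def sobolevNorm (p : ℝ≥0∞) (u : Phase → ℝ) : ℝ≥0∞ :=
  weakDerivNorm (fun h => eLpNorm h p volume) [] u
    + (∑ i, weakDerivNorm (fun h => eLpNorm h p volume) [dirX i] u)
    + ∑ i, weakDerivNorm (fun h => eLpNorm h p volume) [dirV i] u

/-- The norm of `L^p_x(ℝ³; L^q_v(ℝ³))`. -/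
noncomputable def normXV (p q : ℝ≥0∞) (h : Phase → ℝ) : ℝ≥0∞ :=
  eLpNorm (fun x : E3 => eLpNorm (fun v : E3 => h (x, v)) q volume) p volume

/-- The norm of `L^p_v(ℝ³; L^q_x(ℝ³))`. -/
noncomputable def normVX (p q : ℝ≥0∞) (h : Phase → ℝ) : ℝ≥0∞ :=
  eLpNorm (fun v : E3 => eLpNorm (fun x : E3 => h (x, v)) q volume) p volume

/-- The sum of `N (∇_x^m ∇_v^{m'} u)` over all multi-indices with `|m| ≤ 1` and `|m'| ≤ 1`; `none`
stands for the multi-index `0`. -/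
noncomputable def mixedSobolevNorm (N : (Phase → ℝ) → ℝ≥0∞) (u : Phase → ℝ) : ℝ≥0∞ :=
  ∑ m : Option (Fin 3), ∑ m' : Option (Fin 3),
    weakDerivNorm N (m.toList.map dirX ++ m'.toList.map dirV) u

/-- `‖u‖` in `W^{1,1}_{x,v} ∩ W^{1,∞}_{x,v}` plus `‖u‖` in
`W^{1,1}_x W^{1,∞}_v ∩ W^{1,1}_v W^{1,∞}_x`. -/
noncomputable def dataNorm (u : Phase → ℝ) : ℝ≥0∞ :=
  sobolevNorm 1 u + sobolevNorm ∞ u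
    + mixedSobolevNorm (normXV 1 ∞) u + mixedSobolevNorm (normVX 1 ∞) u

/-! ### The Vlasov--Riesz system -/

/-- The interaction potential `w(x) = λ / |x|^α`. -/
noncomputable def potential (α lam : ℝ) (x : E3) : ℝ := lam / ‖x‖ ^ α

/-- The spatial density `ρ_h(x) = ∫ h(x, v) dv`. -/
noncomputable def density (h : Phase → ℝ) (x : E3) : ℝ := ∫ v, h (x, v)

/-- The force field `E_h(x) = -∫ ∇w(x - y) ρ_h(y) dy`. -/
noncomputable def field (α lam : ℝ) (h : Phase → ℝ) (x : E3) : E3 :=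
  -∫ y, density h y • gradient (potential α lam) (x - y)

/-- `f` is a global solution of `∂_t f + v · ∇_x f + E_f · ∇_v f = 0`, `f(0) = f₀`, in the sense
of distributions on phase space. The class of solutions is: continuous in time with values in
`L¹ ∩ L^∞`, and bounded in `W^{1,1} ∩ W^{1,∞}` on compact time intervals. Only the values of `f`
at times `t ≥ 0` matter. -/
structure IsGlobalSolution (α lam : ℝ) (f₀ : Phase → ℝ) (f : ℝ → Phase → ℝ) : Prop where
  initial : f 0 =ᵐ[volume] f₀
  continuous : ∀ t : ℝ, 0 ≤ t →
    Tendsto (fun s => eLpNorm (f s - f t) 1 volume + eLpNorm (f s - f t) ∞ volume)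
      (𝓝[Set.Ici 0] t) (𝓝 0)
  bounded : ∀ T : ℝ, ∃ M : ℝ, ∀ t ∈ Set.Icc 0 T,
    sobolevNorm 1 (f t) + sobolevNorm ∞ (f t) ≤ ENNReal.ofReal M
  equation : ∀ φ : Phase → ℝ, ContDiff ℝ ∞ φ → HasCompactSupport φ →
    (∀ s : ℝ, 0 ≤ s → Integrable
      (fun z => f s z * fderiv ℝ φ z (z.2, field α lam (f s) z.1)) volume) ∧
    ∀ t : ℝ, 0 ≤ t →
      IntervalIntegrable
        (fun s => ∫ z, f s z * fderiv ℝ φ z (z.2, field α lam (f s) z.1)) volume 0 t ∧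
      ∫ z, f t z * φ z = (∫ z, f₀ z * φ z)
        + ∫ s in (0 : ℝ)..t, ∫ z, f s z * fderiv ℝ φ z (z.2, field α lam (f s) z.1)

/-- `sup_{t ≥ 0} (⟨t⟩^{1+α} ‖E_f(t)‖_∞ + ⟨t⟩^{2+α} ‖∇E_f(t)‖_∞ + ⟨t⟩³ ‖∇²E_f(t)‖_∞) ≤ K`. -/
def DispersionBound (α lam : ℝ) (f : ℝ → Phase → ℝ) (K : ℝ) : Prop :=
  ∀ t : ℝ, 0 ≤ t →
    ENNReal.ofReal (jap t ^ (1 + α)) * eLpNorm (field α lam (f t)) ∞ volume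
      + ENNReal.ofReal (jap t ^ (2 + α)) *
          (∑ i, weakDerivNorm (fun h => eLpNorm h ∞ volume) [dir i] (field α lam (f t)))
      + ENNReal.ofReal (jap t ^ (3 : ℕ)) *
          (∑ i, ∑ j, weakDerivNorm (fun h => eLpNorm h ∞ volume) [dir i, dir j]
            (field α lam (f t)))
    ≤ ENNReal.ofReal K

/-- `Φ(t)(x, v) = (𝒳(t,0,x,v), 𝒱(t,0,x,v))` is the forward characteristic flow of `f`:
`∂_t 𝒳 = 𝒱`, `∂_t 𝒱 = E_f(t, 𝒳)` for `t ≥ 0`, starting from `(x, v)` at `t = 0`. -/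
def IsCharacteristicFlow (α lam : ℝ) (f : ℝ → Phase → ℝ) (Φ : ℝ → Phase → Phase) : Prop :=
  ∀ z : Phase, Φ 0 z = z ∧ ∀ t : ℝ, 0 ≤ t →
    HasDerivWithinAt (fun s => Φ s z) ((Φ t z).2, field α lam (f t) (Φ t z).1) (Set.Ici 0) t

/-! ### The modified distribution -/

/-- The velocity correction `A_t(v) = -∬ ∇w(v - 𝒱(t,0,x',v')) f₀(x',v') dx' dv'`. -/
noncomputable def correction (α lam : ℝ) (f₀ : Phase → ℝ) (Φ : ℝ → Phase → Phase)
    (t : ℝ) (v : E3) : E3 :=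
  -∫ z, f₀ z • gradient (potential α lam) (v - (Φ t z).2)

/-- The reference flow `(x, v) ↦ (x + t v - (t^{1-α} - 1)/(1-α) A_t(v), v)`. -/
noncomputable def refFlow (α lam : ℝ) (f₀ : Phase → ℝ) (Φ : ℝ → Phase → Phase)
    (t : ℝ) (z : Phase) : Phase :=
  (z.1 + t • z.2 - ((t ^ (1 - α) - 1) / (1 - α)) • correction α lam f₀ Φ t z.2, z.2)

/-- The modified distribution `g(t, x, v) = f(t, Φ̃^ref(t)(x, v))`. -/
noncomputable def modifiedDistribution (α lam : ℝ) (f₀ : Phase → ℝ) (f : ℝ → Phase → ℝ)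
    (Φ : ℝ → Phase → Phase) (t : ℝ) (z : Phase) : ℝ :=
  f t (refFlow α lam f₀ Φ t z)

/-- The weighted norm `‖⟨x⟩ h‖_{L^∞_{x,v}}`. -/
noncomputable def weightedSup (h : Phase → ℝ) : ℝ≥0∞ :=
  eLpNorm (fun z : Phase => jap z.1 * h z) ∞ volume

end VlasovRiesz

open VlasovRiesz

set_option linter.unusedSectionVars false
namespace VlasovRiesz

/-! Since f is transported, g(t) is the datum composed with the map `pullback`: the modified
reference map at time t followed by the characteristic flow from t back to 0. Two facts about this
map suffice. It is Lipschitz, with a bounded constant in x and a constant O(t^{1-α}) in v, and ⟨x⟩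
is at most a constant times the bracket of the position of the image point.

The second fact is where the correction enters. Along a characteristic, X(t) - tV(t) = X(0) - ∫₀ᵗ σ
E(σ, X(σ)) dσ, and the available bound σ^{-α} on the integrand is not integrable. Liouville's
theorem and the homogeneity of ∇w give, with z running over initial data, E(σ, x) = -σ^{-1-α} ∫
f₀(z) ∇w(x/σ - X(σ,z)/σ) dz. Every X(σ)/σ differs from the later velocity V(t) by at most
σ^{-1}|X(0)| + σ^{-α}. Hence σ E(σ, X(σ)) = σ^{-α} A_t(V(t)) + O(⟨X(0)⟩ σ^{-2α}) for 1 ≤ σ ≤ t. The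
leading term integrates over [1, t] to exactly the correction in the reference map, and the
remainder is integrable because α > 1/2 (`norm_force_sub_correction_le`, `jap_le_mul_jap`).

Replacing the arguments of ∇w costs a Riesz potential with kernel |y|^{-(2+α)}, locally integrable
on ℝ³ because α < 1. For fixed x the maps v ↦ X(σ,x,v)/σ and v ↦ V(t,x,v) contract distances at most
by a factor 2, so the potential is controlled by the L¹ norm and the mixed norm L¹_x L^∞_v of the
datum (`lintegral_singular_le`). The weight ⟨x⟩ on the datum absorbs the dependence of the error on
the initial position of the trajectory integrated over.

The Lipschitz bounds come from a linear bootstrap for the difference of two trajectories, using the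
decay K(1+t)^{-(2+α)} of the Lipschitz constant of the force with K small
(`backward_sub_le_of_snd_eq`, `backward_sub_le_of_fst_sub`). The growth t^{1-α} comes from the shear
generated by A_t and from ∫(1+σ)^{-α}.

It remains to give meaning to the characteristics of a weak solution. The weak derivative bounds and
continuity in L¹ yield a representative E of the field, Lipschitz in space and continuous in time
(`exists_decayingForce`). Its flow preserves volume (`measurePreserving_flow`), and the solution is
constant along it by a mollification argument (`TransportSolution.apply_flow`). The resulting
formula shows that the field itself is continuous, hence equal to E at every point (`field_eq`), so
the given characteristic flow is the flow of E. -/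

instance : (volume : Measure Phase).IsAddHaarMeasure :=
  inferInstanceAs ((volume : Measure E3).prod (volume : Measure E3)).IsAddHaarMeasure

/-! ### Weak derivatives and Lipschitz representatives. -/

section Sobolev

variable {F : Type*} [NormedAddCommGroup F] [NormedSpace ℝ F]
variable {G : Type*} [NormedAddCommGroup G] [NormedSpace ℝ G]

theorem exists_isWeakDeriv_of_weakDerivNorm_lt [MeasureSpace F] {N : (F → G) → ℝ≥0∞} {l : List F}
    {u : F → G} {c : ℝ≥0∞} (h : weakDerivNorm N l u < c) :
    ∃ g, IsWeakDeriv l u g ∧ N g < c := by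
  simpa [weakDerivNorm, iInf_lt_iff] using h

variable [FiniteDimensional ℝ F] [MeasureSpace F] [BorelSpace F]
  [(volume : Measure F).IsAddHaarMeasure]

theorem IsWeakDeriv.ae_eq_of_nil [CompleteSpace G] {u g : F → G} (h : IsWeakDeriv [] u g) :
    u =ᵐ[volume] g := by
  refine ae_eq_of_integral_contDiff_smul_eq h.1 h.2.1 fun φ h1 h2 => ?_
  simpa [dirDeriv] using h.2.2 φ h1 h2

/-- The derivative of a mollification is the mollification of the weak derivative. -/
theorem IsWeakDeriv.norm_fderiv_convolution_le [CompleteSpace G] {u h : F → G} {e : F} {M : ℝ}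
    (hu : IsWeakDeriv [e] u h) (hM : ∀ᵐ z, ‖h z‖ ≤ M) (φ : ContDiffBump (0 : F)) (x : F) :
    ∃ D : F →L[ℝ] G,
      HasFDerivAt (convolution (φ.normed volume) u (ContinuousLinearMap.lsmul ℝ ℝ) volume) D x ∧
        ‖D e‖ ≤ M := by
  set θ := φ.normed (volume : Measure F) with hθ
  have hθs : ContDiff ℝ ∞ θ := φ.contDiff_normed
  have hθc : HasCompactSupport θ := φ.hasCompactSupport_normed
  have h1 := hθc.hasFDerivAt_convolution_left (ContinuousLinearMap.lsmul ℝ ℝ)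
    (hθs.of_le (by norm_cast)) hu.1 x
  refine ⟨_, h1, ?_⟩
  have hint : ConvolutionExistsAt (fderiv ℝ θ) u x
      ((ContinuousLinearMap.lsmul ℝ ℝ).precompL F) volume :=
    (hθc.fderiv ℝ).convolutionExists_left _ (hθs.continuous_fderiv (by simp)) hu.1 x
  -- The reflected bump centred at x is an admissible test function; testing the weak derivative
  -- against it moves the derivative from θ to u.
  set ψ : F → ℝ := fun z => θ (x - z) with hψ
  have hψs : ContDiff ℝ ∞ ψ := hθs.comp (contDiff_const.sub contDiff_id)
  have hψc : HasCompactSupport ψ := hθc.comp_homeomorph (Homeomorph.subLeft x)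
  have hfd : ∀ z, fderiv ℝ ψ z e = - fderiv ℝ θ (x - z) e := by
    intro z
    have h2 : HasFDerivAt ψ ((fderiv ℝ θ (x - z)).comp (-ContinuousLinearMap.id ℝ F)) z :=
      ((hθs.differentiable (by simp)) (x - z)).hasFDerivAt.comp z ((hasFDerivAt_id z).const_sub x)
    rw [h2.fderiv]; simp
  have key : (convolution (fderiv ℝ θ) u ((ContinuousLinearMap.lsmul ℝ ℝ).precompL F) volume x) e
      = ∫ z, ψ z • h z := by
    rw [convolution_def, ContinuousLinearMap.integral_apply hint]
    have h3 := hu.2.2 ψ hψs hψc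
    simp only [dirDeriv, List.foldr, hfd, List.length_cons, List.length_nil, zero_add, pow_one,
      neg_smul, one_smul, integral_neg, neg_inj] at h3
    rw [← h3, ← integral_sub_left_eq_self _ volume x]
    simp [ContinuousLinearMap.precompL_apply]
  rw [key]
  calc ‖∫ z, ψ z • h z‖ ≤ ∫ z, ψ z * M := by
        refine norm_integral_le_of_norm_le ((hψs.continuous.integrable_of_hasCompactSupport
          hψc).mul_const M) ?_
        filter_upwards [hM] with z hz
        have h0 : 0 ≤ ψ z := φ.nonneg_normed _
        rw [norm_smul, Real.norm_of_nonneg h0]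
        gcongr
    _ = M := by
        rw [integral_mul_const, hψ, integral_sub_left_eq_self θ volume x, hθ, φ.integral_normed,
          one_mul]

/-- A locally integrable function whose weak derivatives along a spanning family of directions are
bounded agrees almost everywhere with a Lipschitz function. -/
theorem exists_lipschitz_of_isWeakDeriv [FiniteDimensional ℝ G] [Nontrivial F]
    {ι : Type*} [Fintype ι] [Nonempty ι] {e : ι → F} {c : ι → F → ℝ}
    (hc : ∀ w, w = ∑ i, c i w • e i) (hc1 : ∀ i w, |c i w| ≤ ‖w‖)
    {u : F → G} {h : ι → F → G} {M : ι → ℝ}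
    (hu : ∀ i, IsWeakDeriv [e i] u (h i)) (hM : ∀ i, ∀ᵐ z, ‖h i z‖ ≤ M i) :
    ∃ v : F → G, u =ᵐ[volume] v ∧ ∀ x y, ‖v x - v y‖ ≤ (∑ i, M i) * ‖x - y‖ := by
  have : CompleteSpace G := FiniteDimensional.complete ℝ G
  have hM0 : ∀ i, 0 ≤ M i := fun i => by
    obtain ⟨z, hz⟩ := (hM i).exists
    exact (norm_nonneg _).trans hz
  -- The fixed ratio 2 between outer and inner radius is what the almost everywhere convergence of
  -- the mollifications requires.
  let φ : ℕ → ContDiffBump (0 : F) := fun n =>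
    ⟨1 / ((n : ℝ) + 1) , 2 * (1 / ((n : ℝ) + 1)), by positivity, by
      have : 0 < 1 / ((n : ℝ) + 1) := by positivity
      linarith⟩
  have hlim : Tendsto (fun n => (φ n).rOut) atTop (𝓝 0) := by
    have := (tendsto_one_div_add_atTop_nhds_zero_nat (𝕜 := ℝ)).const_mul 2
    simpa [φ] using this
  obtain ⟨i0⟩ := ‹Nonempty ι›
  have hae := ContDiffBump.ae_convolution_tendsto_right_of_locallyIntegrable (μ := volume)
    (K := 2) hlim (Eventually.of_forall fun n => le_rfl) (hu i0).1
  set U : ℕ → F → G := fun n =>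
    convolution ((φ n).normed volume) u (ContinuousLinearMap.lsmul ℝ ℝ) volume with hU
  have hULip : ∀ n x y, ‖U n x - U n y‖ ≤ (∑ i, M i) * ‖x - y‖ := by
    intro n x y
    have hD : ∀ z, DifferentiableAt ℝ (U n) z := fun z => by
      obtain ⟨D, hD, -⟩ := (hu i0).norm_fderiv_convolution_le (hM i0) (φ n) z
      exact hD.differentiableAt
    refine Convex.norm_image_sub_le_of_norm_fderiv_le (𝕜 := ℝ) (s := Set.univ)
      (fun z _ => hD z) (fun z _ => ?_) convex_univ (Set.mem_univ _) (Set.mem_univ _)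
    refine ContinuousLinearMap.opNorm_le_bound _ (Finset.sum_nonneg fun i _ => hM0 i) fun w => ?_
    conv_lhs => rw [hc w]
    rw [map_sum, Finset.sum_mul]
    refine (norm_sum_le _ _).trans (Finset.sum_le_sum fun i _ => ?_)
    obtain ⟨D, hD, hDe⟩ := (hu i).norm_fderiv_convolution_le (hM i) (φ n) z
    rw [map_smul, norm_smul, hD.fderiv, mul_comm]
    exact mul_le_mul hDe (hc1 i w) (abs_nonneg _) (hM0 i)
  set S : Set F := {x | Tendsto (fun n => U n x) atTop (𝓝 (u x))} with hS
  have hSd : Dense S := Measure.dense_of_ae hae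
  set L : NNReal := ⟨∑ i, M i, Finset.sum_nonneg fun i _ => hM0 i⟩ with hL
  have hSL : LipschitzOnWith L u S := by
    refine LipschitzOnWith.of_dist_le_mul fun x hx y hy => ?_
    rw [dist_eq_norm, dist_eq_norm]
    exact le_of_tendsto ((hx.sub hy).norm) (Eventually.of_forall fun n => hULip n x y)
  obtain ⟨v, hv, hve⟩ := hSL.extend_finite_dimension
  -- The finite-dimensional extension theorem enlarges the Lipschitz constant; density of S and
  -- continuity of v restore the sharp one.
  have hvL : LipschitzOnWith L v (closure S) :=
    LipschitzOnWith.closure hv.continuous.continuousOn (fun x hx y hy => by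
      rw [← hve hx, ← hve hy]; exact hSL hx hy)
  rw [hSd.closure_eq] at hvL
  refine ⟨v, ?_, fun x y => ?_⟩
  · filter_upwards [hae] with x hx using hve hx
  · have := hvL.dist_le_mul x (Set.mem_univ _) y (Set.mem_univ _)
    rwa [dist_eq_norm, dist_eq_norm] at this

theorem norm_le_of_ae_norm_le_of_continuous {v : F → G} (hv : Continuous v) {M : ℝ}
    (h : ∀ᵐ z, ‖v z‖ ≤ M) (z : F) : ‖v z‖ ≤ M := by
  have hd : Dense {z | ‖v z‖ ≤ M} := Measure.dense_of_ae h
  have hcl : IsClosed {z | ‖v z‖ ≤ M} := isClosed_le hv.norm continuous_const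
  have : z ∈ closure {z | ‖v z‖ ≤ M} := hd z
  rwa [hcl.closure_eq] at this

end Sobolev

/-! ### The Japanese bracket and weighted sup norms. -/

theorem one_le_jap {F : Type*} [SeminormedAddCommGroup F] (y : F) : 1 ≤ jap y := by
  unfold jap; rw [Real.one_le_sqrt]; nlinarith [sq_nonneg ‖y‖]

theorem jap_pos {F : Type*} [SeminormedAddCommGroup F] (y : F) : 0 < jap y :=
  one_pos.trans_le (one_le_jap y)

theorem continuous_jap {F : Type*} [SeminormedAddCommGroup F] : Continuous (jap : F → ℝ) := by
  unfold jap; fun_prop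

theorem weightedSup_le {h : Phase → ℝ} {B : ℝ} (hB : ∀ᵐ z, |jap z.1 * h z| ≤ B) :
    weightedSup h ≤ ENNReal.ofReal B := by
  refine eLpNorm_le_of_ae_bound (p := ∞) hB |>.trans ?_
  simp

/-- The weighted norm of the weak derivative of a Lipschitz function is controlled by pointwise
difference quotients. -/
theorem weakDerivNorm_weightedSup_le {u v : Phase → ℝ} {L : NNReal} (hv : LipschitzWith L v)
    (huv : u =ᵐ[volume] v) {e : Phase} {B : ℝ} (hB0 : 0 ≤ B)
    (hB : ∀ z, ∀ h : ℝ, |v (z + h • e) - v z| ≤ B / jap z.1 * |h|) :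
    weakDerivNorm weightedSup [e] u ≤ ENNReal.ofReal B := by
  -- For a Lipschitz function the line derivative exists almost everywhere and obeys integration by
  -- parts, so it is a weak derivative.
  have hw : IsWeakDeriv [e] u (fun z => lineDeriv ℝ v z e) := by
    refine ⟨(hv.continuous.locallyIntegrable).congr huv.symm,
      hv.locallyIntegrable_lineDeriv e, fun φ hφ hφc => ?_⟩
    have hφL : ∃ D, LipschitzWith D φ := by
      exact hφ.lipschitzWith_of_hasCompactSupport hφc (by simp)
    obtain ⟨D, hD⟩ := hφL
    have h1 := hv.integral_lineDeriv_mul_eq (μ := volume) hD hφc e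
    have h2 : ∀ z, lineDeriv ℝ φ z (-e) = - fderiv ℝ φ z e := fun z => by
      rw [((hφ.differentiable (by simp)) z).lineDeriv_eq_fderiv, map_neg]
    simp only [h2, neg_mul, integral_neg] at h1
    simp only [dirDeriv, List.foldr, List.length_cons, List.length_nil, zero_add, pow_one,
      smul_eq_mul]
    have h3 : ∫ z, fderiv ℝ φ z e * u z = ∫ z, fderiv ℝ φ z e * v z := by
      refine integral_congr_ae ?_
      filter_upwards [huv] with z hz
      rw [hz]
    rw [h3]
    simp only [mul_comm (φ _)]
    rw [h1, neg_one_mul, neg_neg]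
  refine (iInf₂_le _ hw).trans (weightedSup_le (Eventually.of_forall fun z => ?_))
  have hj := jap_pos z.1
  rw [abs_mul, abs_of_pos hj, ← le_div_iff₀' hj]
  -- Where the line derivative does not exist it takes the default value 0, so the bound holds at
  -- every point.
  by_cases hd : LineDifferentiableAt ℝ v z e
  · have := HasDerivAt.le_of_lip' (f := fun t : ℝ => v (z + t • e)) (C := B / jap z.1)
      hd.hasLineDerivAt (by positivity) (Eventually.of_forall fun t => by
        simpa using hB z t)
    simpa using this
  · rw [lineDeriv_zero_of_not_lineDifferentiableAt hd]
    simp; positivity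

/-! ### The Riesz kernel -/

theorem hasGradientAt_potential {α lam : ℝ} {x : E3} (hx : x ≠ 0) :
    HasGradientAt (potential α lam) (-(α * lam) • (‖x‖ ^ (-(α + 2)) • x)) x := by
  have hn : 0 < ‖x‖ := norm_pos_iff.2 hx
  have h1 : HasFDerivAt (fun y : E3 => ‖y‖ ^ 2) (2 • innerSL ℝ x) x :=
    (hasStrictFDerivAt_norm_sq x).hasFDerivAt
  have h2 := (h1.rpow_const (p := -(α / 2)) (Or.inl (by positivity))).const_mul lam
  rw [hasGradientAt_iff_hasFDerivAt]
  have h3 : potential α lam = fun y : E3 => lam * (‖y‖ ^ 2) ^ (-(α / 2)) := by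
    ext y
    rw [potential, ← Real.rpow_natCast, ← Real.rpow_mul (norm_nonneg _), div_eq_mul_inv,
      ← Real.rpow_neg (norm_nonneg _)]
    congr 2; push_cast; ring
  rw [h3]
  refine h2.congr_fderiv ?_
  ext y
  have h4 : (‖x‖ ^ 2) ^ (-(α / 2) - 1) = ‖x‖ ^ (-(α + 2)) := by
    rw [← Real.rpow_natCast, ← Real.rpow_mul (norm_nonneg _)]
    congr 1; push_cast; ring
  rw [h4]
  simp only [smul_apply, nsmul_eq_mul, smul_eq_mul, innerSL_apply_apply, InnerProductSpace.toDual_apply_apply,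
    inner_smul_left, map_mul, map_neg, conj_trivial]
  push_cast
  ring

/-- By the conventions for `0 ^ α` and division by zero the potential is 0 at the origin, but at
points of norm at most 1 along a sequence tending to 0 its modulus is at least |lam|, so it is not
even continuous there. -/
theorem not_differentiableAt_potential_zero {α lam : ℝ} (hα : 0 < α) (hlam : lam ≠ 0) :
    ¬ DifferentiableAt ℝ (potential α lam) 0 := by
  intro h
  have hc := h.continuousAt.tendsto
  have h0 : potential α lam 0 = 0 := by simp [potential, Real.zero_rpow hα.ne']
  rw [h0] at hc
  have hseq : Tendsto (fun n : ℕ => (1 / ((n : ℝ) + 1)) • dir 0) atTop (𝓝 0) := by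
    have := (tendsto_one_div_add_atTop_nhds_zero_nat (𝕜 := ℝ)).smul_const (dir 0)
    simpa using this
  have h1 := (hc.comp hseq).norm
  rw [norm_zero] at h1
  have h2 : ∀ n : ℕ, |lam| ≤ ‖(potential α lam ∘ fun n : ℕ => (1 / ((n : ℝ) + 1)) • dir 0) n‖ := by
    intro n
    have hp : (0 : ℝ) < 1 / ((n : ℝ) + 1) := by positivity
    have hnorm : ‖(1 / ((n : ℝ) + 1)) • dir 0‖ = 1 / ((n : ℝ) + 1) := by
      rw [norm_smul, dir, PiLp.norm_single, norm_one, mul_one, Real.norm_of_nonneg hp.le]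
    simp only [Function.comp, potential, norm_div, hnorm]
    rw [Real.norm_eq_abs, Real.norm_of_nonneg (Real.rpow_nonneg hp.le _)]
    refine le_div_self (abs_nonneg _) (Real.rpow_pos_of_pos hp _) (Real.rpow_le_one hp.le ?_ hα.le)
    rw [div_le_one (by positivity)]; linarith [n.cast_nonneg (α := ℝ)]
  have := ge_of_tendsto h1 (Eventually.of_forall h2)
  exact absurd (abs_pos.2 hlam) (not_lt.2 this)

/-- At the origin both sides vanish: the left by the default value of the gradient, the right
through the factor x. No exceptional point has to be carried along later. -/
theorem gradient_potential {α lam : ℝ} (hα : 0 < α) (hlam : lam ≠ 0) (x : E3) :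
    gradient (potential α lam) x = -(α * lam) • (‖x‖ ^ (-(α + 2)) • x) := by
  rcases eq_or_ne x 0 with rfl | hx
  · rw [gradient_eq_zero_of_not_differentiableAt (not_differentiableAt_potential_zero hα hlam)]
    simp
  · exact (hasGradientAt_potential hx).gradient

/-- The vector field `|x|^{-p} x`. -/
noncomputable def riesz (p : ℝ) (x : E3) : E3 := ‖x‖ ^ (-p) • x

theorem norm_riesz {p : ℝ} (hp : 1 < p) (x : E3) : ‖riesz p x‖ = ‖x‖ ^ (1 - p) := by
  rcases eq_or_ne x 0 with rfl | hx
  · simp [riesz, Real.zero_rpow (by linarith : (1 - p) ≠ 0)]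
  · have hn : 0 < ‖x‖ := norm_pos_iff.2 hx
    rw [riesz, norm_smul, Real.norm_of_nonneg (by positivity)]
    conv_lhs => rw [← Real.rpow_one ‖x‖]
    rw [← Real.rpow_mul hn.le, ← Real.rpow_add hn]
    congr 1; ring

theorem riesz_smul {p s : ℝ} (hs : 0 < s) (x : E3) : riesz p (s • x) = s ^ (1 - p) • riesz p x := by
  rw [riesz, riesz, norm_smul, Real.norm_of_nonneg hs.le, Real.mul_rpow hs.le (norm_nonneg _),
    smul_smul, smul_smul, sub_eq_neg_add, Real.rpow_add hs, Real.rpow_one]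
  congr 1; ring

theorem measurable_riesz {p : ℝ} : Measurable (riesz p) := by
  unfold riesz; fun_prop

/-- The difference is split into |a|^{-p}(a - b) and a radial part depending only on r = |b|/|a|.
This avoids integrating the derivative along the segment from a to b, which may meet the
singularity. -/
theorem norm_riesz_sub_le_of_norm_le {p : ℝ} (hp : 0 ≤ p) (hp3 : p ≤ 3) {a b : E3} (hb0 : b ≠ 0)
    (hab : ‖a‖ ≤ ‖b‖) : ‖riesz p a - riesz p b‖ ≤ 4 * ‖a - b‖ * (‖a‖ ^ (-p) + ‖b‖ ^ (-p)) := by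
  have hb : 0 < ‖b‖ := norm_pos_iff.2 hb0
  rcases eq_or_ne a 0 with rfl | ha0
  · have h1 : 0 ≤ ‖(0 : E3)‖ ^ (-p) := Real.rpow_nonneg (norm_nonneg _) _
    have h2 : 0 ≤ ‖b‖ ^ (-p) := Real.rpow_nonneg hb.le _
    have : ‖riesz p (0 : E3) - riesz p b‖ = ‖b‖ ^ (-p) * ‖b‖ := by
      simp [riesz, norm_smul, Real.norm_of_nonneg h2]
    rw [this, zero_sub, norm_neg]
    nlinarith [mul_nonneg hb.le h1, mul_nonneg hb.le h2]
  have ha : 0 < ‖a‖ := norm_pos_iff.2 ha0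
  have hA : 0 < ‖a‖ ^ (-p) := Real.rpow_pos_of_pos ha _
  have hB : 0 < ‖b‖ ^ (-p) := Real.rpow_pos_of_pos hb _
  have hAB : ‖b‖ ^ (-p) ≤ ‖a‖ ^ (-p) := Real.rpow_le_rpow_of_nonpos ha hab (by linarith)
  have hdist : ‖b‖ - ‖a‖ ≤ ‖a - b‖ := by rw [norm_sub_rev]; exact norm_sub_norm_le b a
  have hr : 1 ≤ ‖b‖ / ‖a‖ := (one_le_div ha).2 hab
  have hdec : ‖b‖ ^ (-p) = ‖a‖ ^ (-p) * (‖b‖ / ‖a‖) ^ (-p) := by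
    rw [← Real.mul_rpow ha.le (by positivity), mul_div_cancel₀ _ ha.ne']
  have hr3 : (‖b‖ / ‖a‖) ^ (-(3 : ℝ)) ≤ (‖b‖ / ‖a‖) ^ (-p) :=
    Real.rpow_le_rpow_of_exponent_le hr (by linarith)
  have hr3' : (‖b‖ / ‖a‖) ^ (-(3 : ℝ)) = ((‖b‖ / ‖a‖) ^ 3)⁻¹ := by
    rw [Real.rpow_neg (by positivity)]; norm_cast
  have hmain : (1 - (‖b‖ / ‖a‖) ^ (-p)) * ‖b‖ ≤ 3 * (‖b‖ - ‖a‖) := by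
    rw [hr3'] at hr3
    set r := ‖b‖ / ‖a‖ with hrdef
    have hbr : ‖b‖ = r * ‖a‖ := by rw [hrdef]; field_simp
    -- This is 3 ≤ 2r + r⁻², an instance of the arithmetic-geometric mean inequality; p ≤ 3 reduces
    -- the general exponent to this one.
    have : (1 - r⁻¹ ^ 3) * r ≤ 3 * (r - 1) := by
      have hi : r⁻¹ * r = 1 := inv_mul_cancel₀ (by positivity)
      have hi1 : r⁻¹ ≤ 1 := inv_le_one_of_one_le₀ hr
      have hi0 : 0 < r⁻¹ := by positivity
      have : r⁻¹ ^ 3 * r = r⁻¹ ^ 2 := by rw [pow_succ, mul_assoc, hi, mul_one]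
      have h5 : 2 ≤ r + r⁻¹ := by nlinarith [sq_nonneg (r - 1)]
      nlinarith [sq_nonneg (r⁻¹ - 1), mul_nonneg (sub_nonneg.2 hr) (sub_nonneg.2 hi1)]
    rw [hbr]
    rw [inv_pow] at this
    have h6 : (1 - r ^ (-p)) * r ≤ 3 * (r - 1) := le_trans (by gcongr) this
    nlinarith
  have hsplit : riesz p a - riesz p b
      = ‖a‖ ^ (-p) • (a - b) + (‖a‖ ^ (-p) * (1 - (‖b‖ / ‖a‖) ^ (-p))) • b := by
    rw [riesz, riesz, hdec, smul_sub, mul_sub, mul_one, sub_smul]; abel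
  have h1r : 0 ≤ 1 - (‖b‖ / ‖a‖) ^ (-p) :=
    sub_nonneg.2 (Real.rpow_le_one_of_one_le_of_nonpos hr (by linarith))
  rw [hsplit]
  refine (norm_add_le _ _).trans ?_
  rw [norm_smul, norm_smul, Real.norm_of_nonneg hA.le, Real.norm_of_nonneg (by positivity), mul_assoc]
  have : ‖a‖ ^ (-p) * ((1 - (‖b‖ / ‖a‖) ^ (-p)) * ‖b‖) ≤ ‖a‖ ^ (-p) * (3 * ‖a - b‖) :=
    mul_le_mul_of_nonneg_left (by linarith) hA.le
  nlinarith [mul_nonneg (norm_nonneg (a - b)) hB.le]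

theorem norm_riesz_sub_le {p : ℝ} (hp : 0 ≤ p) (hp3 : p ≤ 3) (a b : E3) :
    ‖riesz p a - riesz p b‖ ≤ 4 * ‖a - b‖ * (‖a‖ ^ (-p) + ‖b‖ ^ (-p)) := by
  rcases le_total ‖a‖ ‖b‖ with h | h
  · rcases eq_or_ne b 0 with rfl | hb
    · have : a = 0 := by simpa using h
      simp [this]
    · exact norm_riesz_sub_le_of_norm_le hp hp3 hb h
  · rcases eq_or_ne a 0 with rfl | ha
    · have : b = 0 := by simpa using h
      simp [this]
    · rw [norm_sub_rev, norm_sub_rev a, add_comm]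
      exact norm_riesz_sub_le_of_norm_le hp hp3 ha h

/-! ### Singular integrals along expanding maps -/

/-- The integral of `|x|^{-p}` over the unit ball of `ℝ³`. -/
noncomputable def ballMass (p : ℝ) : ℝ≥0∞ :=
  ∫⁻ x in Metric.ball (0 : E3) 1, ENNReal.ofReal (‖x‖ ^ (-p))

theorem ballMass_lt_top {p : ℝ} (hp3 : p < 3) : ballMass p < ⊤ := by
  have h := integrableOn_ball_of_norm_le_rpow (μ := (volume : Measure E3)) (f := fun x : E3 => ‖x‖ ^ (-p)) (C := 1) (α := p) (r := 1)
    (by simp) (by simpa using hp3) (Eventually.of_forall fun x => by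
      rw [one_mul, Real.norm_of_nonneg (Real.rpow_nonneg (norm_nonneg _) _)]) (by
      apply Measurable.aestronglyMeasurable; fun_prop)
  have h2 := h.2
  rw [hasFiniteIntegral_iff_ofReal (Eventually.of_forall fun x =>
    Real.rpow_nonneg (norm_nonneg _) _)] at h2
  exact h2

/-- Inside the unit ball about a the density is at most H and the kernel has mass `ballMass p`;
outside, the kernel is at most 1. -/
theorem lintegral_rpow_norm_sub_mul_le {p : ℝ} (hp : 0 ≤ p) (a : E3) {h : E3 → ℝ≥0∞} {H : ℝ≥0∞}
    (hH : ∀ᵐ v, h v ≤ H) :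
    ∫⁻ v, ENNReal.ofReal (‖v - a‖ ^ (-p)) * h v ≤ ballMass p * H + ∫⁻ v, h v := by
  rw [← lintegral_add_compl _ (Metric.isOpen_ball (x := a) (ε := 1)).measurableSet]
  refine add_le_add ?_ ?_
  · calc ∫⁻ v in Metric.ball a 1, ENNReal.ofReal (‖v - a‖ ^ (-p)) * h v
        ≤ ∫⁻ v in Metric.ball a 1, ENNReal.ofReal (‖v - a‖ ^ (-p)) * H := by
          refine lintegral_mono_ae ?_
          filter_upwards [ae_restrict_of_ae hH] with v hv
          gcongr
      _ = (∫⁻ v in Metric.ball a 1, ENNReal.ofReal (‖v - a‖ ^ (-p))) * H :=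
          lintegral_mul_const _ (by fun_prop)
      _ = ballMass p * H := by
          congr 1
          have := (measurePreserving_sub_right (volume : Measure E3) a).setLIntegral_comp_preimage
            (Metric.isOpen_ball (x := (0 : E3)) (ε := 1)).measurableSet
            (f := fun v => ENNReal.ofReal (‖v‖ ^ (-p))) (by fun_prop)
          rw [ballMass, ← this]
          congr 2
          ext v; simp [dist_eq_norm]
  · refine (setLIntegral_mono' Metric.isOpen_ball.measurableSet.compl fun v hv => ?_).trans
      (setLIntegral_le_lintegral _ _)
    have hv1 : 1 ≤ ‖v - a‖ := by simpa [dist_eq_norm] using hv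
    calc ENNReal.ofReal (‖v - a‖ ^ (-p)) * h v ≤ 1 * h v := by
          gcongr
          rw [ENNReal.ofReal_le_one]
          exact Real.rpow_le_one_of_one_le_of_nonpos hv1 (by linarith)
      _ = h v := one_mul _

/-- Expansion replaces a change of variables: neither differentiability nor surjectivity of Y is
needed. Instead of a preimage of a, one takes a point v₀ minimising |a - Y v|; then |v - v₀| ≤ 4|a -
Y v|, and 64 = 4³ bounds 4^p. -/
theorem lintegral_rpow_norm_comp_mul_le {p : ℝ} (hp : 0 ≤ p) (hp3 : p ≤ 3) {Y : E3 → E3}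
    (hYc : Continuous Y) (hY : ∀ v v', ‖v - v'‖ ≤ 2 * ‖Y v - Y v'‖) (a : E3)
    {h : E3 → ℝ≥0∞} {H : ℝ≥0∞} (hH : ∀ᵐ v, h v ≤ H) :
    ∫⁻ v, ENNReal.ofReal (‖a - Y v‖ ^ (-p)) * h v ≤ 64 * (ballMass p * H + ∫⁻ v, h v) := by
  obtain ⟨v₀, hv₀⟩ : ∃ v₀, ∀ v, ‖a - Y v₀‖ ≤ ‖a - Y v‖ := by
    refine Continuous.exists_forall_le (by fun_prop) ?_
    refine tendsto_atTop_mono (f := fun v => 1 / 2 * ‖v‖ + (-‖a - Y 0‖)) (fun v => ?_)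
      (tendsto_atTop_add_const_right _ _
        ((tendsto_norm_cocompact_atTop).const_mul_atTop (by norm_num)))
    have h1 := hY v 0
    have h2 : ‖Y v - Y 0‖ ≤ ‖a - Y v‖ + ‖a - Y 0‖ := by
      have := norm_sub_le (a - Y 0) (a - Y v)
      rw [sub_sub_sub_cancel_left] at this
      linarith
    rw [sub_zero] at h1
    linarith
  refine le_trans ?_ (mul_le_mul_right (lintegral_rpow_norm_sub_mul_le hp v₀ hH) 64)
  rw [← lintegral_const_mul' _ _ (by norm_num)]
  refine lintegral_mono_ae ?_
  have hne : ∀ᵐ v : E3, v ≠ v₀ := by simp [ae_iff]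
  filter_upwards [hne] with v hv
  rw [← mul_assoc]
  gcongr
  have h64 : (64 : ℝ≥0∞) = ENNReal.ofReal 64 := by simp
  rw [h64, ← ENNReal.ofReal_mul (by norm_num)]
  refine ENNReal.ofReal_le_ofReal ?_
  have hpos : 0 < ‖v - v₀‖ := norm_pos_iff.2 (sub_ne_zero.2 hv)
  have hle : ‖v - v₀‖ ≤ 4 * ‖a - Y v‖ := by
    have h1 := hY v v₀
    have h2 : ‖Y v - Y v₀‖ ≤ ‖a - Y v₀‖ + ‖a - Y v‖ := by
      have := norm_sub_le (a - Y v₀) (a - Y v)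
      rwa [sub_sub_sub_cancel_left] at this
    linarith [hv₀ v]
  have hle' : ‖v - v₀‖ / 4 ≤ ‖a - Y v‖ := by linarith
  calc ‖a - Y v‖ ^ (-p) ≤ (‖v - v₀‖ / 4) ^ (-p) :=
        Real.rpow_le_rpow_of_nonpos (by positivity) hle' (by linarith)
    _ = 4 ^ p * ‖v - v₀‖ ^ (-p) := by
        rw [Real.div_rpow hpos.le (by norm_num), Real.rpow_neg (by norm_num : (0 : ℝ) ≤ 4)]
        field_simp
    _ ≤ 64 * ‖v - v₀‖ ^ (-p) := by
        gcongr
        calc (4 : ℝ) ^ p ≤ 4 ^ (3 : ℝ) := Real.rpow_le_rpow_of_exponent_le (by norm_num) hp3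
          _ = 64 := by norm_num

/-! ### Decaying force fields and their flows -/

/-- A continuous force field decaying in time like the field of a dispersing solution. -/
structure DecayingForce (α K : ℝ) (E : ℝ → E3 → E3) : Prop where
  half_lt : 1 / 2 < α
  lt_one : α < 1
  nonneg : 0 ≤ K
  continuous : Continuous fun p : ℝ × E3 => E p.1 p.2
  decay_le : ∀ t x, ‖E t x‖ ≤ K * (1 + |t|) ^ (-(1 + α))
  lipschitz_le : ∀ t x y, ‖E t x - E t y‖ ≤ K * (1 + |t|) ^ (-(2 + α)) * ‖x - y‖

/-- The right-hand side of the characteristic equations. -/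
def phaseField (E : ℝ → E3 → E3) (t : ℝ) (z : Phase) : Phase := (z.2, E t z.1)

/-- A trajectory of the characteristic equations, defined for all times. -/
def IsTrajectory (E : ℝ → E3 → E3) (γ : ℝ → Phase) : Prop :=
  ∀ t, HasDerivAt γ (phaseField E t (γ t)) t

variable {α K : ℝ} {E : ℝ → E3 → E3}

theorem rpow_one_add_abs_le_one {β : ℝ} (hβ : 0 ≤ β) (t : ℝ) : (1 + |t|) ^ (-β) ≤ 1 :=
  Real.rpow_le_one_of_one_le_of_nonpos (by linarith [abs_nonneg t]) (by linarith)

namespace DecayingForce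

theorem alpha_pos (h : DecayingForce α K E) : 0 < α := by linarith [h.half_lt]

theorem norm_le_const (h : DecayingForce α K E) (t : ℝ) (x : E3) : ‖E t x‖ ≤ K :=
  (h.decay_le t x).trans (mul_le_of_le_one_right h.nonneg
    (rpow_one_add_abs_le_one (by linarith [h.alpha_pos]) t))

theorem lipschitz_le_const (h : DecayingForce α K E) (t : ℝ) (x y : E3) :
    ‖E t x - E t y‖ ≤ K * ‖x - y‖ :=
  (h.lipschitz_le t x y).trans (mul_le_mul_of_nonneg_right (mul_le_of_le_one_right h.nonneg
    (rpow_one_add_abs_le_one (by linarith [h.alpha_pos]) t)) (norm_nonneg _))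

theorem continuous_apply (h : DecayingForce α K E) (t : ℝ) : Continuous (E t) :=
  h.continuous.comp (by fun_prop : Continuous fun x : E3 => (t, x))

/-- The Lipschitz constant of the phase space field. -/
noncomputable def lip (_ : DecayingForce α K E) : NNReal := max 1 K.toNNReal

theorem lipschitzWith_phaseField (h : DecayingForce α K E) (t : ℝ) :
    LipschitzWith h.lip (phaseField E t) := by
  refine LipschitzWith.of_dist_le_mul fun z z' => ?_
  have hl1 : (1 : ℝ) ≤ h.lip := by
    have : (1 : NNReal) ≤ h.lip := le_max_left _ _
    exact_mod_cast this
  have hlK : K ≤ h.lip := by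
    have h1 : K.toNNReal ≤ h.lip := le_max_right _ _
    have h2 : (K.toNNReal : ℝ) ≤ h.lip := by exact_mod_cast h1
    rwa [Real.coe_toNNReal _ h.nonneg] at h2
  rw [dist_eq_norm, dist_eq_norm, Prod.norm_def]
  refine max_le ?_ ?_
  · change ‖z.2 - z'.2‖ ≤ _
    have := norm_snd_le (z - z')
    have h0 := norm_nonneg (z - z')
    have : ‖z.2 - z'.2‖ ≤ ‖z - z'‖ := this
    nlinarith
  · change ‖E t z.1 - E t z'.1‖ ≤ _
    have h1 : ‖z.1 - z'.1‖ ≤ ‖z - z'‖ := norm_fst_le (z - z')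
    refine (h.lipschitz_le_const t _ _).trans ?_
    gcongr

theorem exists_local_trajectory (h : DecayingForce α K E) (s : ℝ) (z : Phase) {T : ℝ} (hT : 0 < T) :
    ∃ γ : ℝ → Phase, γ s = z ∧
      ∀ t ∈ Set.Ioo (s - T) (s + T), HasDerivAt γ (phaseField E t (γ t)) t := by
  have hK := h.nonneg
  -- The equations are solved for p = (x - (t - s)v, v). Removing free transport makes the
  -- right-hand side bounded on all of phase space, so Picard–Lindelöf reaches any prescribed T; the
  -- field (v, E) itself is unbounded.
  set c : ℝ → Phase → Phase := fun t p =>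
    (-((t - s) • E t (p.1 + (t - s) • p.2)), E t (p.1 + (t - s) • p.2)) with hc
  set L : NNReal := ⟨(T + 1) * K, by positivity⟩
  set L' : NNReal := ⟨(T + 1) * (K * (1 + T)), by positivity⟩
  have hs : s ∈ Set.Icc (s - T) (s + T) := ⟨by linarith, by linarith⟩
  have habs : ∀ t ∈ Set.Icc (s - T) (s + T), |t - s| ≤ T := fun t ht =>
    abs_le.2 ⟨by linarith [ht.1], by linarith [ht.2]⟩
  have hPL : IsPicardLindelof c (⟨s, hs⟩ : Set.Icc (s - T) (s + T)) z (L * ⟨T, hT.le⟩) 0 L L' := by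
    refine ⟨fun t ht => ?_, fun p _ => ?_, fun t ht p _ => ?_, ?_⟩
    · refine LipschitzWith.lipschitzOnWith (LipschitzWith.of_dist_le_mul fun p q => ?_)
      rw [dist_eq_norm, dist_eq_norm]
      have h1 : ‖p.1 - q.1‖ ≤ ‖p - q‖ := norm_fst_le (p - q)
      have h2 : ‖p.2 - q.2‖ ≤ ‖p - q‖ := norm_snd_le (p - q)
      have h0 : ‖p.1 + (t - s) • p.2 - (q.1 + (t - s) • q.2)‖ ≤ (1 + T) * ‖p - q‖ := by
        have : p.1 + (t - s) • p.2 - (q.1 + (t - s) • q.2)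
            = (p.1 - q.1) + (t - s) • (p.2 - q.2) := by module
        rw [this]
        refine (norm_add_le _ _).trans ?_
        rw [norm_smul, Real.norm_eq_abs, add_mul, one_mul]
        gcongr
        exact habs t ht
      have h3 : ‖E t (p.1 + (t - s) • p.2) - E t (q.1 + (t - s) • q.2)‖ ≤ K * (1 + T) * ‖p - q‖ := by
        refine (h.lipschitz_le_const t _ _).trans ?_
        rw [mul_assoc]; gcongr
      have h4 : 0 ≤ K * (1 + T) * ‖p - q‖ := by positivity
      have hL' : (L' : ℝ) = (T + 1) * (K * (1 + T)) := rfl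
      rw [Prod.norm_def, hL']
      refine max_le ?_ ?_
      · have : (c t p - c t q).1
            = -((t - s) • (E t (p.1 + (t - s) • p.2) - E t (q.1 + (t - s) • q.2))) := by
          simp only [hc, Prod.fst_sub]; module
        rw [this, norm_neg, norm_smul, Real.norm_eq_abs]
        calc _ ≤ T * (K * (1 + T) * ‖p - q‖) := by gcongr; exact habs t ht
          _ ≤ _ := by nlinarith
      · change ‖E t (p.1 + (t - s) • p.2) - E t (q.1 + (t - s) • q.2)‖ ≤ _
        nlinarith
    · have h1 : Continuous fun t : ℝ => E t (p.1 + (t - s) • p.2) :=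
        h.continuous.comp (by fun_prop : Continuous fun t : ℝ => (t, p.1 + (t - s) • p.2))
      simp only [hc]
      exact (((continuous_id.sub continuous_const).smul h1).neg.prodMk h1).continuousOn
    · have h1 := h.norm_le_const t (p.1 + (t - s) • p.2)
      have hL : (L : ℝ) = (T + 1) * K := rfl
      rw [Prod.norm_def, hL]
      refine max_le ?_ ?_
      · change ‖-((t - s) • E t (p.1 + (t - s) • p.2))‖ ≤ _
        rw [norm_neg, norm_smul, Real.norm_eq_abs]
        calc _ ≤ T * K := by gcongr; exact habs t ht
          _ ≤ _ := by nlinarith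
      · change ‖E t (p.1 + (t - s) • p.2)‖ ≤ _
        nlinarith
    · have : max (s + T - s) (s - (s - T)) = T := by simp
      simp only [this, NNReal.coe_zero, sub_zero]
      exact le_of_eq (NNReal.coe_mul L ⟨T, hT.le⟩).symm
  obtain ⟨p, hp0, hp⟩ := hPL.exists_eq_forall_mem_Icc_hasDerivWithinAt₀
  refine ⟨fun t => ((p t).1 + (t - s) • (p t).2, (p t).2), ?_, fun t ht => ?_⟩
  · simp only at hp0
    simp [hp0]
  · have h1 := (hp t (Set.Ioo_subset_Icc_self ht)).hasDerivAt (Icc_mem_nhds ht.1 ht.2)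
    have h2 : HasDerivAt (fun t => (p t).1) (c t (p t)).1 t :=
      ((hasFDerivAt_fst (p := p t)).comp_hasDerivAt t h1)
    have h3 : HasDerivAt (fun t => (p t).2) (c t (p t)).2 t :=
      ((hasFDerivAt_snd (p := p t)).comp_hasDerivAt t h1)
    have h4 := (h2.add (((hasDerivAt_id t).sub_const s).smul h3)).prodMk h3
    convert! h4 using 1
    simp [phaseField, hc]

theorem exists_trajectory (h : DecayingForce α K E) (s : ℝ) (z : Phase) :
    ∃ γ : ℝ → Phase, γ s = z ∧ IsTrajectory E γ := by
  choose γ hγ0 hγ using fun n : ℕ => h.exists_local_trajectory s z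
    (by positivity : (0 : ℝ) < (n : ℝ) + 1)
  have hagree : ∀ n m : ℕ, n ≤ m → ∀ t, |t - s| < (n : ℝ) + 1 → γ n t = γ m t := by
    intro n m hnm t ht
    have hnm' : (n : ℝ) ≤ m := by exact_mod_cast hnm
    refine ODE_solution_unique_of_mem_Ioo (v := phaseField E) (s := fun _ => Set.univ) (K := h.lip)
      (a := s - ((n : ℝ) + 1)) (b := s + ((n : ℝ) + 1)) (t₀ := s)
      (fun t _ => (h.lipschitzWith_phaseField t).lipschitzOnWith)
      ⟨by linarith [n.cast_nonneg (α := ℝ)], by linarith [n.cast_nonneg (α := ℝ)]⟩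
      (fun t ht => ⟨hγ n t ht, trivial⟩)
      (fun t ht => ⟨hγ m t ⟨by linarith [ht.1], by linarith [ht.2]⟩, trivial⟩)
      (by rw [hγ0, hγ0]) ?_
    rw [abs_lt] at ht
    exact ⟨by linarith, by linarith⟩
  -- The n-th local solution lives on |t - s| < n + 1, so this index is always admissible; near t
  -- the glued curve coincides with a single local solution.
  refine ⟨fun t => γ ⌈|t - s|⌉₊ t, hγ0 _, fun t => ?_⟩
  set m := ⌈|t - s|⌉₊ + 1 with hm
  have htm : |t - s| < m := by
    rw [hm]; push_cast
    linarith [Nat.le_ceil |t - s|]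
  have hev : (fun t => γ ⌈|t - s|⌉₊ t) =ᶠ[𝓝 t] γ m := by
    have : ∀ᶠ t' in 𝓝 t, |t' - s| < m :=
      (by fun_prop : Continuous fun t' : ℝ => |t' - s|).continuousAt.eventually_lt
        continuousAt_const htm
    filter_upwards [this] with t' ht'
    exact hagree _ _ (Nat.ceil_le.2 ht'.le) t' ((Nat.le_ceil _).trans_lt (lt_add_one _))
  have hval : γ ⌈|t - s|⌉₊ t = γ m t := hev.self_of_nhds
  simp only [hval]
  refine (hγ m t ?_).congr_of_eventuallyEq hev
  rw [abs_lt] at htm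
  exact ⟨by linarith, by linarith⟩

/-- The flow `flow t s z` of the characteristic equations from time `s` to time `t`. -/
noncomputable def flow (h : DecayingForce α K E) (t s : ℝ) (z : Phase) : Phase :=
  (h.exists_trajectory s z).choose t

theorem flow_self (h : DecayingForce α K E) (s : ℝ) (z : Phase) : h.flow s s z = z :=
  (h.exists_trajectory s z).choose_spec.1

theorem isTrajectory_flow (h : DecayingForce α K E) (s : ℝ) (z : Phase) :
    IsTrajectory E fun t => h.flow t s z :=
  (h.exists_trajectory s z).choose_spec.2

theorem eq_flow (h : DecayingForce α K E) {γ : ℝ → Phase} (hγ : IsTrajectory E γ) (s t : ℝ) :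
    γ t = h.flow t s (γ s) := by
  have := ODE_solution_unique_univ (v := phaseField E) (s := fun _ => Set.univ) (K := h.lip)
    (fun t => (h.lipschitzWith_phaseField t).lipschitzOnWith) (t₀ := s)
    (fun t => ⟨hγ t, trivial⟩) (fun t => ⟨h.isTrajectory_flow s (γ s) t, trivial⟩)
    (h.flow_self s (γ s)).symm
  exact congrFun this t

theorem flow_flow (h : DecayingForce α K E) (t s r : ℝ) (z : Phase) :
    h.flow t s (h.flow s r z) = h.flow t r z :=
  (h.eq_flow (h.isTrajectory_flow r z) s t).symm

theorem dist_flow_le_of_le (h : DecayingForce α K E) {t s : ℝ} (hst : s ≤ t) (z z' : Phase) :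
    dist (h.flow t s z) (h.flow t s z') ≤ dist z z' * Real.exp (h.lip * (t - s)) := by
  have hγ := fun z => h.isTrajectory_flow s z
  have hc : ∀ z, ContinuousOn (fun t => h.flow t s z) (Set.Icc s t) := fun z =>
    (continuous_iff_continuousAt.2 fun t => (hγ z t).continuousAt).continuousOn
  exact dist_le_of_trajectories_ODE (v := phaseField E) h.lipschitzWith_phaseField (hc z)
    (fun t _ => (hγ z t).hasDerivWithinAt) (hc z') (fun t _ => (hγ z' t).hasDerivWithinAt)
    (by rw [h.flow_self, h.flow_self]) t ⟨hst, le_rfl⟩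

theorem dist_flow_le_of_ge (h : DecayingForce α K E) {t s : ℝ} (hst : t ≤ s) (z z' : Phase) :
    dist (h.flow t s z) (h.flow t s z') ≤ dist z z' * Real.exp (h.lip * (s - t)) := by
  -- Reversing time turns the backward estimate into a forward Grönwall estimate for the negated
  -- field.
  have hγ : ∀ z τ, HasDerivAt (fun τ => h.flow (-τ) s z) (-phaseField E (-τ) (h.flow (-τ) s z)) τ :=
    fun z τ => by
      have := (h.isTrajectory_flow s z (-τ)).scomp τ (hasDerivAt_neg τ)
      rw [neg_one_smul] at this
      exact this
  have hc : ∀ z, ContinuousOn (fun τ => h.flow (-τ) s z) (Set.Icc (-s) (-t)) := fun z =>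
    (continuous_iff_continuousAt.2 fun t => (hγ z t).continuousAt).continuousOn
  have := dist_le_of_trajectories_ODE (v := fun τ z => -phaseField E (-τ) z) (δ := dist z z')
    (fun τ => (h.lipschitzWith_phaseField (-τ)).neg) (hc z)
    (fun t _ => (hγ z t).hasDerivWithinAt) (hc z') (fun t _ => (hγ z' t).hasDerivWithinAt)
    (by rw [neg_neg, h.flow_self, h.flow_self]) (-t) ⟨by linarith, le_rfl⟩
  rw [neg_neg] at this
  convert this using 3
  ring

theorem continuous_flow (h : DecayingForce α K E) (t s : ℝ) : Continuous (h.flow t s) := by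
  rcases le_total s t with hst | hst
  · exact (LipschitzWith.of_dist_le_mul (K := ⟨_, (Real.exp_pos (h.lip * (t - s))).le⟩)
      fun z z' => by rw [mul_comm]; exact h.dist_flow_le_of_le hst z z').continuous
  · exact (LipschitzWith.of_dist_le_mul (K := ⟨_, (Real.exp_pos (h.lip * (s - t))).le⟩)
      fun z z' => by rw [mul_comm]; exact h.dist_flow_le_of_ge hst z z').continuous

theorem hasDerivAt_fst_flow (h : DecayingForce α K E) (t s : ℝ) (z : Phase) :
    HasDerivAt (fun t => (h.flow t s z).1) (h.flow t s z).2 t :=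
  (hasFDerivAt_fst (p := h.flow t s z)).comp_hasDerivAt t (h.isTrajectory_flow s z t)

theorem hasDerivAt_snd_flow (h : DecayingForce α K E) (t s : ℝ) (z : Phase) :
    HasDerivAt (fun t => (h.flow t s z).2) (E t (h.flow t s z).1) t :=
  (hasFDerivAt_snd (p := h.flow t s z)).comp_hasDerivAt t (h.isTrajectory_flow s z t)

theorem continuous_flow_time (h : DecayingForce α K E) (s : ℝ) (z : Phase) :
    Continuous fun t => h.flow t s z :=
  continuous_iff_continuousAt.2 fun t => (h.isTrajectory_flow s z t).continuousAt

theorem norm_snd_flow_sub_le (h : DecayingForce α K E) (t s : ℝ) (z : Phase) :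
    ‖(h.flow t s z).2 - z.2‖ ≤ K * |t - s| := by
  have := Convex.norm_image_sub_le_of_norm_hasDerivWithin_le (s := Set.univ) (𝕜 := ℝ)
    (f := fun t => (h.flow t s z).2) (C := K) (x := s) (y := t)
    (fun t _ => (h.hasDerivAt_snd_flow t s z).hasDerivWithinAt)
    (fun t _ => h.norm_le_const t _) convex_univ trivial trivial
  simpa [h.flow_self] using this

theorem norm_fst_flow_sub_le (h : DecayingForce α K E) (t s : ℝ) (z : Phase) :
    ‖(h.flow t s z).1 - z.1‖ ≤ (‖z.2‖ + K * |t - s|) * |t - s| := by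
  have := Convex.norm_image_sub_le_of_norm_hasDerivWithin_le (s := Set.uIcc s t) (𝕜 := ℝ)
    (f := fun t => (h.flow t s z).1) (C := ‖z.2‖ + K * |t - s|) (x := s) (y := t)
    (fun t _ => (h.hasDerivAt_fst_flow t s z).hasDerivWithinAt)
    (fun r hr => ?_) (convex_uIcc s t) Set.left_mem_uIcc Set.right_mem_uIcc
  · simpa [h.flow_self] using this
  · have h1 := h.norm_snd_flow_sub_le r s z
    have h2 : |r - s| ≤ |t - s| := Set.abs_sub_left_of_mem_uIcc hr
    have h3 := norm_le_norm_add_norm_sub' (h.flow r s z).2 z.2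
    have h4 := mul_le_mul_of_nonneg_left h2 h.nonneg
    linarith

end DecayingForce

/-! ### Liouville's theorem -/

/-- On each fibre of fixed x the map is a translation; only measurability of g is needed. -/
theorem measurePreserving_shear_snd {g : E3 → E3} (hg : Measurable g) :
    MeasurePreserving (fun z : Phase => (z.1, z.2 + g z.1)) volume volume := by
  refine (MeasurePreserving.id (volume : Measure E3)).skew_product (g := fun x v => v + g x)
    (by unfold Function.uncurry; fun_prop) (Eventually.of_forall fun x => ?_)
  exact (measurePreserving_add_right (volume : Measure E3) (g x)).map_eq

theorem measurePreserving_shear_fst {g : E3 → E3} (hg : Measurable g) :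
    MeasurePreserving (fun z : Phase => (z.1 + g z.2, z.2)) volume volume := by
  have hs : MeasurePreserving (Prod.swap : Phase → Phase) volume volume :=
    Measure.measurePreserving_swap
  exact hs.comp ((measurePreserving_shear_snd hg).comp hs)

/-- A measurable self-map of phase space which preserves integrals of compactly supported
Lipschitz functions preserves Lebesgue measure. -/
theorem measurePreserving_of_integral_comp {Ψ : Phase → Phase} (hΨ : Measurable Ψ)
    (hint : ∀ (L : NNReal) (φ : Phase → ℝ), LipschitzWith L φ → HasCompactSupport φ →
      Integrable (φ ∘ Ψ) ∧ ∫ z, φ (Ψ z) = ∫ z, φ z) :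
    MeasurePreserving Ψ volume volume := by
  have hcompact : ∀ S : Set Phase, IsCompact S →
      Measure.map Ψ volume S = (volume : Measure Phase) S := by
    intro S hS
    -- The indicator of S is approximated from above by thickened indicators, Lipschitz with support
    -- in the closed 1-neighbourhood of S; dominated convergence is applied with and without Ψ.
    have hpos : ∀ n : ℕ, (0 : ℝ) < 1 / ((n : ℝ) + 1) := fun n => by positivity
    set φ : ℕ → Phase → ℝ := fun n z => (thickenedIndicator (hpos n) S z : ℝ) with hφ
    have hφL : ∀ n, ∃ L, LipschitzWith L (φ n) := fun n =>
      ⟨_, LipschitzWith.of_dist_le_mul fun z z' =>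
        (lipschitzWith_thickenedIndicator (hpos n) S).dist_le_mul z z'⟩
    have hφ0 : ∀ n z, z ∉ Metric.cthickening 1 S → φ n z = 0 := by
      intro n z hz
      have : z ∉ Metric.thickening (1 / ((n : ℝ) + 1)) S := fun h => hz
        (Metric.thickening_subset_cthickening _ _ (Metric.thickening_mono (by
          rw [div_le_one (by positivity)]; linarith [n.cast_nonneg (α := ℝ)]) _ h))
      rw [hφ]; exact NNReal.coe_eq_zero.2 (thickenedIndicator_zero (hpos n) S this)
    have hφc : ∀ n, HasCompactSupport (φ n) := fun n =>
      HasCompactSupport.intro (hS.cthickening (r := 1)) (hφ0 n)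
    have hφ1 : ∀ n z, φ n z ≤ 1 := fun n z => by
      exact NNReal.coe_le_one.2 (thickenedIndicator_le_one (hpos n) S z)
    have hφnn : ∀ n z, 0 ≤ φ n z := fun n z => NNReal.coe_nonneg _
    have hφone : ∀ n z, z ∈ S → φ n z = 1 := fun n z hz => by
      rw [hφ]
      exact NNReal.coe_eq_one.2 (thickenedIndicator_one_of_mem_closure (hpos n) S (subset_closure hz))
    have hlim : ∀ z, Tendsto (fun n => φ n z) atTop (𝓝 (S.indicator (fun _ => (1 : ℝ)) z)) := by
      intro z
      have := thickenedIndicator_tendsto_indicator_closure hpos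
        tendsto_one_div_add_atTop_nhds_zero_nat S
      rw [tendsto_pi_nhds] at this
      have h1 := (NNReal.continuous_coe.tendsto _).comp (this z)
      rw [hS.isClosed.closure_eq] at h1
      convert! h1 using 2
      by_cases hz : z ∈ S <;> simp [hz]
    have hSm := hS.measurableSet
    have hpre : MeasurableSet (Ψ ⁻¹' S) := hΨ hSm
    have hSfin : (volume : Measure Phase) S < ⊤ := hS.measure_lt_top
    have hI0 := (hφL 0).elim fun L hL => (hint L (φ 0) hL (hφc 0)).1
    -- Finiteness must be known before comparing real-valued measures; it follows from integrability
    -- of `φ 0 ∘ Ψ`, which is 1 on the preimage.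
    have hfin : (volume : Measure Phase) (Ψ ⁻¹' S) < ⊤ := by
      have h1 : IntegrableOn (fun _ => (1 : ℝ)) (Ψ ⁻¹' S) := by
        refine Integrable.mono' hI0.integrableOn (by fun_prop) ?_
        filter_upwards [ae_restrict_mem hpre] with z hz
        simp [hφone 0 (Ψ z) hz]
      simpa using h1
    have hA : Tendsto (fun n => ∫ z, φ n z) atTop (𝓝 (volume.real S)) := by
      have h2 : ∫ z, S.indicator (fun _ => (1 : ℝ)) z = volume.real S := by
        rw [integral_indicator_const _ hSm, smul_eq_mul, mul_one]
      rw [← h2]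
      refine tendsto_integral_of_dominated_convergence
        ((Metric.cthickening 1 S).indicator fun _ => (1 : ℝ))
        (fun n => ((hφL n).elim fun L hL => hL.continuous).aestronglyMeasurable) ?_
        (fun n => Eventually.of_forall fun z => ?_) (Eventually.of_forall hlim)
      · exact (integrable_indicator_iff (hS.cthickening (r := 1)).measurableSet).2
          (integrableOn_const (hS.cthickening (r := 1)).measure_ne_top)
      · rw [Real.norm_of_nonneg (hφnn n z)]
        by_cases hz : z ∈ Metric.cthickening 1 S
        · simpa [hz] using hφ1 n z
        · simp [hz, hφ0 n z hz]
    have hB : Tendsto (fun n => ∫ z, φ n (Ψ z)) atTop (𝓝 (volume.real (Ψ ⁻¹' S))) := by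
      have h2 : ∫ z, (Ψ ⁻¹' S).indicator (fun _ => (1 : ℝ)) z = volume.real (Ψ ⁻¹' S) := by
        rw [integral_indicator_const _ hpre, smul_eq_mul, mul_one]
      rw [← h2]
      refine tendsto_integral_of_dominated_convergence (φ 0 ∘ Ψ)
        (fun n => ((hφL n).elim fun L hL => hL.continuous.measurable.comp
          hΨ).aestronglyMeasurable) hI0 (fun n => Eventually.of_forall fun z => ?_)
        (Eventually.of_forall fun z => hlim (Ψ z))
      rw [Real.norm_of_nonneg (hφnn n _)]
      exact NNReal.coe_le_coe.2 (thickenedIndicator_mono (hpos n) (hpos 0) (by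
        gcongr; simp) S (Ψ z))
    have hAB : volume.real S = volume.real (Ψ ⁻¹' S) := by
      refine tendsto_nhds_unique hA (hB.congr fun n => ?_)
      obtain ⟨L, hL⟩ := hφL n
      exact (hint L (φ n) hL (hφc n)).2
    rw [Measure.map_apply hΨ hSm]
    exact ((measureReal_eq_measureReal_iff hSfin.ne hfin.ne).1 hAB).symm
  refine ⟨hΨ, ?_⟩
  -- Finiteness on compacts makes the image measure regular, so equality passes from compact to open
  -- sets and then to all sets.
  have : IsFiniteMeasureOnCompacts (Measure.map Ψ (volume : Measure Phase)) :=
    ⟨fun S hS => by rw [hcompact S hS]; exact hS.measure_lt_top⟩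
  refine Measure.OuterRegular.ext_isOpen fun U hU => ?_
  rw [hU.measure_eq_iSup_isCompact, hU.measure_eq_iSup_isCompact]
  refine iSup_congr fun S => iSup_congr fun _ => iSup_congr fun hS => hcompact S hS

variable {α K : ℝ} {E : ℝ → E3 → E3}

namespace DecayingForce

/-- One step of the symplectic Euler scheme. -/
def eulerStep (E : ℝ → E3 → E3) (s h : ℝ) (z : Phase) : Phase :=
  (z.1 + h • (z.2 + h • E s z.1), z.2 + h • E s z.1)

/-- The position is moved with the already updated velocity, so the step is a composition of two
shears and preserves volume exactly, although E is merely continuous. -/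
theorem measurePreserving_eulerStep (hE : DecayingForce α K E) (s h : ℝ) :
    MeasurePreserving (eulerStep E s h) volume volume :=
  (measurePreserving_shear_fst (g := fun v => h • v) (by fun_prop)).comp
    (measurePreserving_shear_snd (g := fun x => h • E s x)
      ((hE.continuous_apply s).measurable.const_smul h))

theorem norm_eulerStep_sub_le (hE : DecayingForce α K E) {s h T : ℝ} (h0 : 0 ≤ h) (hT : h ≤ T)
    (z : Phase) : ‖eulerStep E s h z - z‖ ≤ h * (‖z‖ + T * K + K) := by
  have hK := hE.nonneg
  have h1 : ‖h • E s z.1‖ ≤ h * K := by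
    rw [norm_smul, Real.norm_of_nonneg h0]; gcongr; exact hE.norm_le_const _ _
  have h2 := norm_snd_le z
  have h3 : h * K ≤ T * K := by gcongr
  have h4 := mul_nonneg h0 (norm_nonneg z)
  have h5 : 0 ≤ h * K := by positivity
  rw [Prod.norm_def]
  refine max_le ?_ ?_
  · have : (eulerStep E s h z - z).1 = h • (z.2 + h • E s z.1) := by simp [eulerStep]
    rw [this, norm_smul, Real.norm_of_nonneg h0]
    gcongr
    linarith [norm_add_le z.2 (h • E s z.1)]
  · have : (eulerStep E s h z - z).2 = h • E s z.1 := by simp [eulerStep]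
    rw [this]
    have : 0 ≤ h * (T * K) := mul_nonneg h0 (h5.trans h3)
    nlinarith

theorem norm_flow_sub_le (hE : DecayingForce α K E) {t s T : ℝ} (h0 : s ≤ t) (hT : t - s ≤ T)
    (z : Phase) : ‖hE.flow t s z - z‖ ≤ (t - s) * (‖z‖ + T * K + K) := by
  have hK := hE.nonneg
  have h1 := hE.norm_snd_flow_sub_le t s z
  have h2 := hE.norm_fst_flow_sub_le t s z
  have hts : 0 ≤ t - s := by linarith
  rw [abs_of_nonneg hts] at h1 h2
  have h3 := norm_snd_le z
  have h4 : K * (t - s) ≤ T * K := by rw [mul_comm]; gcongr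
  have h6 : 0 ≤ T * K := mul_nonneg (hts.trans hT) hK
  rw [Prod.norm_def]
  refine max_le ?_ ?_
  · refine h2.trans ?_
    rw [mul_comm]
    exact mul_le_mul_of_nonneg_left (by linarith) hts
  · refine h1.trans ?_
    rw [mul_comm]
    exact mul_le_mul_of_nonneg_left (by linarith [norm_nonneg z]) hts

/-- Bounded forces move points a controlled distance, so preimages of balls under the flow stay in a
ball uniform over times within T; this keeps supports bounded below. -/
theorem norm_le_of_norm_flow_le (hE : DecayingForce α K E) {t s T R : ℝ} (h0 : s ≤ t)
    (hT : t - s ≤ T) {z : Phase} (hz : ‖hE.flow t s z‖ ≤ R) :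
    ‖z‖ ≤ R + T * K + T * (R + 2 * (T * K)) := by
  have hK := hE.nonneg
  have h1 := hE.norm_snd_flow_sub_le t s z
  have h2 := hE.norm_fst_flow_sub_le t s z
  have hts : 0 ≤ t - s := by linarith
  have hT0 := hts.trans hT
  rw [abs_of_nonneg hts] at h1 h2
  have hR : 0 ≤ R := (norm_nonneg _).trans hz
  have hK1 : K * (t - s) ≤ T * K := by rw [mul_comm]; gcongr
  have h6 : 0 ≤ T * K := mul_nonneg hT0 hK
  have hv : ‖z.2‖ ≤ R + T * K := by
    have := norm_le_norm_add_norm_sub (hE.flow t s z).2 z.2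
    linarith [(norm_snd_le (hE.flow t s z)).trans hz]
  have hx : ‖z.1‖ ≤ R + T * (R + 2 * (T * K)) := by
    have h7 := norm_le_norm_add_norm_sub (hE.flow t s z).1 z.1
    have h8 : (‖z.2‖ + K * (t - s)) * (t - s) ≤ (R + 2 * (T * K)) * T := by
      refine mul_le_mul (by linarith) hT hts ?_
      linarith
    linarith [(norm_fst_le (hE.flow t s z)).trans hz]
  have h9 : 0 ≤ T * (R + 2 * (T * K)) := by positivity
  rw [Prod.norm_def]
  exact max_le (by linarith) (by linarith)

theorem norm_le_of_norm_eulerStep_le (hE : DecayingForce α K E) {s h T R : ℝ} (h0 : 0 ≤ h)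
    (hT : h ≤ T) {z : Phase} (hz : ‖eulerStep E s h z‖ ≤ R) : ‖z‖ ≤ R + T * K + T * R := by
  have hK := hE.nonneg
  have hT0 := h0.trans hT
  have hR : 0 ≤ R := (norm_nonneg _).trans hz
  have h1 : ‖h • E s z.1‖ ≤ T * K := by
    rw [norm_smul, Real.norm_of_nonneg h0]; gcongr; exact hE.norm_le_const _ _
  have hz2 : ‖z.2 + h • E s z.1‖ ≤ R := (norm_snd_le (eulerStep E s h z)).trans hz
  have hz1 : ‖z.1 + h • (z.2 + h • E s z.1)‖ ≤ R := (norm_fst_le (eulerStep E s h z)).trans hz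
  have h2 : ‖h • (z.2 + h • E s z.1)‖ ≤ T * R := by
    rw [norm_smul, Real.norm_of_nonneg h0]; gcongr
  have h3 : ‖z.2‖ ≤ R + T * K := by
    have := norm_sub_le (z.2 + h • E s z.1) (h • E s z.1)
    rw [add_sub_cancel_right] at this; linarith
  have h4 : ‖z.1‖ ≤ R + T * R := by
    have := norm_sub_le (z.1 + h • (z.2 + h • E s z.1)) (h • (z.2 + h • E s z.1))
    rw [add_sub_cancel_right] at this; linarith
  have h5 : 0 ≤ T * K := by positivity
  have h6 : 0 ≤ T * R := by positivity
  rw [Prod.norm_def]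
  exact max_le (by linarith) (by linarith)

theorem continuous_eulerStep (hE : DecayingForce α K E) (s h : ℝ) :
    Continuous (eulerStep E s h) := by
  have := (hE.continuous_apply s).comp (continuous_fst : Continuous (Prod.fst : Phase → E3))
  unfold eulerStep
  exact (continuous_fst.add ((continuous_snd.add (this.const_smul h)).const_smul h)).prodMk
    (continuous_snd.add (this.const_smul h))

theorem hasDerivAt_eulerStep (_ : DecayingForce α K E) (s : ℝ) (z : Phase) :
    HasDerivAt (fun t => eulerStep E s (t - s) z) (phaseField E s z) s := by
  have h0 : HasDerivAt (fun t : ℝ => t - s) 1 s := (hasDerivAt_id s).sub_const s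
  have h1 : HasDerivAt (fun t : ℝ => z.2 + (t - s) • E s z.1) (E s z.1) s := by
    simpa using (h0.smul_const (E s z.1)).const_add z.2
  have h2 : HasDerivAt (fun t : ℝ => z.1 + (t - s) • (z.2 + (t - s) • E s z.1)) z.2 s := by
    simpa using (h0.smul h1).const_add z.1
  exact h2.prodMk h1

/-- The error of one Euler step is of higher order. -/
theorem tendsto_eulerStep_sub_flow (hE : DecayingForce α K E) (s : ℝ) (z : Phase) :
    Tendsto (fun t => (t - s)⁻¹ * ‖eulerStep E s (t - s) z - hE.flow t s z‖) (𝓝[>] s) (𝓝 0) := by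
  have h1 := (hE.hasDerivAt_eulerStep s z).sub (hE.isTrajectory_flow s z s)
  simp only [hE.flow_self, sub_self] at h1
  have h2 := h1.tendsto_slope.mono_left (nhdsGT_le_nhdsNE s)
  have h3 := h2.norm
  rw [norm_zero] at h3
  refine h3.congr' ?_
  filter_upwards [self_mem_nhdsWithin] with t ht
  have : (0 : ℝ) < t - s := sub_pos.2 ht
  simp only [slope, vsub_eq_sub, Pi.sub_apply, sub_self, hE.flow_self]
  have h4 : eulerStep E s 0 z = z := by simp [eulerStep]
  rw [h4, sub_self, sub_zero, norm_smul, norm_inv, Real.norm_of_nonneg this.le]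

/-- Let J(s) be the integral of φ composed with the flow from s to T. A volume-preserving Euler step
may be inserted into J(t) at no cost, so J(t) - J(s) is controlled by the one-step error of the
scheme, which is o(t - s). Thus J has right derivative 0 and is constant. No Jacobian of the flow is
used. -/
theorem integral_comp_flow (hE : DecayingForce α K E) {T : ℝ} (hT : 0 ≤ T) {L : NNReal}
    {φ : Phase → ℝ} (hφ : LipschitzWith L φ) (hc : HasCompactSupport φ) :
    Integrable (φ ∘ hE.flow T 0) ∧ ∫ z, φ (hE.flow T 0 z) = ∫ z, φ z := by
  have hK := hE.nonneg
  obtain ⟨R, hR⟩ : ∃ R, ∀ z, φ z ≠ 0 → ‖z‖ ≤ R := by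
    obtain ⟨R, hR⟩ := hc.isCompact.isBounded.exists_norm_le
    exact ⟨R, fun z hz => hR z (subset_tsupport φ hz)⟩
  set R₁ := R + T * K + T * (R + 2 * (T * K)) with hR1
  -- Outside this radius both φ after the flow and φ after the flow and an Euler step vanish, for
  -- all intermediate times.
  set R₂ := max R₁ (R₁ + T * K + T * R₁) with hR2
  have hzero1 : ∀ s, 0 ≤ s → s ≤ T → ∀ z, R₁ < ‖z‖ → φ (hE.flow T s z) = 0 := by
    intro s hs hsT z hz
    by_contra hne
    exact absurd (hE.norm_le_of_norm_flow_le hsT (by linarith) (hR _ hne)) (not_le.2 hz)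
  have hint : ∀ s, 0 ≤ s → s ≤ T → Integrable (fun z => φ (hE.flow T s z)) := fun s hs hsT =>
    (hφ.continuous.comp (hE.continuous_flow T s)).integrable_of_hasCompactSupport
      (HasCompactSupport.intro (isCompact_closedBall 0 R₁) fun z hz =>
        hzero1 s hs hsT z (by simpa using hz))
  set J : ℝ → ℝ := fun s => ∫ z, φ (hE.flow T s z) with hJ
  set M := L * Real.exp (hE.lip * T) with hM
  have hM0 : 0 ≤ M := by positivity
  set C := 2 * (R₂ + T * K + K) with hCdef
  have hstep : ∀ s t, 0 ≤ s → s ≤ t → t ≤ T → ∀ z, ‖z‖ ≤ R₂ →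
      ‖eulerStep E s (t - s) z - hE.flow t s z‖ ≤ C * (t - s) := by
    intro s t hs hst htT z hz
    have h1 := hE.norm_eulerStep_sub_le (s := s) (h := t - s) (T := T) (by linarith)
      (by linarith) z
    have h2 := hE.norm_flow_sub_le (T := T) hst (by linarith) z
    have h3 : (t - s) * (‖z‖ + T * K + K) ≤ (t - s) * (R₂ + T * K + K) :=
      mul_le_mul_of_nonneg_left (by linarith) (by linarith)
    have h4 := norm_sub_le (eulerStep E s (t - s) z - z) (hE.flow t s z - z)
    rw [sub_sub_sub_cancel_right] at h4
    rw [hCdef]; linarith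
  have hdiff : ∀ s t, 0 ≤ s → s ≤ t → t ≤ T →
      |J t - J s| ≤ ∫ z in Metric.closedBall (0 : Phase) R₂,
        M * ‖eulerStep E s (t - s) z - hE.flow t s z‖ := by
    intro s t hs hst htT
    have ht0 := hs.trans hst
    have hmp := hE.measurePreserving_eulerStep s (t - s)
    have h1 : J t = ∫ z, φ (hE.flow T t (eulerStep E s (t - s) z)) := by
      have h2 := integral_map hmp.measurable.aemeasurable (μ := volume)
        (f := fun z => φ (hE.flow T t z))
        ((hφ.continuous.comp (hE.continuous_flow T t)).aestronglyMeasurable)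
      rw [hmp.map_eq] at h2
      exact h2
    have hint1 : Integrable fun z => φ (hE.flow T t (eulerStep E s (t - s) z)) :=
      (hmp.integrable_comp (hint t ht0 htT).aestronglyMeasurable).2 (hint t ht0 htT)
    rw [h1, hJ, ← integral_sub hint1 (hint s hs (hst.trans htT)), ← Real.norm_eq_abs,
      ← integral_indicator measurableSet_closedBall]
    refine norm_integral_le_of_norm_le ?_ (Eventually.of_forall fun z => ?_)
    · refine (integrable_indicator_iff measurableSet_closedBall).2
        (ContinuousOn.integrableOn_compact (isCompact_closedBall _ _) ?_)
      exact (((hE.continuous_eulerStep s (t - s)).sub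
        (hE.continuous_flow t s)).norm.const_mul M).continuousOn
    · by_cases hz : z ∈ Metric.closedBall (0 : Phase) R₂
      · rw [Set.indicator_of_mem hz, Real.norm_eq_abs, ← Real.dist_eq,
          ← hE.flow_flow T t s z]
        refine (hφ.dist_le_mul _ _).trans ?_
        rw [hM, mul_assoc]
        refine mul_le_mul_of_nonneg_left ((hE.dist_flow_le_of_le htT _ _).trans ?_) L.coe_nonneg
        rw [mul_comm, dist_eq_norm]
        refine mul_le_mul_of_nonneg_right (Real.exp_le_exp.2 ?_) (norm_nonneg _)
        exact mul_le_mul_of_nonneg_left (by linarith) (NNReal.coe_nonneg _)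
      · rw [Set.indicator_of_notMem hz]
        have hz' : R₂ < ‖z‖ := by simpa using hz
        have e1 := hzero1 s hs (hst.trans htT) z ((le_max_left _ _).trans_lt hz')
        have e2 : φ (hE.flow T t (eulerStep E s (t - s) z)) = 0 := by
          refine hzero1 t ht0 htT _ ?_
          by_contra hcon
          have := hE.norm_le_of_norm_eulerStep_le (s := s) (h := t - s) (T := T) (by linarith)
            (by linarith) (not_lt.1 hcon)
          exact absurd (this.trans (le_max_right _ _)) (not_le.2 hz')
        simp [e1, e2]
  have hC0 : 0 ≤ volume.real (Metric.closedBall (0 : Phase) R₂) := measureReal_nonneg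
  have hJlip : ∀ s t, 0 ≤ s → s ≤ t → t ≤ T →
      |J t - J s| ≤ M * C * volume.real (Metric.closedBall (0 : Phase) R₂) * (t - s) := by
    intro s t hs hst htT
    refine (hdiff s t hs hst htT).trans ?_
    have := norm_setIntegral_le_of_norm_le_const (μ := volume)
      (s := Metric.closedBall (0 : Phase) R₂)
      (f := fun z => M * ‖eulerStep E s (t - s) z - hE.flow t s z‖) (C := M * (C * (t - s)))
      (isCompact_closedBall _ _).measure_lt_top (fun z hz => by
        rw [Real.norm_of_nonneg (by positivity)]
        exact mul_le_mul_of_nonneg_left (hstep s t hs hst htT z (by simpa using hz)) hM0)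
    refine (le_abs_self _).trans (this.trans (le_of_eq ?_))
    ring
  have hcont : ContinuousOn J (Set.Icc 0 T) := by
    refine LipschitzOnWith.continuousOn
      (K := (M * C * volume.real (Metric.closedBall (0 : Phase) R₂)).toNNReal)
      (LipschitzOnWith.of_dist_le_mul fun s hs t ht => ?_)
    rw [Real.dist_eq, Real.dist_eq]
    refine le_trans ?_ (mul_le_mul_of_nonneg_right (Real.le_coe_toNNReal _) (abs_nonneg _))
    rcases le_total s t with hst | hst
    · rw [abs_sub_comm, abs_sub_comm s t, abs_of_nonneg (sub_nonneg.2 hst)]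
      exact hJlip s t hs.1 hst ht.2
    · rw [abs_of_nonneg (sub_nonneg.2 hst)]
      exact hJlip t s ht.1 hst hs.2
  have hderiv : ∀ s ∈ Set.Ico 0 T, HasDerivWithinAt J 0 (Set.Ici s) s := by
    intro s hs
    rw [← hasDerivWithinAt_Ioi_iff_Ici, hasDerivWithinAt_iff_tendsto_slope' (by simp)]
    have hlt : ∀ᶠ t in 𝓝[>] s, t < T := mem_nhdsWithin_of_mem_nhds (Iio_mem_nhds hs.2)
    have hgt : ∀ᶠ t in 𝓝[>] s, s < t := self_mem_nhdsWithin
    have hlim : Tendsto (fun t => ∫ z in Metric.closedBall (0 : Phase) R₂,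
        M * ((t - s)⁻¹ * ‖eulerStep E s (t - s) z - hE.flow t s z‖)) (𝓝[>] s) (𝓝 0) := by
      have h0 : ∫ z in Metric.closedBall (0 : Phase) R₂, (0 : ℝ) = 0 := by simp
      rw [← h0]
      refine tendsto_integral_filter_of_dominated_convergence (fun _ => M * C)
        (Eventually.of_forall fun t => ?_) ?_ ?_ (Eventually.of_forall fun z => ?_)
      · exact ((((hE.continuous_eulerStep s (t - s)).sub
          (hE.continuous_flow t s)).norm.const_mul _).const_mul M).aestronglyMeasurable
      · filter_upwards [hlt, hgt] with t h1 h2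
        filter_upwards [ae_restrict_mem measurableSet_closedBall] with z hz
        have hpos : 0 < t - s := sub_pos.2 h2
        rw [Real.norm_of_nonneg (by positivity)]
        refine mul_le_mul_of_nonneg_left ?_ hM0
        rw [inv_mul_le_iff₀ hpos, mul_comm]
        exact hstep s t hs.1 h2.le h1.le z (by simpa using hz)
      · exact integrableOn_const (isCompact_closedBall _ _).measure_ne_top
      · simpa using (hE.tendsto_eulerStep_sub_flow s z).const_mul M
    refine squeeze_zero_norm' ?_ hlim
    filter_upwards [hlt, hgt] with t h1 h2
    have hpos : 0 < t - s := sub_pos.2 h2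
    rw [slope, vsub_eq_sub, norm_smul, norm_inv, Real.norm_of_nonneg hpos.le, Real.norm_eq_abs]
    refine (mul_le_mul_of_nonneg_left (hdiff s t hs.1 h2.le h1.le) (by positivity)).trans
      (le_of_eq ?_)
    rw [← integral_const_mul]
    congr 1; ext z; ring
  refine ⟨hint 0 le_rfl hT, ?_⟩
  have := constant_of_has_deriv_right_zero hcont hderiv T ⟨hT, le_rfl⟩
  simp only [hJ, hE.flow_self] at this
  exact this.symm

/-- **Liouville's theorem**: the flow preserves phase space volume. -/
theorem measurePreserving_flow (hE : DecayingForce α K E) {t : ℝ} (ht : 0 ≤ t) :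
    MeasurePreserving (hE.flow t 0) volume volume :=
  measurePreserving_of_integral_comp (hE.continuous_flow t 0).measurable
    fun _ _ hφ hc => hE.integral_comp_flow ht hφ hc

end DecayingForce

/-! ### Uniqueness for the transport equation -/

instance : (volume : Measure Phase).IsNegInvariant :=
  ⟨((Measure.measurePreserving_neg (volume : Measure E3)).prod
    (Measure.measurePreserving_neg (volume : Measure E3))).map_eq⟩

/-- Mollifiers at scale `ε` whose gradients have mass `O(1/ε)`. -/
theorem exists_mollifier : ∃ C : ℝ, 0 ≤ C ∧ ∀ ε : ℝ, 0 < ε → ∃ θ : Phase → ℝ,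
    ContDiff ℝ ∞ θ ∧ HasCompactSupport θ ∧ (∀ z, 0 ≤ θ z) ∧ (∀ z, ε < ‖z‖ → θ z = 0) ∧
      ∫ z, θ z = 1 ∧ ∫ z, ‖fderiv ℝ θ z‖ ≤ C / ε := by
  set b : ContDiffBump (0 : Phase) := ⟨1 / 2, 1, by norm_num, by norm_num⟩ with hb
  set θ₁ : Phase → ℝ := b.normed volume with hθ₁
  have hs : ContDiff ℝ ∞ θ₁ := b.contDiff_normed
  set n := Module.finrank ℝ Phase
  -- All mollifiers rescale one bump θ₁, so the gradient mass scales exactly as 1/ε and C is that of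
  -- θ₁.
  refine ⟨∫ z, ‖fderiv ℝ θ₁ z‖, by positivity, fun ε hε => ?_⟩
  set c : ℝ := (ε⁻¹) ^ n with hc
  have hc0 : 0 < c := by positivity
  have hscale : ContDiff ℝ ∞ fun z : Phase => ε⁻¹ • z := contDiff_id.const_smul ε⁻¹
  have hzero : ∀ z : Phase, ε < ‖z‖ → c * θ₁ (ε⁻¹ • z) = 0 := by
    intro z hz
    have : ε⁻¹ • z ∉ Function.support θ₁ := by
      rw [hθ₁, b.support_normed_eq, mem_ball_zero_iff, norm_smul, norm_inv,
        Real.norm_of_nonneg hε.le, not_lt]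
      change 1 ≤ _
      rw [← div_eq_inv_mul, one_le_div hε]
      exact hz.le
    rw [Function.notMem_support.1 this, mul_zero]
  refine ⟨fun z => c * θ₁ (ε⁻¹ • z), contDiff_const.mul (hs.comp hscale),
    HasCompactSupport.intro (isCompact_closedBall 0 ε) fun z hz => hzero z (by simpa using hz),
    fun z => mul_nonneg hc0.le (b.nonneg_normed _), hzero, ?_, ?_⟩
  · rw [integral_const_mul, Measure.integral_comp_smul, hθ₁, b.integral_normed, smul_eq_mul,
      mul_one, abs_of_pos (by positivity), hc]
    exact mul_inv_cancel₀ (by positivity)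
  · have hfd : ∀ z, fderiv ℝ (fun z => c * θ₁ (ε⁻¹ • z)) z = (c * ε⁻¹) • fderiv ℝ θ₁ (ε⁻¹ • z) := by
      intro z
      have h1 : HasFDerivAt (fun z : Phase => ε⁻¹ • z) (ε⁻¹ • ContinuousLinearMap.id ℝ Phase) z :=
        (hasFDerivAt_id z).const_smul ε⁻¹
      have h2 := ((hs.differentiable (by simp) (ε⁻¹ • z)).hasFDerivAt.comp z h1).const_mul c
      have h3 := h2.fderiv
      simp only [Function.comp_def] at h3
      rw [h3]
      ext w <;> simp [mul_assoc]
    simp only [hfd, norm_smul]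
    rw [integral_const_mul, Measure.integral_comp_smul volume (fun z => ‖fderiv ℝ θ₁ z‖),
      smul_eq_mul, abs_of_pos (by positivity), Real.norm_of_nonneg (by positivity), hc]
    refine le_of_eq ?_
    change (ε⁻¹) ^ n * ε⁻¹ * (((ε⁻¹) ^ n)⁻¹ * _) = _
    field_simp

theorem integral_fderiv_apply_eq_zero {F : Type*} [NormedAddCommGroup F] [NormedSpace ℝ F]
    [FiniteDimensional ℝ F] [MeasureSpace F] [BorelSpace F] [(volume : Measure F).IsAddHaarMeasure]
    {θ : F → ℝ} (hθ : ContDiff ℝ 1 θ) (hc : HasCompactSupport θ) (w : F) :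
    ∫ x, fderiv ℝ θ x w = 0 := by
  have hfc : HasCompactSupport fun x => fderiv ℝ θ x w := hc.fderiv_apply ℝ w
  have := integral_mul_fderiv_eq_neg_fderiv_mul_of_integrable (μ := (volume : Measure F))
    (f := fun _ : F => (1 : ℝ)) (g := θ) (v := w) (by simp) (by
      simp only [one_mul]
      exact ((hθ.continuous_fderiv (by simp)).clm_apply continuous_const).integrable_of_hasCompactSupport hfc)
    (by simpa using hθ.continuous.integrable_of_hasCompactSupport hc)
    (by simp) (fun x _ => hθ.differentiable (by simp) x)
  simpa using this

/-- Fields of the form `(A(v), B(x))` are divergence free. -/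
theorem integral_fderiv_divergenceFree {θ : Phase → ℝ} (hθ : ContDiff ℝ 1 θ)
    (hc : HasCompactSupport θ) {A B : E3 → E3} (hA : Continuous A) (hB : Continuous B) :
    ∫ z, fderiv ℝ θ z (A z.2, B z.1) = 0 := by
  have hfd := hθ.continuous_fderiv (by simp)
  have hfc : HasCompactSupport (fderiv ℝ θ) := hc.fderiv ℝ
  have hzero : ∀ z, z ∉ tsupport (fderiv ℝ θ) → fderiv ℝ θ z = 0 := fun z hz =>
    image_eq_zero_of_notMem_tsupport hz
  have hint : ∀ W : Phase → Phase, Continuous W → Integrable fun z => fderiv ℝ θ z (W z) :=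
    fun W hW => (hfd.clm_apply hW).integrable_of_hasCompactSupport
      (HasCompactSupport.intro hfc fun z hz => by simp [hzero z hz])
  have hI1 : Integrable fun z : Phase => fderiv ℝ θ z (A z.2, 0) := hint _ (by fun_prop)
  have hI2 : Integrable fun z : Phase => fderiv ℝ θ z (0, B z.1) := hint _ (by fun_prop)
  have hsplit : ∀ z : Phase, fderiv ℝ θ z (A z.2, B z.1)
      = fderiv ℝ θ z (A z.2, 0) + fderiv ℝ θ z (0, B z.1) := fun z => by
    rw [← map_add]; simp
  simp only [hsplit]
  rw [integral_add hI1 hI2]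
  have h1 : ∫ z : Phase, fderiv ℝ θ z (A z.2, 0) = 0 := by
    have := integral_prod_symm (μ := (volume : Measure E3)) (ν := (volume : Measure E3)) _ hI1
    refine this.trans ?_
    rw [← integral_zero E3 ℝ]
    congr 1
    ext v
    have hsl : ContDiff ℝ 1 fun x : E3 => θ (x, v) := hθ.comp (contDiff_id.prodMk contDiff_const)
    have hcs : HasCompactSupport fun x : E3 => θ (x, v) :=
      HasCompactSupport.intro (hc.isCompact.image continuous_fst) fun x hx =>
        image_eq_zero_of_notMem_tsupport fun h => hx ⟨(x, v), h, rfl⟩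
    rw [← integral_fderiv_apply_eq_zero hsl hcs (A v)]
    congr 1
    ext x
    have h2 : HasFDerivAt (fun x : E3 => (x, v)) (ContinuousLinearMap.inl ℝ E3 E3) x :=
      hasFDerivAt_prodMk_left x v
    have h3 := ((hθ.differentiable (by simp) (x, v)).hasFDerivAt.comp x h2).fderiv
    simp only [Function.comp_def] at h3
    rw [h3]; simp
  have h2 : ∫ z : Phase, fderiv ℝ θ z (0, B z.1) = 0 := by
    have := integral_prod (μ := (volume : Measure E3)) (ν := (volume : Measure E3)) _ hI2
    refine this.trans ?_
    rw [← integral_zero E3 ℝ]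
    congr 1
    ext x
    have hsl : ContDiff ℝ 1 fun v : E3 => θ (x, v) := hθ.comp (contDiff_const.prodMk contDiff_id)
    have hcs : HasCompactSupport fun v : E3 => θ (x, v) :=
      HasCompactSupport.intro (hc.isCompact.image continuous_snd) fun v hv =>
        image_eq_zero_of_notMem_tsupport fun h => hv ⟨(x, v), h, rfl⟩
    rw [← integral_fderiv_apply_eq_zero hsl hcs (B x)]
    congr 1
    ext v
    have h2 : HasFDerivAt (fun v : E3 => (x, v)) (ContinuousLinearMap.inr ℝ E3 E3) v :=
      hasFDerivAt_prodMk_right x v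
    have h3 := ((hθ.differentiable (by simp) (x, v)).hasFDerivAt.comp v h2).fderiv
    simp only [Function.comp_def] at h3
    rw [h3]; simp
  rw [h1, h2, add_zero]

variable {α K : ℝ} {E : ℝ → E3 → E3}

/-- A bounded Lipschitz weak solution of the transport equation on `[0, T]`. -/
structure TransportSolution (E : ℝ → E3 → E3) (F : ℝ → Phase → ℝ) (T M : ℝ) (L : NNReal) :
    Prop where
  lipschitz : ∀ t ∈ Set.Icc 0 T, LipschitzWith L (F t)
  bound : ∀ t ∈ Set.Icc 0 T, ∀ z, |F t z| ≤ M
  continuousOn : ∀ z, ContinuousOn (fun t => F t z) (Set.Icc 0 T)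
  equation : ∀ φ : Phase → ℝ, ContDiff ℝ ∞ φ → HasCompactSupport φ → ∀ t ∈ Set.Icc 0 T,
    ∫ z, F t z * φ z = (∫ z, F 0 z * φ z)
      + ∫ s in (0 : ℝ)..t, ∫ z, F s z * fderiv ℝ φ z (phaseField E s z)

namespace TransportSolution

variable {F : ℝ → Phase → ℝ} {T M : ℝ} {L : NNReal}

/-- The integrand in time of the weak equation is continuous by dominated convergence, so the
integrated equation can be differentiated at every time. -/
theorem hasDerivWithinAt_integral_mul (hE : DecayingForce α K E)
    (hF : TransportSolution E F T M L) {φ : Phase → ℝ} (hφ : ContDiff ℝ ∞ φ)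
    (hc : HasCompactSupport φ) {t : ℝ} (ht : t ∈ Set.Icc 0 T) :
    HasDerivWithinAt (fun s => ∫ z, F s z * φ z)
      (∫ z, F t z * fderiv ℝ φ z (phaseField E t z)) (Set.Icc 0 T) t := by
  have hfd := hφ.continuous_fderiv (by simp)
  have hfc : HasCompactSupport (fderiv ℝ φ) := hc.fderiv ℝ
  have hzero : ∀ z, z ∉ tsupport (fderiv ℝ φ) → fderiv ℝ φ z = 0 := fun z hz =>
    image_eq_zero_of_notMem_tsupport hz
  have hM : 0 ≤ M := (abs_nonneg _).trans (hF.bound t ht 0)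
  set q : ℝ → ℝ := fun s => ∫ z, F s z * fderiv ℝ φ z (phaseField E s z) with hq
  have hbc : ∀ s, Continuous (phaseField E s) := fun s =>
    (hE.lipschitzWith_phaseField s).continuous
  have hqc : ContinuousOn q (Set.Icc 0 T) := by
    refine continuousOn_of_dominated (bound := fun z => M * (‖fderiv ℝ φ z‖ * (‖z‖ + K)))
      (fun s hs => ?_) (fun s hs => Eventually.of_forall fun z => ?_) ?_
      (Eventually.of_forall fun z => ?_)
    · exact ((hF.lipschitz s hs).continuous.mul (hfd.clm_apply (hbc s))).aestronglyMeasurable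
    · rw [norm_mul]
      have h1 : ‖phaseField E s z‖ ≤ ‖z‖ + K := by
        rw [Prod.norm_def]
        have hK := hE.nonneg
        exact max_le ((norm_snd_le z).trans (by linarith))
          ((hE.norm_le_const s z.1).trans (by linarith [norm_nonneg z]))
      have h2 := (fderiv ℝ φ z).le_opNorm (phaseField E s z)
      exact mul_le_mul (hF.bound s hs z)
        (h2.trans (mul_le_mul_of_nonneg_left h1 (norm_nonneg _))) (norm_nonneg _) hM
    · refine Continuous.integrable_of_hasCompactSupport ?_
        (HasCompactSupport.intro hfc fun z hz => by simp [hzero z hz])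
      fun_prop
    · refine (hF.continuousOn z).mul (Continuous.continuousOn ?_)
      have : Continuous fun s => E s z.1 :=
        hE.continuous.comp (by fun_prop : Continuous fun s : ℝ => (s, z.1))
      exact (fderiv ℝ φ z).continuous.comp (continuous_const.prodMk this)
  have : Fact (t ∈ Set.Icc 0 T) := ⟨ht⟩
  have h1 : HasDerivWithinAt (fun u => ∫ s in (0 : ℝ)..u, q s) (q t) (Set.Icc 0 T) t := by
    refine intervalIntegral.integral_hasDerivWithinAt_right ?_ ?_ (hqc t ht)
    · refine ContinuousOn.intervalIntegrable ?_
      rw [Set.uIcc_of_le ht.1]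
      exact hqc.mono (Set.Icc_subset_Icc_right ht.2)
    · exact hqc.stronglyMeasurableAtFilter_nhdsWithin measurableSet_Icc t
  refine (h1.const_add (∫ z, F 0 z * φ z)).congr (fun s hs => hF.equation φ hφ hc s hs)
    (hF.equation φ hφ hc t ht)

/-- The test function is centred at a moving point of a characteristic. Differentiating the centre
produces the field at the centre, the equation produces minus the field at z', and only the
difference survives. It is small on the support of θ. -/
theorem hasDerivWithinAt_integral_mul_flow (hE : DecayingForce α K E)
    (hF : TransportSolution E F T M L) {θ : Phase → ℝ} (hθ : ContDiff ℝ ∞ θ)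
    (hc : HasCompactSupport θ) (z : Phase) {t : ℝ} (ht : t ∈ Set.Icc 0 T) :
    HasDerivWithinAt (fun s => ∫ z', F s z' * θ (hE.flow s 0 z - z'))
      (∫ z', F t z' * fderiv ℝ θ (hE.flow t 0 z - z')
        (phaseField E t (hE.flow t 0 z) - phaseField E t z')) (Set.Icc 0 T) t := by
  set y : ℝ → Phase := fun s => hE.flow s 0 z with hy
  have hyd : HasDerivAt y (phaseField E t (y t)) t := hE.isTrajectory_flow 0 z t
  have hM : 0 ≤ M := (abs_nonneg _).trans (hF.bound t ht 0)
  have hθ1 : ContDiff ℝ 1 θ := hθ.of_le (by norm_cast)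
  obtain ⟨D, hD⟩ := hθ1.lipschitzWith_of_hasCompactSupport hc (by simp)
  obtain ⟨R, hR⟩ : ∃ R, ∀ w, θ w ≠ 0 → ‖w‖ ≤ R := by
    obtain ⟨R, hR⟩ := hc.isCompact.isBounded.exists_norm_le
    exact ⟨R, fun w hw => hR w (subset_tsupport θ hw)⟩
  set φ : Phase → ℝ := fun z' => θ (y t - z') with hφ
  have hφs : ContDiff ℝ ∞ φ := hθ.comp (contDiff_const.sub contDiff_id)
  have hφc : HasCompactSupport φ := hc.comp_homeomorph (Homeomorph.subLeft (y t))
  have hfdφ : ∀ z' w, fderiv ℝ φ z' w = - fderiv ℝ θ (y t - z') w := by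
    intro z' w
    have h2 : HasFDerivAt φ ((fderiv ℝ θ (y t - z')).comp (-ContinuousLinearMap.id ℝ Phase)) z' :=
      ((hθ.differentiable (by simp)) (y t - z')).hasFDerivAt.comp z'
        ((hasFDerivAt_id z').const_sub (y t))
    rw [h2.fderiv]; simp
  have hslope2 := (hF.hasDerivWithinAt_integral_mul hE hφs hφc ht)
  rw [hasDerivWithinAt_iff_tendsto_slope] at hslope2 ⊢
  set l := 𝓝[Set.Icc 0 T \ {t}] t with hl
  have hl_le : l ≤ 𝓝[≠] t := nhdsWithin_mono _ (fun s hs => hs.2)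
  have hl_mem : ∀ᶠ s in l, s ∈ Set.Icc 0 T := by
    filter_upwards [self_mem_nhdsWithin] with s hs using hs.1
  obtain ⟨Cy, hCy0, hCy⟩ := hyd.isBigO_sub.exists_pos
  have hCy' : ∀ᶠ s in l, ‖y s - y t‖ ≤ Cy * ‖s - t‖ :=
    hCy.bound.filter_mono (hl_le.trans nhdsWithin_le_nhds)
  have hnear : ∀ᶠ s in l, ‖y s - y t‖ ≤ 1 := by
    have h1 : ∀ᶠ s in 𝓝 t, dist (y s) (y t) < 1 :=
      hyd.continuousAt.eventually (Metric.ball_mem_nhds _ one_pos)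
    filter_upwards [h1.filter_mono (hl_le.trans nhdsWithin_le_nhds)] with s hs
    rw [← dist_eq_norm]; exact hs.le
  have hFc : ∀ s ∈ Set.Icc 0 T, Continuous (F s) := fun s hs => (hF.lipschitz s hs).continuous
  have hint : ∀ s ∈ Set.Icc 0 T, ∀ x, Integrable fun z' => F s z' * θ (x - z') := by
    intro s hs x
    have hcs : HasCompactSupport fun z' => θ (x - z') := hc.comp_homeomorph (Homeomorph.subLeft x)
    have h1 := hFc s hs
    have h2 := hθ.continuous
    exact Continuous.integrable_of_hasCompactSupport (by fun_prop) hcs.mul_left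
  -- This is the half of the difference quotient coming from the motion of the centre; the other
  -- half has a frozen test function and is covered by the preceding lemma.
  have hslope1 : Tendsto (fun s => ∫ z', F s z' * ((s - t)⁻¹ * (θ (y s - z') - θ (y t - z')))) l
      (𝓝 (∫ z', F t z' * fderiv ℝ θ (y t - z') (phaseField E t (y t)))) := by
    refine tendsto_integral_filter_of_dominated_convergence
      ((Metric.closedBall (y t) (R + 1)).indicator fun _ => M * (D * Cy)) ?_ ?_ ?_ ?_
    · filter_upwards [hl_mem] with s hs
      have h1 := hFc s hs
      have h2 := hθ.continuous
      exact Continuous.aestronglyMeasurable (by fun_prop)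
    · filter_upwards [hl_mem, hCy', hnear, hl_le self_mem_nhdsWithin] with s hs h1 h2 h3
      refine Eventually.of_forall fun z' => ?_
      by_cases hz : z' ∈ Metric.closedBall (y t) (R + 1)
      · rw [Set.indicator_of_mem hz, norm_mul, norm_mul, norm_inv]
        have hst : 0 < ‖s - t‖ := norm_pos_iff.2 (sub_ne_zero.2 h3)
        refine mul_le_mul (hF.bound s hs z') ?_ (by positivity) hM
        rw [inv_mul_le_iff₀ hst]
        have h4 := hD.dist_le_mul (y s - z') (y t - z')
        rw [dist_sub_right, dist_eq_norm, dist_eq_norm] at h4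
        refine h4.trans ?_
        calc (D : ℝ) * ‖y s - y t‖ ≤ D * (Cy * ‖s - t‖) := by gcongr
          _ = _ := by ring
      · have hz' : R + 1 < ‖y t - z'‖ := by
          rw [Metric.mem_closedBall, not_le, dist_comm, dist_eq_norm] at hz
          exact hz
        have e1 : θ (y t - z') = 0 := by
          by_contra hne; linarith [hR _ hne]
        have e2 : θ (y s - z') = 0 := by
          by_contra hne
          have h5 := norm_sub_le (y s - z') (y s - y t)
          rw [sub_sub_sub_cancel_left] at h5
          linarith [hR _ hne]
        simp [hz, e1, e2]
    · exact (integrable_indicator_iff measurableSet_closedBall).2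
        (integrableOn_const (isCompact_closedBall _ _).measure_ne_top)
    · refine Eventually.of_forall fun z' => Tendsto.mul ?_ ?_
      · exact (hF.continuousOn z' t ht).mono_left (nhdsWithin_mono _ Set.sdiff_subset)
      · have h1 : HasDerivAt (fun s => θ (y s - z')) (fderiv ℝ θ (y t - z') (phaseField E t (y t))) t :=
          ((hθ.differentiable (by simp)) (y t - z')).hasFDerivAt.comp_hasDerivAt t
            (hyd.sub_const z')
        have h2 := h1.tendsto_slope.mono_left hl_le
        refine h2.congr fun s => ?_
        rw [slope, vsub_eq_sub, smul_eq_mul]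
  have hval : (∫ z', F t z' * fderiv ℝ θ (y t - z') (phaseField E t (y t) - phaseField E t z'))
      = (∫ z', F t z' * fderiv ℝ θ (y t - z') (phaseField E t (y t)))
        + ∫ z', F t z' * fderiv ℝ φ z' (phaseField E t z') := by
    have hfd := hθ.continuous_fderiv (by simp)
    have hbc := (hE.lipschitzWith_phaseField t).continuous
    have hgen : ∀ W : Phase → Phase, Continuous W →
        Integrable fun z' => F t z' * fderiv ℝ θ (y t - z') (W z') := by
      intro W hW
      have hcs : HasCompactSupport fun z' => fderiv ℝ θ (y t - z') :=
        (hc.fderiv ℝ).comp_homeomorph (Homeomorph.subLeft (y t))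
      have h1 := hFc t ht
      refine Continuous.integrable_of_hasCompactSupport (h1.mul ?_)
        (HasCompactSupport.intro hcs fun z' hz => by
          have : fderiv ℝ θ (y t - z') = 0 := image_eq_zero_of_notMem_tsupport
            (f := fun z' => fderiv ℝ θ (y t - z')) hz
          simp [this])
      exact (hfd.comp (by fun_prop)).clm_apply hW
    simp only [hfdφ, mul_neg, integral_neg, ← sub_eq_add_neg]
    rw [← integral_sub (hgen _ continuous_const) (hgen _ hbc)]
    simp only [map_sub, mul_sub]
  rw [hval]
  refine (hslope1.add hslope2).congr' ?_
  filter_upwards [hl_mem] with s hs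
  simp only [slope, vsub_eq_sub, smul_eq_mul]
  rw [← integral_sub (hint s hs _) (hint t ht _), ← integral_sub (hint s hs _) (hint t ht _),
    ← integral_const_mul, ← integral_const_mul, ← integral_add]
  · congr 1; ext z'; ring
  · have := ((hint s hs (y s)).sub (hint s hs (y t))).const_mul (s - t)⁻¹
    refine this.congr (Eventually.of_forall fun z' => ?_)
    simp only [Pi.sub_apply]; ring
  · exact ((hint s hs (y t)).sub (hint t ht (y t))).const_mul (s - t)⁻¹

/-- Weak solutions of the transport equation are constant along characteristics. -/
theorem apply_flow (hE : DecayingForce α K E) (hF : TransportSolution E F T M L) (hT : 0 ≤ T)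
    (z : Phase) : F T (hE.flow T 0 z) = F 0 z := by
  obtain ⟨C, hC0, hC⟩ := exists_mollifier
  have hT' : T ∈ Set.Icc 0 T := ⟨hT, le_rfl⟩
  have h0' : (0 : ℝ) ∈ Set.Icc 0 T := ⟨le_rfl, hT⟩
  -- Mollifying at scale ε costs Lε at each endpoint. The time derivative of the mollified value is
  -- at most (Lε)(lip ε)(C/ε), again O(ε).
  have key : ∀ ε : ℝ, 0 < ε →
      |F T (hE.flow T 0 z) - F 0 z| ≤ ε * (L * hE.lip * C * T + 2 * L) := by
    intro ε hε
    obtain ⟨θ, hθ, hc, hnn, hzero, hone, hgrad⟩ := hC ε hε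
    have hθ1 : ContDiff ℝ 1 θ := hθ.of_le (by norm_cast)
    have hfd := hθ.continuous_fderiv (by simp)
    have hfzero : ∀ w, ε < ‖w‖ → fderiv ℝ θ w = 0 := by
      intro w hw
      have : θ =ᶠ[𝓝 w] fun _ => 0 := by
        filter_upwards [(isOpen_lt continuous_const continuous_norm).mem_nhds hw] with x hx
          using hzero x hx
      rw [this.fderiv_eq]; simp
    set k : ℝ → ℝ := fun s => ∫ z', F s z' * θ (hE.flow s 0 z - z') with hk
    have hkF : ∀ t ∈ Set.Icc 0 T, |k t - F t (hE.flow t 0 z)| ≤ L * ε := by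
      intro t ht
      set x := hE.flow t 0 z
      have hcs : HasCompactSupport fun z' => θ (x - z') :=
        hc.comp_homeomorph (Homeomorph.subLeft x)
      have hθi : Integrable fun z' => θ (x - z') :=
        (hθ.continuous.comp (by fun_prop)).integrable_of_hasCompactSupport hcs
      have h1 : ∫ z', θ (x - z') = 1 := by rw [integral_sub_left_eq_self θ volume x, hone]
      have hi : Integrable fun z' => F t z' * θ (x - z') :=
        ((hF.lipschitz t ht).continuous.mul
          (hθ.continuous.comp (by fun_prop))).integrable_of_hasCompactSupport hcs.mul_left
      have h2 : k t - F t x = ∫ z', (F t z' - F t x) * θ (x - z') := by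
        have : F t x = ∫ z', F t x * θ (x - z') := by rw [integral_const_mul, h1, mul_one]
        rw [hk]
        conv_lhs => rw [this]
        rw [← integral_sub hi (hθi.const_mul _)]
        congr 1; ext z'; ring
      rw [h2, ← Real.norm_eq_abs]
      refine (norm_integral_le_of_norm_le (hθi.const_mul (L * ε))
        (Eventually.of_forall fun z' => ?_)).trans (le_of_eq (by
          rw [integral_const_mul, h1, mul_one]))
      rw [norm_mul, Real.norm_of_nonneg (hnn _)]
      by_cases hz : ε < ‖x - z'‖
      · simp [hzero _ hz]
      · refine mul_le_mul_of_nonneg_right ?_ (hnn _)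
        have := (hF.lipschitz t ht).dist_le_mul z' x
        rw [dist_eq_norm, dist_comm, dist_eq_norm] at this
        exact this.trans (mul_le_mul_of_nonneg_left (not_lt.1 hz) L.coe_nonneg)
    have hkd : ∀ t ∈ Set.Icc 0 T, ‖∫ z', F t z' * fderiv ℝ θ (hE.flow t 0 z - z')
        (phaseField E t (hE.flow t 0 z) - phaseField E t z')‖ ≤ L * hE.lip * C * ε := by
      intro t ht
      set x := hE.flow t 0 z
      have hbc := (hE.lipschitzWith_phaseField t).continuous
      have hcs : HasCompactSupport fun z' => fderiv ℝ θ (x - z') :=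
        (hc.fderiv ℝ).comp_homeomorph (Homeomorph.subLeft x)
      have hcs' : ∀ z', z' ∉ tsupport (fun z' => fderiv ℝ θ (x - z')) → fderiv ℝ θ (x - z') = 0 :=
        fun z' hz => image_eq_zero_of_notMem_tsupport (f := fun z' => fderiv ℝ θ (x - z')) hz
      have hfdx : Continuous fun z' => fderiv ℝ θ (x - z') := hfd.comp (by fun_prop)
      -- The field difference is divergence free, so F t x may be subtracted from F t z' under the
      -- integral. This gains the factor Lε without a derivative of F.
      have hdiv : ∫ z', fderiv ℝ θ (x - z') (phaseField E t x - phaseField E t z') = 0 := by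
        rw [← integral_sub_left_eq_self _ volume x]
        simp only [sub_sub_cancel]
        have := integral_fderiv_divergenceFree hθ1 hc (A := fun v => x.2 - (x.2 - v))
          (B := fun u => E t x.1 - E t (x.1 - u)) (by fun_prop)
          (continuous_const.sub ((hE.continuous_apply t).comp (by fun_prop)))
        exact this
      have hi : ∀ G : Phase → ℝ, Continuous G → Integrable fun z' =>
          G z' * fderiv ℝ θ (x - z') (phaseField E t x - phaseField E t z') := fun G hG =>
        (hG.mul (hfdx.clm_apply (continuous_const.sub hbc))).integrable_of_hasCompactSupport
          (HasCompactSupport.intro hcs fun z' hz => by simp [hcs' z' hz])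
      have h2 : ∫ z', F t z' * fderiv ℝ θ (x - z') (phaseField E t x - phaseField E t z')
          = ∫ z', (F t z' - F t x) *
              fderiv ℝ θ (x - z') (phaseField E t x - phaseField E t z') := by
        simp only [sub_mul]
        rw [integral_sub (hi _ (hF.lipschitz t ht).continuous) (hi _ continuous_const),
          integral_const_mul, hdiv, mul_zero, sub_zero]
      rw [h2]
      have hgi : Integrable fun z' => ‖fderiv ℝ θ (x - z')‖ :=
        hfdx.norm.integrable_of_hasCompactSupport hcs.norm
      refine (norm_integral_le_of_norm_le (hgi.const_mul (L * ε * (hE.lip * ε)))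
        (Eventually.of_forall fun z' => ?_)).trans ?_
      · rw [norm_mul]
        by_cases hz : ε < ‖x - z'‖
        · simp [hfzero _ hz]
        · have h3 := (hF.lipschitz t ht).dist_le_mul z' x
          rw [dist_eq_norm, dist_comm, dist_eq_norm] at h3
          have h4 := (hE.lipschitzWith_phaseField t).dist_le_mul x z'
          rw [dist_eq_norm, dist_eq_norm] at h4
          have h5 := (fderiv ℝ θ (x - z')).le_opNorm (phaseField E t x - phaseField E t z')
          have hz' := not_lt.1 hz
          calc _ ≤ (L * ε) * (‖fderiv ℝ θ (x - z')‖ * (hE.lip * ε)) := by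
                refine mul_le_mul (h3.trans (by gcongr)) (h5.trans ?_) (norm_nonneg _)
                  (by positivity)
                gcongr
                exact h4.trans (by gcongr)
            _ = _ := by ring
      · rw [integral_const_mul, integral_sub_left_eq_self (fun w => ‖fderiv ℝ θ w‖) volume x]
        calc _ ≤ L * ε * (hE.lip * ε) * (C / ε) := by gcongr
          _ = _ := by field_simp
    have hmv := Convex.norm_image_sub_le_of_norm_hasDerivWithin_le (𝕜 := ℝ)
      (fun t ht => hF.hasDerivWithinAt_integral_mul_flow hE hθ hc z ht) hkd (convex_Icc 0 T) h0' hT'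
    have h1 := hkF T hT'
    have h2 := hkF 0 h0'
    rw [hE.flow_self] at h2
    rw [sub_zero, Real.norm_of_nonneg hT] at hmv
    have h3 : |k T - k 0| ≤ L * hE.lip * C * ε * T := hmv
    have h4 : F T (hE.flow T 0 z) - F 0 z
        = (k T - k 0) - (k T - F T (hE.flow T 0 z)) + (k 0 - F 0 z) := by ring
    rw [h4]
    refine (abs_add_le _ _).trans ?_
    have h5 := abs_sub (k T - k 0) (k T - F T (hE.flow T 0 z))
    nlinarith
  have hlim : Tendsto (fun ε : ℝ => ε * (L * hE.lip * C * T + 2 * L)) (𝓝[>] 0) (𝓝 0) := by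
    have : Tendsto (fun ε : ℝ => ε * (L * hE.lip * C * T + 2 * L)) (𝓝 0)
        (𝓝 (0 * (L * hE.lip * C * T + 2 * L))) := tendsto_id.mul_const _
    rw [zero_mul] at this
    exact this.mono_left nhdsWithin_le_nhds
  have := ge_of_tendsto hlim (by filter_upwards [self_mem_nhdsWithin] with ε hε using key ε hε)
  exact sub_eq_zero.1 (abs_eq_zero.1 (le_antisymm this (abs_nonneg _)))

end TransportSolution

/-! ### Stability of trajectories -/

theorem continuous_one_add_abs_rpow (β : ℝ) : Continuous fun s : ℝ => (1 + |s|) ^ β :=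
  (by fun_prop : Continuous fun s : ℝ => 1 + |s|).rpow_const
    fun s => Or.inl (by positivity)

theorem integral_one_add_abs_rpow {β t : ℝ} (hβ : β ≠ -1) (ht : 0 ≤ t) :
    ∫ s in (0 : ℝ)..t, (1 + |s|) ^ β = ((1 + t) ^ (β + 1) - 1) / (β + 1) := by
  have hb : β + 1 ≠ 0 := fun h => hβ (by linarith)
  have h1 : ∀ s ∈ Set.uIcc 0 t, HasDerivAt (fun s : ℝ => (1 + s) ^ (β + 1) / (β + 1))
      ((1 + |s|) ^ β) s := by
    intro s hs
    rw [Set.uIcc_of_le ht] at hs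
    have h2 : HasDerivAt (fun s : ℝ => 1 + s) 1 s := (hasDerivAt_id s).const_add 1
    have h3 := (h2.rpow_const (p := β + 1) (Or.inl (by linarith [hs.1] : (1 + s) ≠ 0))).div_const
      (β + 1)
    convert! h3 using 1
    rw [abs_of_nonneg hs.1, add_sub_cancel_right]
    field_simp
  rw [intervalIntegral.integral_eq_sub_of_hasDerivAt h1
    ((continuous_one_add_abs_rpow β).intervalIntegrable _ _)]
  simp [sub_div]

/-- The full integral is 1/α, and 1/2 < α. -/
theorem integral_one_add_abs_rpow_le_two {α t : ℝ} (hα : 1 / 2 < α) (ht : 0 ≤ t) :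
    ∫ s in (0 : ℝ)..t, (1 + |s|) ^ (-(1 + α)) ≤ 2 := by
  rw [integral_one_add_abs_rpow (by linarith) ht]
  have h1 : 0 ≤ (1 + t) ^ (-(1 + α) + 1) := by positivity
  have h2 : -(1 + α) + 1 = -α := by ring
  rw [h2] at h1 ⊢
  rw [div_neg, ← neg_div, div_le_iff₀ (by linarith)]
  linarith

theorem integral_one_add_abs_rpow_neg_le {α t : ℝ} (hα : 0 < α) (hα' : α < 1) (ht : 1 ≤ t) :
    ∫ s in (0 : ℝ)..t, (1 + |s|) ^ (-α) ≤ 2 / (1 - α) * t ^ (1 - α) := by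
  rw [integral_one_add_abs_rpow (by linarith) (by linarith)]
  have h2 : -α + 1 = 1 - α := by ring
  rw [h2, div_mul_eq_mul_div]
  have h3 : 0 < 1 - α := by linarith
  refine div_le_div_of_nonneg_right ?_ h3.le
  have h4 : (1 + t) ^ (1 - α) ≤ (2 * t) ^ (1 - α) :=
    Real.rpow_le_rpow (by linarith) (by linarith) h3.le
  rw [Real.mul_rpow (by norm_num) (by linarith)] at h4
  have h5 : (2 : ℝ) ^ (1 - α) ≤ 2 ^ (1 : ℝ) :=
    Real.rpow_le_rpow_of_exponent_le (by norm_num) (by linarith)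
  rw [Real.rpow_one] at h5
  have h6 : 0 ≤ t ^ (1 - α) := by positivity
  nlinarith

/-- A linear bootstrap for weighted suprema. -/
theorem norm_le_of_bootstrap {D : ℝ → E3} {w : ℝ → ℝ} {T a : ℝ} (hT : 0 ≤ T)
    (hD : Continuous D) (hw : Continuous w) (hw0 : ∀ s ∈ Set.Icc 0 T, 0 < w s)
    (h : ∀ M, 0 ≤ M → (∀ s ∈ Set.Icc 0 T, ‖D s‖ ≤ M * w s) →
      ∀ s ∈ Set.Icc 0 T, ‖D s‖ ≤ (a + M / 2) * w s) :
    ∀ s ∈ Set.Icc 0 T, ‖D s‖ ≤ 2 * a * w s := by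
  -- The smallest admissible M is finite and attained, and at the maximising time the hypothesis
  -- reads M ≤ a + M/2.
  obtain ⟨s₀, hs₀, hmax⟩ := isCompact_Icc.exists_isMaxOn (Set.nonempty_Icc.2 hT)
    (f := fun s => ‖D s‖ / w s)
    (hD.norm.continuousOn.div hw.continuousOn fun s hs => (hw0 s hs).ne')
  set M := ‖D s₀‖ / w s₀ with hM
  have hM0 : 0 ≤ M := div_nonneg (norm_nonneg _) (hw0 s₀ hs₀).le
  have h1 : ∀ s ∈ Set.Icc 0 T, ‖D s‖ ≤ M * w s := fun s hs =>
    (div_le_iff₀ (hw0 s hs)).1 (hmax hs)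
  have h2 := h M hM0 h1 s₀ hs₀
  rw [← div_le_iff₀ (hw0 s₀ hs₀), ← hM] at h2
  intro s hs
  refine (h1 s hs).trans (mul_le_mul_of_nonneg_right (by linarith) (hw0 s hs).le)

variable {α K : ℝ} {E : ℝ → E3 → E3} {γ γ' : ℝ → Phase}

namespace IsTrajectory

theorem hasDerivAt_fst (h : IsTrajectory E γ) (t : ℝ) :
    HasDerivAt (fun t => (γ t).1) (γ t).2 t :=
  (hasFDerivAt_fst (p := γ t)).comp_hasDerivAt t (h t)

theorem hasDerivAt_snd (h : IsTrajectory E γ) (t : ℝ) :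
    HasDerivAt (fun t => (γ t).2) (E t (γ t).1) t :=
  (hasFDerivAt_snd (p := γ t)).comp_hasDerivAt t (h t)

theorem continuous (h : IsTrajectory E γ) : Continuous γ :=
  continuous_iff_continuousAt.2 fun t => (h t).continuousAt

theorem continuous_force (h : IsTrajectory E γ) (hE : DecayingForce α K E) :
    Continuous fun t => E t (γ t).1 :=
  hE.continuous.comp (continuous_id.prodMk (continuous_fst.comp h.continuous))

theorem snd_eq (h : IsTrajectory E γ) (hE : DecayingForce α K E) (r s : ℝ) :
    (γ r).2 = (γ s).2 + ∫ σ in s..r, E σ (γ σ).1 := by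
  rw [intervalIntegral.integral_eq_sub_of_hasDerivAt (fun σ _ => h.hasDerivAt_snd σ)
    ((h.continuous_force hE).intervalIntegrable _ _)]
  abel

theorem fst_eq (h : IsTrajectory E γ) (hE : DecayingForce α K E) (r s : ℝ) :
    (γ r).1 = (γ s).1 + (r - s) • (γ s).2 + ∫ σ in s..r, (r - σ) • E σ (γ σ).1 := by
  have h1 : ∀ σ, HasDerivAt (fun σ => (γ σ).1 + (r - σ) • (γ σ).2) ((r - σ) • E σ (γ σ).1) σ := by
    intro σ
    have h2 : HasDerivAt (fun σ : ℝ => r - σ) (-1) σ := by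
      simpa using (hasDerivAt_id σ).const_sub r
    have h3 := (h.hasDerivAt_fst σ).add (h2.smul (h.hasDerivAt_snd σ))
    convert! h3 using 1
    module
  have hc : Continuous fun σ => (r - σ) • E σ (γ σ).1 :=
    (continuous_const.sub continuous_id).smul (h.continuous_force hE)
  rw [intervalIntegral.integral_eq_sub_of_hasDerivAt (fun σ _ => h1 σ) (hc.intervalIntegrable _ _)]
  simp

theorem snd_sub_eq (h : IsTrajectory E γ) (h' : IsTrajectory E γ') (hE : DecayingForce α K E)
    (r s : ℝ) : (γ r).2 - (γ' r).2 = (γ s).2 - (γ' s).2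
      + ∫ σ in s..r, (E σ (γ σ).1 - E σ (γ' σ).1) := by
  rw [intervalIntegral.integral_sub ((h.continuous_force hE).intervalIntegrable _ _)
    ((h'.continuous_force hE).intervalIntegrable _ _), h.snd_eq hE r s, h'.snd_eq hE r s]
  abel

theorem fst_sub_eq (h : IsTrajectory E γ) (h' : IsTrajectory E γ') (hE : DecayingForce α K E)
    (r s : ℝ) : (γ r).1 - (γ' r).1 = (γ s).1 - (γ' s).1 + (r - s) • ((γ s).2 - (γ' s).2)
      + ∫ σ in s..r, (r - σ) • (E σ (γ σ).1 - E σ (γ' σ).1) := by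
  have hc : Continuous fun σ => (r - σ) • E σ (γ σ).1 :=
    (continuous_const.sub continuous_id).smul (h.continuous_force hE)
  have hc' : Continuous fun σ => (r - σ) • E σ (γ' σ).1 :=
    (continuous_const.sub continuous_id).smul (h'.continuous_force hE)
  simp only [smul_sub]
  rw [intervalIntegral.integral_sub (hc.intervalIntegrable _ _) (hc'.intervalIntegrable _ _),
    h.fst_eq hE r s, h'.fst_eq hE r s]
  module

theorem norm_force_sub_le (hE : DecayingForce α K E) {t : ℝ} {B : ℝ → ℝ}
    (hB : ∀ σ ∈ Set.Icc 0 t, ‖(γ σ).1 - (γ' σ).1‖ ≤ B σ) {σ : ℝ} (hσ : σ ∈ Set.Icc 0 t) :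
    ‖E σ (γ σ).1 - E σ (γ' σ).1‖ ≤ K * ((1 + |σ|) ^ (-(2 + α)) * B σ) := by
  refine (hE.lipschitz_le σ _ _).trans ?_
  rw [mul_assoc]
  have := hE.nonneg
  have := hB σ hσ
  gcongr

theorem norm_integral_force_sub_le (hE : DecayingForce α K E) {t : ℝ}
    {B : ℝ → ℝ} (hBc : Continuous B) (hB : ∀ σ ∈ Set.Icc 0 t, ‖(γ σ).1 - (γ' σ).1‖ ≤ B σ)
    (ht : 0 ≤ t) :
    ‖∫ σ in (0 : ℝ)..t, (E σ (γ σ).1 - E σ (γ' σ).1)‖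
      ≤ K * ∫ σ in (0 : ℝ)..t, (1 + |σ|) ^ (-(2 + α)) * B σ := by
  rw [← intervalIntegral.integral_const_mul]
  refine intervalIntegral.norm_integral_le_of_norm_le ht
    (Eventually.of_forall fun σ hσ => norm_force_sub_le hE hB ⟨hσ.1.le, hσ.2⟩) ?_
  exact (((continuous_one_add_abs_rpow _).mul hBc).const_mul K).intervalIntegrable _ _

theorem norm_integral_forward_le (hE : DecayingForce α K E) {t : ℝ}
    {B : ℝ → ℝ} (hBc : Continuous B) (hB : ∀ σ ∈ Set.Icc 0 t, ‖(γ σ).1 - (γ' σ).1‖ ≤ B σ)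
    (ht : 0 ≤ t) :
    ‖∫ σ in (0 : ℝ)..t, (t - σ) • (E σ (γ σ).1 - E σ (γ' σ).1)‖
      ≤ t * (K * ∫ σ in (0 : ℝ)..t, (1 + |σ|) ^ (-(2 + α)) * B σ) := by
  rw [← intervalIntegral.integral_const_mul, ← intervalIntegral.integral_const_mul]
  refine intervalIntegral.norm_integral_le_of_norm_le ht
    (Eventually.of_forall fun σ hσ => ?_) ?_
  · rw [norm_smul, Real.norm_of_nonneg (by linarith [hσ.2])]
    exact mul_le_mul (by linarith [hσ.1]) (norm_force_sub_le hE hB ⟨hσ.1.le, hσ.2⟩)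
      (norm_nonneg _) ht
  · exact ((((continuous_one_add_abs_rpow _).mul hBc).const_mul K).const_mul t).intervalIntegrable
      _ _

/-- Integrating backward from t, the time lag σ - r is at most 1 + σ, so it costs one power of decay
instead of a factor t. -/
theorem norm_integral_backward_le (hE : DecayingForce α K E) {r t : ℝ}
    {B : ℝ → ℝ} (hBc : Continuous B) (hB : ∀ σ ∈ Set.Icc 0 t, ‖(γ σ).1 - (γ' σ).1‖ ≤ B σ)
    (hr : 0 ≤ r) (hrt : r ≤ t) :
    ‖∫ σ in t..r, (r - σ) • (E σ (γ σ).1 - E σ (γ' σ).1)‖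
      ≤ K * ∫ σ in (0 : ℝ)..t, (1 + |σ|) ^ (-(1 + α)) * B σ := by
  have hc : Continuous fun σ => K * ((1 + |σ|) ^ (-(1 + α)) * B σ) :=
    ((continuous_one_add_abs_rpow _).mul hBc).const_mul K
  have hK := hE.nonneg
  have hB0 : ∀ σ ∈ Set.Icc 0 t, 0 ≤ B σ := fun σ hσ => (norm_nonneg _).trans (hB σ hσ)
  rw [← intervalIntegral.integral_const_mul, intervalIntegral.integral_symm, norm_neg]
  have h1 : ‖∫ σ in r..t, (r - σ) • (E σ (γ σ).1 - E σ (γ' σ).1)‖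
      ≤ ∫ σ in r..t, K * ((1 + |σ|) ^ (-(1 + α)) * B σ) := by
    refine intervalIntegral.norm_integral_le_of_norm_le hrt
      (Eventually.of_forall fun σ hσ => ?_) (hc.intervalIntegrable _ _)
    have hσ' : σ ∈ Set.Icc 0 t := ⟨by linarith [hσ.1], hσ.2⟩
    rw [norm_smul, Real.norm_eq_abs, abs_sub_comm, abs_of_nonneg (by linarith [hσ.1])]
    calc (σ - r) * ‖E σ (γ σ).1 - E σ (γ' σ).1‖
        ≤ (1 + |σ|) * (K * ((1 + |σ|) ^ (-(2 + α)) * B σ)) :=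
          mul_le_mul (by rw [abs_of_nonneg hσ'.1]; linarith) (norm_force_sub_le hE hB hσ')
            (norm_nonneg _) (by positivity)
      _ = K * ((1 + |σ|) ^ (-(1 + α)) * B σ) := by
          have : (1 + |σ|) ^ (-(1 + α)) = (1 + |σ|) * (1 + |σ|) ^ (-(2 + α)) := by
            conv_rhs => lhs; rw [← Real.rpow_one (1 + |σ|)]
            rw [← Real.rpow_add (by positivity)]
            congr 1; ring
          rw [this]; ring
  refine h1.trans ?_
  refine intervalIntegral.integral_mono_interval hr hrt le_rfl ?_ (hc.intervalIntegrable _ _)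
  filter_upwards [ae_restrict_mem measurableSet_Ioc] with σ hσ
  have := hB0 σ ⟨hσ.1.le, hσ.2⟩
  simp only [Pi.zero_apply]
  positivity

theorem continuous_fst_sub (h : IsTrajectory E γ) (h' : IsTrajectory E γ') :
    Continuous fun σ => (γ σ).1 - (γ' σ).1 :=
  (continuous_fst.comp h.continuous).sub (continuous_fst.comp h'.continuous)

/-- Trajectories issued from the same position separate linearly in time. -/
theorem forward_sub_le (h : IsTrajectory E γ) (h' : IsTrajectory E γ')
    (hE : DecayingForce α K E) (hK : K ≤ 1 / 8) (h0 : (γ 0).1 = (γ' 0).1) {t : ℝ} (ht : 0 ≤ t) :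
    ‖(γ t).1 - (γ' t).1 - t • ((γ 0).2 - (γ' 0).2)‖ ≤ 1 / 2 * t * ‖(γ 0).2 - (γ' 0).2‖ ∧
    ‖(γ t).2 - (γ' t).2 - ((γ 0).2 - (γ' 0).2)‖ ≤ 1 / 2 * ‖(γ 0).2 - (γ' 0).2‖ := by
  set k := (γ 0).2 - (γ' 0).2 with hk
  have hK0 := hE.nonneg
  -- Linear growth of the separation uses up one power of the decay of the Lipschitz constant; the
  -- rest integrates to at most 2, and K ≤ 1/8 leaves M/4.
  have hI : ∀ M r, 0 ≤ M → 0 ≤ r →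
      K * ∫ σ in (0 : ℝ)..r, (1 + |σ|) ^ (-(2 + α)) * (M * (1 + |σ|)) ≤ M / 4 := by
    intro M r hM hr
    have h1 : ∀ σ : ℝ, (1 + |σ|) ^ (-(2 + α)) * (M * (1 + |σ|)) = M * (1 + |σ|) ^ (-(1 + α)) := by
      intro σ
      have : (1 + |σ|) ^ (-(1 + α)) = (1 + |σ|) ^ (-(2 + α)) * (1 + |σ|) := by
        conv_rhs => rhs; rw [← Real.rpow_one (1 + |σ|)]
        rw [← Real.rpow_add (by positivity)]
        congr 1; ring
      rw [this]; ring
    simp only [h1, intervalIntegral.integral_const_mul]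
    have h2 := integral_one_add_abs_rpow_le_two hE.half_lt hr
    have h3 : 0 ≤ ∫ s in (0 : ℝ)..r, (1 + |s|) ^ (-(1 + α)) :=
      intervalIntegral.integral_nonneg hr fun σ _ => by positivity
    calc _ ≤ 1 / 8 * (M * 2) := by gcongr
      _ = _ := by ring
  have hfst : ∀ r, (γ r).1 - (γ' r).1 = r • k
      + ∫ σ in (0 : ℝ)..r, (r - σ) • (E σ (γ σ).1 - E σ (γ' σ).1) := by
    intro r
    rw [h.fst_sub_eq h' hE r 0, h0, sub_self, zero_add, sub_zero]
  have hsup := norm_le_of_bootstrap (D := fun σ => (γ σ).1 - (γ' σ).1) (w := fun σ => 1 + |σ|)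
    (a := ‖k‖) ht (h.continuous_fst_sub h') (by fun_prop) (fun s _ => by positivity)
    (fun M hM hMb s hs => by
      rw [hfst s]
      have h1 := norm_integral_forward_le hE (t := s) (B := fun σ => M * (1 + |σ|)) (by fun_prop)
        (fun σ hσ => hMb σ ⟨hσ.1, hσ.2.trans hs.2⟩) hs.1
      have h2 := hI M s hM hs.1
      have h3 := mul_le_mul_of_nonneg_left h2 hs.1
      refine (norm_add_le _ _).trans ?_
      rw [norm_smul, Real.norm_of_nonneg hs.1, abs_of_nonneg hs.1]
      nlinarith [norm_nonneg k, hs.1, mul_nonneg hM hs.1])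
  have hb := norm_integral_forward_le hE (t := t) (B := fun σ => 2 * ‖k‖ * (1 + |σ|))
    (by fun_prop) hsup ht
  have hb2 := norm_integral_force_sub_le hE (t := t) (B := fun σ => 2 * ‖k‖ * (1 + |σ|))
    (by fun_prop) hsup ht
  have hI' := hI (2 * ‖k‖) t (by positivity) ht
  constructor
  · rw [hfst t, add_sub_cancel_left]
    refine hb.trans ((mul_le_mul_of_nonneg_left hI' ht).trans (le_of_eq ?_))
    ring
  · rw [h.snd_sub_eq h' hE t 0, ← hk, add_sub_cancel_left]
    refine hb2.trans (hI'.trans (le_of_eq ?_))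
    ring

/-- The deviation from free separation is at most half of it. Divided by t, this is the expansion
hypothesis under which singular integrals along the flow are bounded. -/
theorem forward_fst_expanding (h : IsTrajectory E γ) (h' : IsTrajectory E γ')
    (hE : DecayingForce α K E) (hK : K ≤ 1 / 8) (h0 : (γ 0).1 = (γ' 0).1) {t : ℝ} (ht : 0 ≤ t) :
    t * ‖(γ 0).2 - (γ' 0).2‖ ≤ 2 * ‖(γ t).1 - (γ' t).1‖ := by
  have h1 := (h.forward_sub_le h' hE hK h0 ht).1
  have h2 := norm_sub_norm_le (t • ((γ 0).2 - (γ' 0).2)) ((γ t).1 - (γ' t).1)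
  rw [norm_sub_rev (t • _), norm_smul, Real.norm_of_nonneg ht] at h2
  linarith

theorem forward_snd_expanding (h : IsTrajectory E γ) (h' : IsTrajectory E γ')
    (hE : DecayingForce α K E) (hK : K ≤ 1 / 8) (h0 : (γ 0).1 = (γ' 0).1) {t : ℝ} (ht : 0 ≤ t) :
    ‖(γ 0).2 - (γ' 0).2‖ ≤ 2 * ‖(γ t).2 - (γ' t).2‖ := by
  have h1 := (h.forward_sub_le h' hE hK h0 ht).2
  have h2 := norm_sub_norm_le ((γ 0).2 - (γ' 0).2) ((γ t).2 - (γ' t).2)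
  rw [norm_sub_rev (_ - _)] at h2
  linarith

theorem integral_backward_le_of_const (hE : DecayingForce α K E) (hK : K ≤ 1 / 8) {M t : ℝ}
    (hM : 0 ≤ M) (ht : 0 ≤ t) :
    K * ∫ σ in (0 : ℝ)..t, (1 + |σ|) ^ (-(1 + α)) * M ≤ M / 4 := by
  rw [intervalIntegral.integral_mul_const]
  have h2 := integral_one_add_abs_rpow_le_two hE.half_lt ht
  have h3 : 0 ≤ ∫ s in (0 : ℝ)..t, (1 + |s|) ^ (-(1 + α)) :=
    intervalIntegral.integral_nonneg ht fun σ _ => by positivity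
  calc _ ≤ 1 / 8 * (2 * M) := by gcongr
    _ = _ := by ring

/-- Backward stability with respect to the final position. -/
theorem backward_sub_le_of_snd_eq (h : IsTrajectory E γ) (h' : IsTrajectory E γ')
    (hE : DecayingForce α K E) (hK : K ≤ 1 / 8) {t : ℝ} (ht : 0 ≤ t) (h0 : (γ t).2 = (γ' t).2) :
    ‖γ 0 - γ' 0‖ ≤ 2 * ‖(γ t).1 - (γ' t).1‖ := by
  set k := (γ t).1 - (γ' t).1 with hk
  have hfst : ∀ r, (γ r).1 - (γ' r).1 = k
      + ∫ σ in t..r, (r - σ) • (E σ (γ σ).1 - E σ (γ' σ).1) := by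
    intro r
    rw [h.fst_sub_eq h' hE r t, h0, sub_self, smul_zero, add_zero]
  have hsup := norm_le_of_bootstrap (D := fun σ => (γ σ).1 - (γ' σ).1) (w := fun _ => 1)
    (a := ‖k‖) ht (h.continuous_fst_sub h') (by fun_prop) (fun s _ => by positivity)
    (fun M hM hMb s hs => by
      rw [hfst s]
      have h1 := norm_integral_backward_le hE (r := s) (t := t) (B := fun σ => M) (by fun_prop)
        (fun σ hσ => by simpa using hMb σ hσ) hs.1 hs.2
      have h2 := integral_backward_le_of_const hE hK hM ht
      refine (norm_add_le _ _).trans ?_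
      linarith)
  have h1 := norm_integral_force_sub_le hE (t := t) (B := fun σ => 2 * ‖k‖)
    (by fun_prop) (fun σ hσ => by simpa using hsup σ hσ) ht
  have h2 := integral_backward_le_of_const hE hK (M := 2 * ‖k‖) (by positivity) ht
  have h3 : ∫ σ in (0 : ℝ)..t, (1 + |σ|) ^ (-(2 + α)) * (2 * ‖k‖)
      ≤ ∫ σ in (0 : ℝ)..t, (1 + |σ|) ^ (-(1 + α)) * (2 * ‖k‖) := by
    refine intervalIntegral.integral_mono_on ht
      (((continuous_one_add_abs_rpow _).mul continuous_const).intervalIntegrable _ _)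
      (((continuous_one_add_abs_rpow _).mul continuous_const).intervalIntegrable _ _)
      fun σ _ => ?_
    refine mul_le_mul_of_nonneg_right (Real.rpow_le_rpow_of_exponent_le
      (by linarith [abs_nonneg σ]) (by linarith)) (by positivity)
  have h4 := mul_le_mul_of_nonneg_left h3 hE.nonneg
  have h5 := h.snd_sub_eq h' hE t 0
  rw [h0, sub_self] at h5
  have h6 : ‖(γ 0).2 - (γ' 0).2‖ ≤ 2 * ‖k‖ := by
    rw [eq_neg_of_add_eq_zero_left h5.symm, norm_neg]
    linarith [norm_nonneg k]
  rw [Prod.norm_def]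
  exact max_le (by simpa using hsup 0 ⟨le_rfl, ht⟩) h6

/-- Backward stability for final data whose free parts nearly coincide at time `0`. -/
theorem backward_sub_le_of_fst_sub (h : IsTrajectory E γ) (h' : IsTrajectory E γ')
    (hE : DecayingForce α K E) (hK : K ≤ (1 - α) / 16) {t a : ℝ} (ht : 1 ≤ t) (ha : 0 ≤ a)
    (h0 : ‖(γ t).1 - (γ' t).1 - t • ((γ t).2 - (γ' t).2)‖
      ≤ a * t ^ (1 - α) * ‖(γ t).2 - (γ' t).2‖) :
    ‖γ 0 - γ' 0‖ ≤ 2 * (1 + a) * t ^ (1 - α) * ‖(γ t).2 - (γ' t).2‖ := by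
  set k := (γ t).2 - (γ' t).2 with hk
  set e := (γ t).1 - (γ' t).1 - t • k with he
  set q := t ^ (1 - α) with hq
  have hα := hE.alpha_pos
  have hα1 := hE.lt_one
  have hq1 : 1 ≤ q := Real.one_le_rpow ht (by linarith)
  have ht0 : 0 ≤ t := by linarith
  have hK0 := hE.nonneg
  -- The weight σ + t^{1-α} reproduces itself: its linear part integrates against the decay to
  -- 2t^{1-α}/(1-α), its constant part to at most 2t^{1-α}. The smallness K ≤ (1-α)/16 cancels the
  -- factor 1/(1-α).
  have hI : ∀ M, 0 ≤ M →
      K * ∫ σ in (0 : ℝ)..t, (1 + |σ|) ^ (-(1 + α)) * (M * (|σ| + q)) ≤ M / 4 * q := by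
    intro M hM
    have hle : ∫ σ in (0 : ℝ)..t, (1 + |σ|) ^ (-(1 + α)) * (M * (|σ| + q))
        ≤ ∫ σ in (0 : ℝ)..t, (M * (1 + |σ|) ^ (-α) + M * q * (1 + |σ|) ^ (-(1 + α))) := by
      refine intervalIntegral.integral_mono_on ht0
        (((continuous_one_add_abs_rpow _).mul (by fun_prop)).intervalIntegrable _ _)
        ((((continuous_one_add_abs_rpow _).const_mul _).add
          ((continuous_one_add_abs_rpow _).const_mul _)).intervalIntegrable _ _) fun σ _ => ?_
      have : (1 + |σ|) ^ (-α) = (1 + |σ|) ^ (-(1 + α)) * (1 + |σ|) := by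
        conv_rhs => rhs; rw [← Real.rpow_one (1 + |σ|)]
        rw [← Real.rpow_add (by positivity)]
        congr 1; ring
      rw [this]
      have : 0 ≤ M * (1 + |σ|) ^ (-(1 + α)) := by positivity
      nlinarith
    rw [intervalIntegral.integral_add
      (((continuous_one_add_abs_rpow _).const_mul _).intervalIntegrable _ _)
      (((continuous_one_add_abs_rpow _).const_mul _).intervalIntegrable _ _),
      intervalIntegral.integral_const_mul, intervalIntegral.integral_const_mul] at hle
    have h1 := integral_one_add_abs_rpow_neg_le hα hα1 ht
    have h2 := integral_one_add_abs_rpow_le_two hE.half_lt ht0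
    have hd : 0 < 1 - α := by linarith
    calc K * ∫ σ in (0 : ℝ)..t, (1 + |σ|) ^ (-(1 + α)) * (M * (|σ| + q))
        ≤ (1 - α) / 16 * (M * (2 / (1 - α) * q) + M * q * 2) := by
          refine mul_le_mul hK (hle.trans ?_) ?_ (by linarith)
          · gcongr
          · exact intervalIntegral.integral_nonneg ht0 fun σ _ => by positivity
      _ = (M / 8 + (1 - α) * M / 8) * q := by field_simp; ring
      _ ≤ M / 4 * q := by
          refine mul_le_mul_of_nonneg_right ?_ (by linarith)
          nlinarith
  have hfst : ∀ r, (γ r).1 - (γ' r).1 = e + r • k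
      + ∫ σ in t..r, (r - σ) • (E σ (γ σ).1 - E σ (γ' σ).1) := by
    intro r
    rw [h.fst_sub_eq h' hE r t, he]
    module
  have hsup := norm_le_of_bootstrap (D := fun σ => (γ σ).1 - (γ' σ).1) (w := fun σ => |σ| + q)
    (a := (1 + a) * ‖k‖) ht0 (h.continuous_fst_sub h') (by fun_prop) (fun s _ => by positivity)
    (fun M hM hMb s hs => by
      rw [hfst s]
      have h1 := norm_integral_backward_le hE (r := s) (t := t) (B := fun σ => M * (|σ| + q))
        (by fun_prop) hMb hs.1 hs.2
      have h2 := hI M hM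
      have h3 : ‖e + s • k‖ ≤ (1 + a) * ‖k‖ * (|s| + q) := by
        refine (norm_add_le _ _).trans ?_
        rw [norm_smul, Real.norm_eq_abs]
        have : 0 ≤ a * ‖k‖ * |s| := by positivity
        have : 0 ≤ ‖k‖ * q := by positivity
        nlinarith
      refine (norm_add_le _ _).trans ?_
      have : 0 ≤ M * |s| := by positivity
      have : 0 ≤ M * q := by positivity
      nlinarith)
  have h1 := norm_integral_force_sub_le hE (t := t)
    (B := fun σ => 2 * ((1 + a) * ‖k‖) * (|σ| + q)) (by fun_prop) hsup ht0
  have h2 := hI (2 * ((1 + a) * ‖k‖)) (by positivity)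
  have h3 : ∫ σ in (0 : ℝ)..t, (1 + |σ|) ^ (-(2 + α)) * (2 * ((1 + a) * ‖k‖) * (|σ| + q))
      ≤ ∫ σ in (0 : ℝ)..t, (1 + |σ|) ^ (-(1 + α)) * (2 * ((1 + a) * ‖k‖) * (|σ| + q)) := by
    refine intervalIntegral.integral_mono_on ht0
      (((continuous_one_add_abs_rpow _).mul (by fun_prop)).intervalIntegrable _ _)
      (((continuous_one_add_abs_rpow _).mul (by fun_prop)).intervalIntegrable _ _)
      fun σ _ => ?_
    refine mul_le_mul_of_nonneg_right (Real.rpow_le_rpow_of_exponent_le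
      (by linarith [abs_nonneg σ]) (by linarith)) (by positivity)
  have h4 := mul_le_mul_of_nonneg_left h3 hK0
  have h5 := h.snd_sub_eq h' hE t 0
  rw [← hk] at h5
  have hkk : 0 ≤ (1 + a) * ‖k‖ := by positivity
  have h6 : ‖(γ 0).2 - (γ' 0).2‖ ≤ 2 * (1 + a) * q * ‖k‖ := by
    rw [eq_sub_of_add_eq h5.symm]
    refine (norm_sub_le _ _).trans ?_
    have h7 : ‖k‖ ≤ (1 + a) * ‖k‖ * q := by
      have : ‖k‖ ≤ (1 + a) * ‖k‖ := by nlinarith [norm_nonneg k]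
      nlinarith
    nlinarith
  have h8 : ‖(γ 0).1 - (γ' 0).1‖ ≤ 2 * (1 + a) * q * ‖k‖ := by
    have := hsup 0 ⟨le_rfl, ht0⟩
    simp only [abs_zero, zero_add] at this
    linarith
  rw [Prod.norm_def]
  exact max_le h8 h6

end IsTrajectory

/-! ### Continuous representatives -/

theorem E3_eq_sum_dir (x : E3) : x = ∑ i, x i • dir i := by
  have := (EuclideanSpace.basisFun (Fin 3) ℝ).sum_repr x
  simpa [dir] using this.symm

theorem abs_apply_le_norm (x : E3) (i : Fin 3) : |x i| ≤ ‖x‖ := by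
  simpa using PiLp.norm_apply_le x i

/-- The coordinate directions of phase space. -/
noncomputable def dirPhase : Fin 3 ⊕ Fin 3 → Phase := Sum.elim dirX dirV

theorem ae_norm_le_of_eLpNorm_top_lt {X G : Type*} [MeasureSpace X] [NormedAddCommGroup G]
    {h : X → G} {c : ℝ} (hh : eLpNorm h ⊤ volume < ENNReal.ofReal c) : ∀ᵐ z, ‖h z‖ ≤ c := by
  have hc : 0 < c := ENNReal.ofReal_pos.1 (bot_le.trans_lt hh)
  rw [eLpNorm_exponent_top] at hh
  filter_upwards [ae_le_eLpNormEssSup (f := h) (μ := volume)] with z hz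
  have := hz.trans hh.le
  rwa [← ofReal_norm, ENNReal.ofReal_le_ofReal_iff hc.le] at this

/-- Each of the six coordinate derivatives is bounded by c, whence the factor 6. The strict
inequality is needed because the norm is an infimum that must be realised by an actual weak
derivative. -/
theorem exists_lipschitz_of_sobolevNorm_top_lt {u : Phase → ℝ} {c : ℝ}
    (hu : sobolevNorm ⊤ u < ENNReal.ofReal c) :
    ∃ v : Phase → ℝ, u =ᵐ[volume] v ∧ (∀ z, |v z| ≤ c) ∧
      ∀ x y, |v x - v y| ≤ 6 * c * ‖x - y‖ := by
  unfold sobolevNorm at hu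
  have h0 : weakDerivNorm (fun h => eLpNorm h ⊤ volume) [] u < ENNReal.ofReal c :=
    lt_of_le_of_lt (le_add_right le_self_add) hu
  have hX : ∀ i, weakDerivNorm (fun h => eLpNorm h ⊤ volume) [dirX i] u < ENNReal.ofReal c :=
    fun i => lt_of_le_of_lt ((Finset.single_le_sum (f := fun i =>
      weakDerivNorm (fun h => eLpNorm h ⊤ volume) [dirX i] u) (fun _ _ => bot_le)
        (Finset.mem_univ i)).trans (le_add_right le_add_self)) hu
  have hV : ∀ i, weakDerivNorm (fun h => eLpNorm h ⊤ volume) [dirV i] u < ENNReal.ofReal c :=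
    fun i => lt_of_le_of_lt ((Finset.single_le_sum (f := fun i =>
      weakDerivNorm (fun h => eLpNorm h ⊤ volume) [dirV i] u) (fun _ _ => bot_le)
        (Finset.mem_univ i)).trans le_add_self) hu
  have hD : ∀ j, ∃ g, IsWeakDeriv [dirPhase j] u g ∧ ∀ᵐ z, ‖g z‖ ≤ c := by
    rintro (i | i)
    · obtain ⟨g, hg, hgc⟩ := exists_isWeakDeriv_of_weakDerivNorm_lt (hX i)
      exact ⟨g, hg, ae_norm_le_of_eLpNorm_top_lt hgc⟩
    · obtain ⟨g, hg, hgc⟩ := exists_isWeakDeriv_of_weakDerivNorm_lt (hV i)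
      exact ⟨g, hg, ae_norm_le_of_eLpNorm_top_lt hgc⟩
  choose g hg hgc using hD
  obtain ⟨v, huv, hv⟩ := exists_lipschitz_of_isWeakDeriv
    (e := dirPhase) (c := fun j z => Sum.elim (fun i => z.1 i) (fun i => z.2 i) j)
    (fun z => by
      rw [Fintype.sum_sum_type]
      simp only [dirPhase, Sum.elim_inl, Sum.elim_inr]
      refine Prod.ext ?_ ?_
      · simpa [dirX, dirV, Prod.fst_sum, Prod.snd_sum] using E3_eq_sum_dir z.1
      · simpa [dirX, dirV, Prod.fst_sum, Prod.snd_sum] using E3_eq_sum_dir z.2)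
    (by
      rintro (i | i) z
      · exact (abs_apply_le_norm z.1 i).trans (norm_fst_le z)
      · exact (abs_apply_le_norm z.2 i).trans (norm_snd_le z))
    hg (M := fun _ => c) hgc
  have hv6 : ∀ x y, |v x - v y| ≤ 6 * c * ‖x - y‖ := fun x y => by
    have := hv x y
    simp only [Finset.sum_const, Finset.card_univ, Fintype.card_sum, Fintype.card_fin,
      nsmul_eq_mul] at this
    norm_num at this
    exact this
  have hc : 0 < c := ENNReal.ofReal_pos.1 (bot_le.trans_lt hu)
  have hvc : Continuous v := (LipschitzWith.of_dist_le_mul (K := ⟨6 * c, by positivity⟩)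
    fun x y => by rw [dist_eq_norm, dist_eq_norm]; exact hv6 x y).continuous
  refine ⟨v, huv, ?_, hv6⟩
  obtain ⟨g0, hg0, hg0c⟩ := exists_isWeakDeriv_of_weakDerivNorm_lt h0
  refine norm_le_of_ae_norm_le_of_continuous hvc ?_
  filter_upwards [huv, hg0.ae_eq_of_nil, ae_norm_le_of_eLpNorm_top_lt hg0c] with z h1 h2 h3
  rw [← h1, h2]; exact h3

theorem exists_lipschitz_vectorField {u : E3 → E3} {c b : ℝ} (hb : ∀ᵐ z, ‖u z‖ ≤ b)
    (hu : ∑ i, weakDerivNorm (fun h => eLpNorm h ⊤ volume) [dir i] u < ENNReal.ofReal c) :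
    ∃ v : E3 → E3, u =ᵐ[volume] v ∧ (∀ z, ‖v z‖ ≤ b) ∧
      ∀ x y, ‖v x - v y‖ ≤ 3 * c * ‖x - y‖ := by
  have hD : ∀ i, ∃ g, IsWeakDeriv [dir i] u g ∧ ∀ᵐ z, ‖g z‖ ≤ c := by
    intro i
    have : weakDerivNorm (fun h => eLpNorm h ⊤ volume) [dir i] u < ENNReal.ofReal c :=
      lt_of_le_of_lt (Finset.single_le_sum (f := fun i =>
        weakDerivNorm (fun h => eLpNorm h ⊤ volume) [dir i] u) (fun _ _ => bot_le)
          (Finset.mem_univ i)) hu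
    obtain ⟨g, hg, hgc⟩ := exists_isWeakDeriv_of_weakDerivNorm_lt this
    exact ⟨g, hg, ae_norm_le_of_eLpNorm_top_lt hgc⟩
  choose g hg hgc using hD
  obtain ⟨v, huv, hv⟩ := exists_lipschitz_of_isWeakDeriv
    (e := dir) (c := fun i x => x i) E3_eq_sum_dir (fun i x => abs_apply_le_norm x i)
    hg (M := fun _ => c) hgc
  have hv3 : ∀ x y, ‖v x - v y‖ ≤ 3 * c * ‖x - y‖ := fun x y => by
    simpa using hv x y
  have hc : 0 < c := ENNReal.ofReal_pos.1 (bot_le.trans_lt hu)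
  have hvc : Continuous v := (LipschitzWith.of_dist_le_mul (K := ⟨3 * c, by positivity⟩)
    fun x y => by rw [dist_eq_norm, dist_eq_norm]; exact hv3 x y).continuous
  refine ⟨v, huv, norm_le_of_ae_norm_le_of_continuous hvc ?_, hv3⟩
  filter_upwards [huv, hb] with z h1 h2
  rwa [← h1]

theorem exists_ae_eq_of_weakDerivNorm_nil_lt {N : (Phase → ℝ) → ℝ≥0∞} {u : Phase → ℝ} {c : ℝ≥0∞}
    (hu : weakDerivNorm N [] u < c) : ∃ g, u =ᵐ[volume] g ∧ LocallyIntegrable g ∧ N g < c := by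
  obtain ⟨g, hg, hgc⟩ := exists_isWeakDeriv_of_weakDerivNorm_lt hu
  exact ⟨g, hg.ae_eq_of_nil, hg.2.1, hgc⟩

theorem integrable_of_sobolevNorm_one_lt_top {u : Phase → ℝ} {c : ℝ≥0∞} (hc : c ≠ ⊤)
    (hu : sobolevNorm 1 u < c) : Integrable u ∧ ∫⁻ z, ‖u z‖ₑ < c := by
  have h0 : weakDerivNorm (fun h => eLpNorm h 1 volume) [] u < c :=
    lt_of_le_of_lt (le_add_right le_self_add) hu
  obtain ⟨g, hug, hgl, hgc⟩ := exists_ae_eq_of_weakDerivNorm_nil_lt h0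
  rw [eLpNorm_one_eq_lintegral_enorm] at hgc
  have he : ∫⁻ z, ‖u z‖ₑ = ∫⁻ z, ‖g z‖ₑ := by
    refine lintegral_congr_ae ?_
    filter_upwards [hug] with z hz; rw [hz]
  have hgi : Integrable g := ⟨hgl.aestronglyMeasurable, hgc.trans (lt_top_iff_ne_top.2 hc)⟩
  exact ⟨hgi.congr hug.symm, he ▸ hgc⟩

/-! ### Initial data -/

/-- The bounds on the weighted datum `F = ⟨x⟩ f₀` which are used in the sequel. -/
structure NiceDatum (η : ℝ) (F : Phase → ℝ) : Prop where
  pos : 0 < η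
  nonneg : ∀ z, 0 ≤ F z
  le : ∀ z, F z ≤ 2 * η
  lipschitz : ∀ p q, |F p - F q| ≤ 12 * η * ‖p - q‖
  mass : ∫⁻ z, ENNReal.ofReal (F z) ≤ ENNReal.ofReal (2 * η)
  sup_snd : ∫⁻ x, ⨆ v, ENNReal.ofReal (F (x, v)) ≤ ENNReal.ofReal (2 * η)
  sup_fst : ∫⁻ v, ⨆ x, ENNReal.ofReal (F (x, v)) ≤ ENNReal.ofReal (2 * η)

/-- The set where the essential supremum bounds h is closed and dense. True suprema are preferred
because fibrewise almost everywhere bounds are awkward along the flow. -/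
theorem iSup_enorm_le_eLpNorm_top {X : Type*} [TopologicalSpace X] [MeasureSpace X]
    [(volume : Measure X).IsOpenPosMeasure] {h : X → ℝ} (hh : Continuous h) :
    ⨆ v, ‖h v‖ₑ ≤ eLpNorm h ⊤ volume := by
  rw [eLpNorm_exponent_top]
  refine iSup_le fun v => ?_
  have hd : Dense {v | ‖h v‖ₑ ≤ eLpNormEssSup h volume} := Measure.dense_of_ae ae_le_eLpNormEssSup
  have hcl : IsClosed {v | ‖h v‖ₑ ≤ eLpNormEssSup h volume} :=
    isClosed_le hh.enorm continuous_const
  have := hd v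
  rwa [hcl.closure_eq] at this

theorem mixedSobolevNorm_nil_le (N : (Phase → ℝ) → ℝ≥0∞) (u : Phase → ℝ) :
    weakDerivNorm N [] u ≤ mixedSobolevNorm N u := by
  unfold mixedSobolevNorm
  have h1 := Finset.single_le_sum (f := fun m : Option (Fin 3) => ∑ m' : Option (Fin 3),
    weakDerivNorm N (m.toList.map dirX ++ m'.toList.map dirV) u) (fun _ _ => bot_le)
    (Finset.mem_univ none)
  refine le_trans ?_ h1
  have h2 := Finset.single_le_sum (f := fun m' : Option (Fin 3) =>
    weakDerivNorm N ((none : Option (Fin 3)).toList.map dirX ++ m'.toList.map dirV) u)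
    (fun _ _ => bot_le) (Finset.mem_univ none)
  exact le_trans (by simp) h2

/-- The weighted datum has a continuous representative with all the bounds needed. -/
theorem exists_niceDatum {f₀ : Phase → ℝ} {η : ℝ} (hη : 0 < η) (hf₀ : ∀ᵐ z, 0 ≤ f₀ z)
    (hd : dataNorm (fun z => jap z.1 * f₀ z) ≤ ENNReal.ofReal η) :
    ∃ F : Phase → ℝ, NiceDatum η F ∧ ∀ᵐ z, f₀ z = F z / jap z.1 := by
  -- Doubling η gives the strict inequality needed to select weak derivatives; it explains the
  -- constants 2 and 12 = 6 · 2 in `NiceDatum`.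
  have hlt : dataNorm (fun z => jap z.1 * f₀ z) < ENNReal.ofReal (2 * η) :=
    hd.trans_lt ((ENNReal.ofReal_lt_ofReal_iff (by positivity)).2 (by linarith))
  set u : Phase → ℝ := fun z => jap z.1 * f₀ z with hu
  unfold dataNorm at hlt
  have h1 : sobolevNorm 1 u < ENNReal.ofReal (2 * η) :=
    lt_of_le_of_lt (le_add_right (le_add_right le_self_add)) hlt
  have h2 : sobolevNorm ⊤ u < ENNReal.ofReal (2 * η) :=
    lt_of_le_of_lt (le_add_right (le_add_right le_add_self)) hlt
  have h3 : weakDerivNorm (normXV 1 ⊤) [] u < ENNReal.ofReal (2 * η) :=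
    (mixedSobolevNorm_nil_le _ _).trans_lt (lt_of_le_of_lt (le_add_right le_add_self) hlt)
  have h4 : weakDerivNorm (normVX 1 ⊤) [] u < ENNReal.ofReal (2 * η) :=
    (mixedSobolevNorm_nil_le _ _).trans_lt (lt_of_le_of_lt le_add_self hlt)
  obtain ⟨F, huF, hFb, hFL⟩ := exists_lipschitz_of_sobolevNorm_top_lt h2
  have hFc : Continuous F := (LipschitzWith.of_dist_le_mul (K := ⟨6 * (2 * η), by positivity⟩)
    fun x y => by rw [dist_eq_norm, dist_eq_norm]; exact hFL x y).continuous
  have hF0 : ∀ z, 0 ≤ F z := by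
    have hd : Dense {z | 0 ≤ F z} := Measure.dense_of_ae (by
      filter_upwards [huF, hf₀] with z hz h0
      rw [← hz]
      exact mul_nonneg (jap_pos _).le h0)
    have hcl : IsClosed {z | 0 ≤ F z} := isClosed_le continuous_const hFc
    intro z
    have : z ∈ closure {z | 0 ≤ F z} := hd z
    rwa [hcl.closure_eq] at this
  have hen : ∀ z, ENNReal.ofReal (F z) = ‖F z‖ₑ := fun z => (Real.enorm_of_nonneg (hF0 z)).symm
  obtain ⟨g₁, hug₁, hg₁l, hg₁⟩ := exists_ae_eq_of_weakDerivNorm_nil_lt h3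
  obtain ⟨g₂, hug₂, hg₂l, hg₂⟩ := exists_ae_eq_of_weakDerivNorm_nil_lt h4
  refine ⟨F, ⟨hη, hF0, fun z => (le_abs_self _).trans (hFb z), fun p q => ?_, ?_, ?_, ?_⟩, ?_⟩
  · have := hFL p q
    linarith
  · simp only [hen]
    refine le_trans (le_of_eq (lintegral_congr_ae ?_))
      (integrable_of_sobolevNorm_one_lt_top ENNReal.ofReal_ne_top h1).2.le
    filter_upwards [huF] with z hz; rw [hz]
  · simp only [hen]
    refine le_trans ?_ hg₁.le
    unfold normXV
    rw [eLpNorm_one_eq_lintegral_enorm]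
    refine lintegral_mono_ae ?_
    have hae : ∀ᵐ z : E3 × E3 ∂(volume.prod volume), F z = g₁ z := huF.symm.trans hug₁
    filter_upwards [Measure.ae_ae_of_ae_prod hae] with x hx
    refine (iSup_enorm_le_eLpNorm_top (h := fun v => F (x, v)) (by fun_prop)).trans ?_
    rw [eLpNorm_congr_ae hx, enorm_eq_self]
  · simp only [hen]
    refine le_trans ?_ hg₂.le
    unfold normVX
    rw [eLpNorm_one_eq_lintegral_enorm]
    refine lintegral_mono_ae ?_
    have hae : ∀ᵐ z : E3 × E3 ∂(volume.prod volume), F z = g₂ z := huF.symm.trans hug₂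
    have hae' : ∀ᵐ z : E3 × E3 ∂(volume.prod volume), F z.swap = g₂ z.swap :=
      Measure.measurePreserving_swap.quasiMeasurePreserving.ae hae
    filter_upwards [Measure.ae_ae_of_ae_prod hae'] with v hv
    refine (iSup_enorm_le_eLpNorm_top (h := fun x => F (x, v)) (by fun_prop)).trans ?_
    rw [enorm_eq_self]
    exact (eLpNorm_congr_ae hv).le
  · filter_upwards [huF] with z hz
    rw [← hz, hu]
    have := jap_pos z.1
    field_simp

namespace NiceDatum

variable {η : ℝ} {F : Phase → ℝ}

theorem continuous (hF : NiceDatum η F) : Continuous F :=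
  (LipschitzWith.of_dist_le_mul (K := ⟨12 * η, by have := hF.pos; positivity⟩)
    fun x y => by rw [dist_eq_norm, dist_eq_norm]; exact hF.lipschitz x y).continuous

/-- The constant in the singular integral estimates. -/
noncomputable def singularConst (p : ℝ) : ℝ := 128 * ((ballMass p).toReal + 1)

theorem singularConst_pos (p : ℝ) : 0 < singularConst p := by unfold singularConst; positivity

theorem ofReal_singularConst {p : ℝ} (hp3 : p < 3) (hη : 0 ≤ η) :
    ENNReal.ofReal (singularConst p * η)
      = 64 * (ballMass p * ENNReal.ofReal (2 * η) + ENNReal.ofReal (2 * η)) := by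
  have h64 : (64 : ℝ≥0∞) = ENNReal.ofReal 64 := by simp
  rw [← ENNReal.ofReal_toReal (ballMass_lt_top hp3).ne, h64, ← ENNReal.ofReal_mul (by positivity),
    ← ENNReal.ofReal_add (by positivity) (by positivity), ← ENNReal.ofReal_mul (by norm_num),
    singularConst]
  congr 1; ring

/-- Singular integrals over phase space along maps expanding in velocity. -/
theorem lintegral_singular_le (hF : NiceDatum η F) {p : ℝ} (hp : 0 ≤ p) (hp3 : p < 3)
    {Y : Phase → E3} (hYc : Continuous Y)
    (hY : ∀ x v v', ‖v - v'‖ ≤ 2 * ‖Y (x, v) - Y (x, v')‖) (a : E3) :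
    ∫⁻ z, ENNReal.ofReal (‖a - Y z‖ ^ (-p)) * ENNReal.ofReal (F z)
      ≤ ENNReal.ofReal (singularConst p * η) := by
  have hFm := hF.continuous.measurable
  have hYm := hYc.measurable
  rw [ofReal_singularConst hp3 hF.pos.le]
  have hprod := lintegral_prod (μ := (volume : Measure E3)) (ν := (volume : Measure E3))
    (fun z => ENNReal.ofReal (‖a - Y z‖ ^ (-p)) * ENNReal.ofReal (F z)) (by fun_prop)
  have hmass := lintegral_prod (μ := (volume : Measure E3)) (ν := (volume : Measure E3))
    (fun z => ENNReal.ofReal (F z)) (by fun_prop)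
  refine le_trans (le_of_eq hprod) ?_
  calc ∫⁻ x, ∫⁻ v, ENNReal.ofReal (‖a - Y (x, v)‖ ^ (-p)) * ENNReal.ofReal (F (x, v))
      ≤ ∫⁻ x, 64 * (ballMass p * (⨆ v, ENNReal.ofReal (F (x, v)))
          + ∫⁻ v, ENNReal.ofReal (F (x, v))) :=
        lintegral_mono fun x => lintegral_rpow_norm_comp_mul_le hp hp3.le
          (hYc.comp (by fun_prop)) (hY x) a
          (Eventually.of_forall fun v => le_iSup (fun v => ENNReal.ofReal (F (x, v))) v)
    _ = 64 * (ballMass p * (∫⁻ x, ⨆ v, ENNReal.ofReal (F (x, v)))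
          + ∫⁻ x, ∫⁻ v, ENNReal.ofReal (F (x, v))) := by
        rw [lintegral_const_mul' _ _ (by norm_num), lintegral_add_right _
          (Measurable.lintegral_prod_right' (f := fun z : E3 × E3 => ENNReal.ofReal (F z))
            (by fun_prop)), lintegral_const_mul' _ _ (ballMass_lt_top hp3).ne]
    _ ≤ _ := by
        gcongr
        · exact hF.sup_snd
        · exact hmass.symm.le.trans hF.mass

/-- Singular integrals over phase space in the position variable. -/
theorem lintegral_singular_fst_le (hF : NiceDatum η F) {p : ℝ} (hp : 0 ≤ p) (hp3 : p < 3)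
    (a : E3) :
    ∫⁻ z, ENNReal.ofReal (‖a - z.1‖ ^ (-p)) * ENNReal.ofReal (F z)
      ≤ ENNReal.ofReal (singularConst p * η) := by
  have hFm := hF.continuous.measurable
  rw [ofReal_singularConst hp3 hF.pos.le]
  have hprod := lintegral_prod_symm (μ := (volume : Measure E3)) (ν := (volume : Measure E3))
    (fun z => ENNReal.ofReal (‖a - z.1‖ ^ (-p)) * ENNReal.ofReal (F z)) (by fun_prop)
  have hmass := lintegral_prod_symm (μ := (volume : Measure E3)) (ν := (volume : Measure E3))
    (fun z => ENNReal.ofReal (F z)) (by fun_prop)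
  refine le_trans (le_of_eq hprod) ?_
  calc ∫⁻ v, ∫⁻ x, ENNReal.ofReal (‖a - x‖ ^ (-p)) * ENNReal.ofReal (F (x, v))
      ≤ ∫⁻ v, 64 * (ballMass p * (⨆ x, ENNReal.ofReal (F (x, v)))
          + ∫⁻ x, ENNReal.ofReal (F (x, v))) :=
        lintegral_mono fun v => lintegral_rpow_norm_comp_mul_le hp hp3.le
          continuous_id (fun x x' => by simp only [id]; linarith [norm_nonneg (x - x')]) a
          (Eventually.of_forall fun x => le_iSup (fun x => ENNReal.ofReal (F (x, v))) x)
    _ = 64 * (ballMass p * (∫⁻ v, ⨆ x, ENNReal.ofReal (F (x, v)))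
          + ∫⁻ v, ∫⁻ x, ENNReal.ofReal (F (x, v))) := by
        rw [lintegral_const_mul' _ _ (by norm_num), lintegral_add_right _
          (Measurable.lintegral_prod_left' (f := fun z : E3 × E3 => ENNReal.ofReal (F z))
            (by fun_prop)), lintegral_const_mul' _ _ (ballMass_lt_top hp3).ne]
    _ ≤ _ := by
        gcongr
        · exact hF.sup_fst
        · exact hmass.symm.le.trans hF.mass

end NiceDatum

/-! ### Averages of the interaction kernel -/

theorem norm_gradient_potential {α lam : ℝ} (hα : 0 < α) (hlam : |lam| = 1) (x : E3) :
    ‖gradient (potential α lam) x‖ = α * ‖x‖ ^ (-(α + 1)) := by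
  have h0 : lam ≠ 0 := by rintro rfl; simp at hlam
  have h := norm_riesz (p := α + 2) (by linarith) x
  unfold riesz at h
  rw [gradient_potential hα h0, norm_smul, h, norm_neg, Real.norm_eq_abs, abs_mul, hlam,
    abs_of_pos hα, mul_one]
  ring_nf

theorem measurable_gradient_potential {α lam : ℝ} (hα : 0 < α) (hlam : |lam| = 1) :
    Measurable (gradient (potential α lam)) := by
  have h0 : lam ≠ 0 := by rintro rfl; simp at hlam
  have : gradient (potential α lam) = fun x => -(α * lam) • riesz (α + 2) x := by
    funext x; exact gradient_potential hα h0 x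
  rw [this]
  exact (measurable_riesz (p := α + 2)).const_smul (-(α * lam))

theorem norm_gradient_potential_sub_le {α lam : ℝ} (hα : 0 < α) (hα1 : α < 1)
    (hlam : |lam| = 1) (a b : E3) :
    ‖gradient (potential α lam) a - gradient (potential α lam) b‖
      ≤ 4 * α * ‖a - b‖ * (‖a‖ ^ (-(α + 2)) + ‖b‖ ^ (-(α + 2))) := by
  have h0 : lam ≠ 0 := by rintro rfl; simp at hlam
  have h := norm_riesz_sub_le (p := α + 2) (by linarith) (by linarith) a b
  unfold riesz at h
  rw [gradient_potential hα h0, gradient_potential hα h0, ← smul_sub, norm_smul, norm_neg,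
    Real.norm_eq_abs, abs_mul, hlam, abs_of_pos hα, mul_one]
  calc _ ≤ α * (4 * ‖a - b‖ * (‖a‖ ^ (-(α + 2)) + ‖b‖ ^ (-(α + 2)))) := by gcongr
    _ = _ := by ring

/-- Homogeneity of degree -(α + 1) is what turns the field at time t into t^{-(α+1)} times an
average in velocity-like variables. -/
theorem gradient_potential_smul {α lam s : ℝ} (hα : 0 < α) (hlam : |lam| = 1) (hs : 0 < s)
    (x : E3) :
    gradient (potential α lam) (s • x) = s ^ (-(α + 1)) • gradient (potential α lam) x := by
  have h0 : lam ≠ 0 := by rintro rfl; simp at hlam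
  have h := riesz_smul (p := α + 2) hs x
  unfold riesz at h
  rw [gradient_potential hα h0, gradient_potential hα h0, h, smul_comm]
  ring_nf

/-- Integrals of the interaction kernel along `Y` against the datum with weight `F`. -/
noncomputable def kernelAverage (α lam : ℝ) (F : Phase → ℝ) (Y : Phase → E3) (a : E3) : E3 :=
  ∫ z, (F z / jap z.1) • gradient (potential α lam) (a - Y z)

/-- The distribution of `Y` under `F` has uniformly bounded Riesz potentials. -/
structure HasRieszBounds (η : ℝ) (F : Phase → ℝ) (Y : Phase → E3) : Prop where
  continuous : Continuous Y
  bound : ∀ p : ℝ, 0 ≤ p → p < 3 → ∀ a,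
    ∫⁻ z, ENNReal.ofReal (‖a - Y z‖ ^ (-p)) * ENNReal.ofReal (F z)
      ≤ ENNReal.ofReal (NiceDatum.singularConst p * η)

namespace NiceDatum

variable {α lam η : ℝ} {F : Phase → ℝ} {Y Y' : Phase → E3}

theorem hasRieszBounds_of_expanding (hF : NiceDatum η F) (hYc : Continuous Y)
    (hY : ∀ x v v', ‖v - v'‖ ≤ 2 * ‖Y (x, v) - Y (x, v')‖) : HasRieszBounds η F Y :=
  ⟨hYc, fun _ hp hp3 a => hF.lintegral_singular_le hp hp3 hYc hY a⟩

/-- This serves time 0, where position does not yet spread with velocity; the roles of x and v are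
exchanged and the other mixed norm is used. -/
theorem hasRieszBounds_fst (hF : NiceDatum η F) : HasRieszBounds η F Prod.fst :=
  ⟨continuous_fst, fun _ hp hp3 a => hF.lintegral_singular_fst_le hp hp3 a⟩

theorem div_jap_nonneg (hF : NiceDatum η F) (z : Phase) : 0 ≤ F z / jap z.1 :=
  div_nonneg (hF.nonneg z) (jap_pos _).le

theorem div_jap_le (hF : NiceDatum η F) (z : Phase) : F z / jap z.1 ≤ F z :=
  div_le_self (hF.nonneg z) (one_le_jap _)

theorem continuous_div_jap (hF : NiceDatum η F) : Continuous fun z : Phase => F z / jap z.1 :=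
  hF.continuous.div (continuous_jap.comp continuous_fst) fun _ => (jap_pos _).ne'

theorem integrable_rpow_mul (hF : NiceDatum η F) (hY : HasRieszBounds η F Y) {p : ℝ} (hp : 0 ≤ p)
    (hp3 : p < 3) (a : E3) : Integrable fun z => ‖a - Y z‖ ^ (-p) * F z := by
  have hFm := hF.continuous.measurable
  have hYm := hY.continuous.measurable
  refine ⟨by fun_prop, ?_⟩
  refine lt_of_le_of_lt ?_ ((hY.bound p hp hp3 a).trans_lt ENNReal.ofReal_lt_top)
  refine lintegral_mono fun z => ?_
  rw [Real.enorm_of_nonneg (mul_nonneg (by positivity) (hF.nonneg z)),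
    ENNReal.ofReal_mul (by positivity)]

theorem integral_rpow_mul_le (hF : NiceDatum η F) (hY : HasRieszBounds η F Y) {p : ℝ}
    (hp : 0 ≤ p) (hp3 : p < 3) (a : E3) :
    ∫ z, ‖a - Y z‖ ^ (-p) * F z ≤ singularConst p * η := by
  have hFm := hF.continuous.measurable
  have hYm := hY.continuous.measurable
  rw [integral_eq_lintegral_of_nonneg_ae
    (Eventually.of_forall fun z => mul_nonneg (by positivity) (hF.nonneg z)) (by fun_prop)]
  refine ENNReal.toReal_le_of_le_ofReal
    (mul_nonneg (singularConst_pos p).le hF.pos.le) ?_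
  refine le_trans (lintegral_mono fun z => ?_) (hY.bound p hp hp3 a)
  rw [ENNReal.ofReal_mul (by positivity)]

theorem integrable_kernel (hF : NiceDatum η F) (hY : HasRieszBounds η F Y) (hα : 0 < α)
    (hα1 : α < 1) (hlam : |lam| = 1) (a : E3) :
    Integrable fun z => (F z / jap z.1) • gradient (potential α lam) (a - Y z) := by
  have hm := measurable_gradient_potential hα hlam
  have hYm := hY.continuous.measurable
  refine Integrable.mono' ((hF.integrable_rpow_mul hY (p := α + 1) (by linarith) (by linarith)
    a).const_mul α) ?_ (Eventually.of_forall fun z => ?_)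
  · exact (hF.continuous_div_jap.measurable.smul (hm.comp (by fun_prop))).aestronglyMeasurable
  · rw [norm_smul, norm_gradient_potential hα hlam, Real.norm_of_nonneg (hF.div_jap_nonneg z)]
    have h1 : 0 ≤ ‖a - Y z‖ ^ (-(α + 1)) := by positivity
    calc F z / jap z.1 * (α * ‖a - Y z‖ ^ (-(α + 1)))
        ≤ F z * (α * ‖a - Y z‖ ^ (-(α + 1))) := by
          gcongr; exact hF.div_jap_le z
      _ = _ := by ring

/-- Stability of the averages in the map and in the point. -/
theorem norm_kernelAverage_sub_le (hF : NiceDatum η F) (hY : HasRieszBounds η F Y)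
    (hY' : HasRieszBounds η F Y') (hα : 0 < α) (hα1 : α < 1) (hlam : |lam| = 1) {a b : E3}
    {D : ℝ} (hD : ∀ z, ‖(a - Y z) - (b - Y' z)‖ ≤ D * jap z.1) :
    ‖kernelAverage α lam F Y a - kernelAverage α lam F Y' b‖
      ≤ 8 * α * singularConst (α + 2) * η * D := by
  have hD0 : 0 ≤ D := by
    have := (norm_nonneg _).trans (hD 0)
    exact nonneg_of_mul_nonneg_left this (jap_pos _)
  have hi := (hF.integrable_rpow_mul hY (p := α + 2) (by linarith) (by linarith) a)
  have hi' := (hF.integrable_rpow_mul hY' (p := α + 2) (by linarith) (by linarith) b)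
  unfold kernelAverage
  rw [← integral_sub (hF.integrable_kernel hY hα hα1 hlam a)
    (hF.integrable_kernel hY' hα hα1 hlam b)]
  refine (norm_integral_le_of_norm_le ((hi.add hi').const_mul (4 * α * D))
    (Eventually.of_forall fun z => ?_)).trans ?_
  · rw [← smul_sub, norm_smul, Real.norm_of_nonneg (hF.div_jap_nonneg z)]
    have hj := jap_pos z.1
    have h1 := norm_gradient_potential_sub_le hα hα1 hlam (a - Y z) (b - Y' z)
    have h2 : 0 ≤ ‖a - Y z‖ ^ (-(α + 2)) + ‖b - Y' z‖ ^ (-(α + 2)) := by positivity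
    calc _ ≤ F z / jap z.1 * (4 * α * ‖a - Y z - (b - Y' z)‖
          * (‖a - Y z‖ ^ (-(α + 2)) + ‖b - Y' z‖ ^ (-(α + 2)))) := by
          gcongr; exact hF.div_jap_nonneg z
      _ ≤ F z / jap z.1 * (4 * α * (D * jap z.1)
          * (‖a - Y z‖ ^ (-(α + 2)) + ‖b - Y' z‖ ^ (-(α + 2)))) := by
          gcongr
          · exact hF.div_jap_nonneg z
          · exact hD z
      -- The bracket in the hypothesis on D cancels the one dividing F: the weighted datum pays for
      -- displacements growing with the initial position.
      _ = 4 * α * D * (‖a - Y z‖ ^ (-(α + 2)) * F z + ‖b - Y' z‖ ^ (-(α + 2)) * F z) := by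
          field_simp
  · rw [integral_const_mul]
    simp only [Pi.add_apply]
    rw [integral_add hi hi']
    have h1 := hF.integral_rpow_mul_le hY (p := α + 2) (by linarith) (by linarith) a
    have h2 := hF.integral_rpow_mul_le hY' (p := α + 2) (by linarith) (by linarith) b
    calc _ ≤ 4 * α * D * (singularConst (α + 2) * η + singularConst (α + 2) * η) := by gcongr
      _ = _ := by ring

theorem norm_kernelAverage_sub_le_norm_sub (hF : NiceDatum η F) (hY : HasRieszBounds η F Y)
    (hα : 0 < α) (hα1 : α < 1) (hlam : |lam| = 1) (a b : E3) :
    ‖kernelAverage α lam F Y a - kernelAverage α lam F Y b‖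
      ≤ 8 * α * singularConst (α + 2) * η * ‖a - b‖ := by
  refine hF.norm_kernelAverage_sub_le hY hY hα hα1 hlam fun z => ?_
  rw [sub_sub_sub_cancel_right]
  exact le_mul_of_one_le_right (norm_nonneg _) (one_le_jap _)

end NiceDatum

/-! ### Continuity in time of the force field -/

theorem le_ofReal_div_of_ofReal_mul_le {a K : ℝ} {N : ℝ≥0∞} (ha : 0 < a)
    (h : ENNReal.ofReal a * N ≤ ENNReal.ofReal K) : N ≤ ENNReal.ofReal (K / a) := by
  rw [ENNReal.ofReal_div_of_pos ha, ENNReal.le_div_iff_mul_le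
    (Or.inl (by simpa using ha)) (Or.inl ENNReal.ofReal_ne_top), mul_comm]
  exact h

theorem one_add_abs_le_two_mul_jap (t : ℝ) : 1 + |t| ≤ 2 * jap t := by
  have h1 : 1 ≤ jap t := one_le_jap t
  have h2 : |t| ≤ jap t := by
    unfold jap
    rw [Real.norm_eq_abs]
    exact Real.le_sqrt_of_sq_le (by linarith)
  linarith

theorem inv_jap_rpow_le {β : ℝ} (hβ : 0 ≤ β) (hβ3 : β ≤ 3) (t : ℝ) :
    (jap t ^ β)⁻¹ ≤ 8 * (1 + |t|) ^ (-β) := by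
  have h1 : (0 : ℝ) < 1 + |t| := by positivity
  have hj := jap_pos t
  have h2 : (1 + |t|) ^ β ≤ 8 * jap t ^ β := by
    calc (1 + |t|) ^ β ≤ (2 * jap t) ^ β := by
          gcongr; exact one_add_abs_le_two_mul_jap t
      _ = 2 ^ β * jap t ^ β := Real.mul_rpow (by norm_num) hj.le
      _ ≤ 2 ^ (3 : ℝ) * jap t ^ β := by
          gcongr; norm_num
      _ = _ := by norm_num
  rw [Real.rpow_neg h1.le, ← div_eq_mul_inv, inv_le_comm₀ (by positivity) (by positivity), inv_div]
  rw [div_le_iff₀ (by norm_num)]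
  linarith

/-- The force field has a Lipschitz representative with the decay given by the dispersion bound. -/
theorem DispersionBound.exists_lipschitz_field {α lam K : ℝ} {f : ℝ → Phase → ℝ}
    (hα : 0 < α) (hα1 : α < 1) (hK : 0 < K) (h : DispersionBound α lam f K) {t : ℝ}
    (ht : 0 ≤ t) : ∃ v : E3 → E3, field α lam (f t) =ᵐ[volume] v ∧
      (∀ x, ‖v x‖ ≤ 48 * K * (1 + |t|) ^ (-(1 + α))) ∧
      ∀ x y, ‖v x - v y‖ ≤ 48 * K * (1 + |t|) ^ (-(2 + α)) * ‖x - y‖ := by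
  have hj := jap_pos t
  have h := h t ht
  have h1 := le_ofReal_div_of_ofReal_mul_le (Real.rpow_pos_of_pos hj (1 + α))
    ((le_add_right le_self_add).trans h)
  have h2 := le_ofReal_div_of_ofReal_mul_le (Real.rpow_pos_of_pos hj (2 + α))
    ((le_add_right le_add_self).trans h)
  -- The final 48 is 3 · 2 · 8: three directions, a factor 2 for strictness, and 8 for trading the
  -- bracket for 1 + |t|.
  have hlt : ∀ β : ℝ, ENNReal.ofReal (K / jap t ^ β) < ENNReal.ofReal (2 * (K / jap t ^ β)) := by
    intro β
    have : 0 < K / jap t ^ β := by positivity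
    exact (ENNReal.ofReal_lt_ofReal_iff (by positivity)).2 (by linarith)
  obtain ⟨v, hv, hb, hL⟩ := exists_lipschitz_vectorField
    (ae_norm_le_of_eLpNorm_top_lt (h1.trans_lt (hlt _))) (h2.trans_lt (hlt _))
  refine ⟨v, hv, fun x => (hb x).trans ?_, fun x y => (hL x y).trans ?_⟩
  · have := inv_jap_rpow_le (β := 1 + α) (by linarith) (by linarith) t
    have h0 : 0 ≤ (1 + |t|) ^ (-(1 + α)) := by positivity
    calc 2 * (K / jap t ^ (1 + α)) = 2 * K * (jap t ^ (1 + α))⁻¹ := by ring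
      _ ≤ 2 * K * (8 * (1 + |t|) ^ (-(1 + α))) := by gcongr
      _ ≤ _ := by nlinarith
  · have := inv_jap_rpow_le (β := 2 + α) (by linarith) (by linarith) t
    calc 3 * (2 * (K / jap t ^ (2 + α))) * ‖x - y‖
        = 6 * K * (jap t ^ (2 + α))⁻¹ * ‖x - y‖ := by ring
      _ ≤ 6 * K * (8 * (1 + |t|) ^ (-(2 + α))) * ‖x - y‖ := by gcongr
      _ = _ := by ring

theorem integrable_density {h : Phase → ℝ} (hh : Integrable h) : Integrable (density h) := by
  have hh' : Integrable h ((volume : Measure E3).prod (volume : Measure E3)) := hh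
  exact hh'.integral_prod_left

theorem lintegral_density_sub_le {h₁ h₂ : Phase → ℝ} (hh₁ : Integrable h₁) (hh₂ : Integrable h₂) :
    ∫⁻ y, ‖density h₁ y - density h₂ y‖ₑ ≤ ∫⁻ z, ‖h₁ z - h₂ z‖ₑ := by
  have hh₁' : Integrable h₁ ((volume : Measure E3).prod (volume : Measure E3)) := hh₁
  have hh₂' : Integrable h₂ ((volume : Measure E3).prod (volume : Measure E3)) := hh₂
  have hm : AEMeasurable (fun z => ‖h₁ z - h₂ z‖ₑ)
      ((volume : Measure E3).prod (volume : Measure E3)) :=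
    (hh₁'.sub hh₂').aestronglyMeasurable.enorm
  have h1 := lintegral_prod _ hm
  have h2 : ∫⁻ z, ‖h₁ z - h₂ z‖ₑ = ∫⁻ x, ∫⁻ y, ‖h₁ (x, y) - h₂ (x, y)‖ₑ := h1
  rw [h2]
  refine lintegral_mono_ae ?_
  filter_upwards [hh₁'.prod_right_ae, hh₂'.prod_right_ae] with x hx₁ hx₂
  unfold density
  rw [← integral_sub hx₁ hx₂]
  exact enorm_integral_le_lintegral_enorm _

/-- The constant in the local `L¹` bound for the force field. -/
noncomputable def localForceConst (α : ℝ) : ℝ≥0∞ :=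
  ENNReal.ofReal α * (ballMass (α + 1) + volume (Metric.ball (0 : E3) 1))

theorem localForceConst_lt_top {α : ℝ} (hα1 : α < 1) : localForceConst α < ⊤ :=
  ENNReal.mul_lt_top ENNReal.ofReal_lt_top
    (ENNReal.add_lt_top.2 ⟨ballMass_lt_top (by linarith), measure_ball_lt_top⟩)

/-- The singular integral bound is applied with the indicator of the ball as density, which makes it
uniform in the location y of the singularity. -/
theorem setLIntegral_kernel_le {α lam : ℝ} (hα : 0 < α) (hlam : |lam| = 1) (x₀ y : E3) :
    ∫⁻ x in Metric.ball x₀ 1, ‖gradient (potential α lam) (x - y)‖ₑ ≤ localForceConst α := by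
  have h := lintegral_rpow_norm_sub_mul_le (p := α + 1) (by linarith) y
    (h := (Metric.ball x₀ 1).indicator 1) (H := 1)
    (Eventually.of_forall fun v => Set.indicator_le_self' (by simp) v)
  rw [mul_one, lintegral_indicator_one Metric.isOpen_ball.measurableSet,
    Measure.addHaar_ball_center] at h
  unfold localForceConst
  refine le_trans ?_ (mul_le_mul_right h (ENNReal.ofReal α))
  rw [← lintegral_const_mul' _ _ ENNReal.ofReal_ne_top,
    ← lintegral_indicator Metric.isOpen_ball.measurableSet]
  refine lintegral_mono fun x => ?_
  by_cases hx : x ∈ Metric.ball x₀ 1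
  · rw [Set.indicator_of_mem hx, Set.indicator_of_mem hx, Pi.one_apply, mul_one,
      ← ofReal_norm, norm_gradient_potential hα hlam, ENNReal.ofReal_mul hα.le]
  · rw [Set.indicator_of_notMem hx]
    exact bot_le

theorem setLIntegral_kernel_mul_le {α lam : ℝ} (hα : 0 < α) (hlam : |lam| = 1)
    {ρ : E3 → ℝ≥0∞} (hρ : AEMeasurable ρ) (x₀ : E3) :
    ∫⁻ x in Metric.ball x₀ 1, ∫⁻ y, ρ y * ‖gradient (potential α lam) (x - y)‖ₑ
      ≤ localForceConst α * ∫⁻ y, ρ y := by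
  have hm := measurable_gradient_potential hα hlam
  rw [lintegral_lintegral_swap]
  · calc ∫⁻ y, ∫⁻ x in Metric.ball x₀ 1, ρ y * ‖gradient (potential α lam) (x - y)‖ₑ
        = ∫⁻ y, ρ y * ∫⁻ x in Metric.ball x₀ 1, ‖gradient (potential α lam) (x - y)‖ₑ := by
          refine lintegral_congr fun y => ?_
          rw [lintegral_const_mul]
          exact (hm.comp (measurable_id.sub_const y)).enorm
      _ ≤ ∫⁻ y, ρ y * localForceConst α := by
          refine lintegral_mono fun y => ?_
          gcongr
          exact setLIntegral_kernel_le hα hlam x₀ y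
      _ = _ := by rw [lintegral_mul_const'' _ hρ, mul_comm]
  · refine AEMeasurable.mul ?_ ?_
    · exact hρ.comp_snd
    · exact ((hm.comp (measurable_fst.sub measurable_snd)).enorm).aemeasurable

/-- For a density that is merely integrable the field integral may diverge at some points, where it
takes a default value; Tonelli's theorem confines them to a null set. -/
theorem ae_integrable_density_smul {α lam : ℝ} (hα : 0 < α) (hα1 : α < 1) (hlam : |lam| = 1)
    {h : Phase → ℝ} (hh : Integrable h) (x₀ : E3) :
    ∀ᵐ x ∂volume.restrict (Metric.ball x₀ 1),
      Integrable fun y => density h y • gradient (potential α lam) (x - y) := by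
  have hm := measurable_gradient_potential hα hlam
  have hd := integrable_density hh
  have hle := setLIntegral_kernel_mul_le hα hlam (ρ := fun y => ‖density h y‖ₑ)
    hd.aestronglyMeasurable.enorm x₀
  have hfin : ∫⁻ x in Metric.ball x₀ 1, ∫⁻ y, ‖density h y‖ₑ
      * ‖gradient (potential α lam) (x - y)‖ₑ ≠ ⊤ :=
    (hle.trans_lt (ENNReal.mul_lt_top (localForceConst_lt_top hα1) hd.2)).ne
  have hmeas : AEMeasurable (fun x => ∫⁻ y, ‖density h y‖ₑ
      * ‖gradient (potential α lam) (x - y)‖ₑ) (volume.restrict (Metric.ball x₀ 1)) := by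
    refine AEMeasurable.lintegral_prod_right'
      (f := fun p : E3 × E3 => ‖density h p.2‖ₑ * ‖gradient (potential α lam) (p.1 - p.2)‖ₑ) ?_
    exact (hd.aestronglyMeasurable.enorm.comp_snd).mul
      ((hm.comp (measurable_fst.sub measurable_snd)).enorm).aemeasurable
  filter_upwards [ae_lt_top' hmeas hfin] with x hx
  refine ⟨hd.aestronglyMeasurable.smul
    (hm.comp (measurable_id.const_sub x)).aestronglyMeasurable, ?_⟩
  simpa only [HasFiniteIntegral, enorm_smul] using hx

/-- Local `L¹` stability of the force field. -/
theorem setLIntegral_field_sub_le {α lam : ℝ} (hα : 0 < α) (hα1 : α < 1) (hlam : |lam| = 1)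
    {h₁ h₂ : Phase → ℝ} (hh₁ : Integrable h₁) (hh₂ : Integrable h₂) (x₀ : E3) :
    ∫⁻ x in Metric.ball x₀ 1, ‖field α lam h₁ x - field α lam h₂ x‖ₑ
      ≤ localForceConst α * ∫⁻ z, ‖h₁ z - h₂ z‖ₑ := by
  have hd : AEMeasurable fun y => ‖density h₁ y - density h₂ y‖ₑ :=
    ((integrable_density hh₁).sub (integrable_density hh₂)).aestronglyMeasurable.enorm
  refine le_trans ?_ ((setLIntegral_kernel_mul_le hα hlam hd x₀).trans
    (mul_le_mul_right (lintegral_density_sub_le hh₁ hh₂) _))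
  refine lintegral_mono_ae ?_
  filter_upwards [ae_integrable_density_smul hα hα1 hlam hh₁ x₀,
    ae_integrable_density_smul hα hα1 hlam hh₂ x₀] with x hx₁ hx₂
  unfold field
  rw [neg_sub_neg, ← integral_sub hx₂ hx₁]
  refine (enorm_integral_le_lintegral_enorm _).trans (le_of_eq (lintegral_congr fun y => ?_))
  rw [← sub_smul, enorm_smul, enorm_sub_rev]

/-- Lipschitz fields which converge in `L¹` of a ball converge pointwise. -/
theorem tendsto_of_tendsto_setLIntegral {ι : Type*} {l : Filter ι} {v : ι → E3 → E3} {u : E3 → E3}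
    {L : ℝ} (hL : 0 < L) (hv : ∀ᶠ i in l, ∀ x y, ‖v i x - v i y‖ ≤ L * ‖x - y‖)
    (hu : ∀ x y, ‖u x - u y‖ ≤ L * ‖x - y‖) (x₀ : E3)
    (h : Tendsto (fun i => ∫⁻ x in Metric.ball x₀ 1, ‖v i x - u x‖ₑ) l (𝓝 0)) :
    Tendsto (fun i => v i x₀) l (𝓝 (u x₀)) := by
  rw [Metric.tendsto_nhds]
  intro ε hε
  -- On this radius each Lipschitz function varies by at most ε/4, so a gap ε at the centre forces a
  -- gap ε/2 on the whole small ball.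
  set r := min 1 (ε / (4 * L)) with hr
  have hr0 : 0 < r := by positivity
  have hμ : 0 < volume (Metric.ball x₀ r) := Metric.measure_ball_pos _ _ hr0
  have hpos : 0 < ENNReal.ofReal (ε / 2) * volume (Metric.ball x₀ r) :=
    ENNReal.mul_pos (by simpa using hε) hμ.ne'
  filter_upwards [hv, h.eventually (gt_mem_nhds hpos)] with i hi hlt
  by_contra! hcon
  rw [dist_eq_norm] at hcon
  refine absurd hlt (not_lt.2 ?_)
  calc ENNReal.ofReal (ε / 2) * volume (Metric.ball x₀ r)
      = ∫⁻ x in Metric.ball x₀ r, ENNReal.ofReal (ε / 2) := by rw [setLIntegral_const]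
    _ ≤ ∫⁻ x in Metric.ball x₀ r, ‖v i x - u x‖ₑ := by
        refine setLIntegral_mono' Metric.isOpen_ball.measurableSet fun x hx => ?_
        rw [← ofReal_norm]
        refine ENNReal.ofReal_le_ofReal ?_
        have h1 := hi x₀ x
        have h2 := hu x₀ x
        have h3 : ‖x₀ - x‖ ≤ ε / (4 * L) := by
          rw [← dist_eq_norm, dist_comm]
          exact (Metric.mem_ball.1 hx).le.trans (min_le_right _ _)
        have h4 : L * ‖x₀ - x‖ ≤ ε / 4 := by
          calc _ ≤ L * (ε / (4 * L)) := by gcongr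
            _ = ε / 4 := by field_simp
        have h5 : v i x₀ - u x₀ = (v i x₀ - v i x) + (v i x - u x) - (u x₀ - u x) := by abel
        have h6 := norm_sub_le ((v i x₀ - v i x) + (v i x - u x)) (u x₀ - u x)
        have h7 := norm_add_le (v i x₀ - v i x) (v i x - u x)
        rw [← h5] at h6
        linarith
    _ ≤ _ := lintegral_mono_set (Metric.ball_subset_ball (min_le_left _ _))

/-! ### Representatives of the solution -/

namespace IsGlobalSolution

variable {α lam : ℝ} {f₀ : Phase → ℝ} {f : ℝ → Phase → ℝ}

theorem integrable (hf : IsGlobalSolution α lam f₀ f) {t : ℝ} (ht : 0 ≤ t) :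
    Integrable (f t) := by
  obtain ⟨M, hM⟩ := hf.bounded t
  have h := hM t ⟨ht, le_rfl⟩
  exact (integrable_of_sobolevNorm_one_lt_top (c := ENNReal.ofReal (max M 0 + 1))
    ENNReal.ofReal_ne_top (((le_add_right le_rfl).trans h).trans_lt
      ((ENNReal.ofReal_lt_ofReal_iff (by positivity)).2 (by linarith [le_max_left M 0])))).1

theorem exists_lipschitz (hf : IsGlobalSolution α lam f₀ f) (T : ℝ) :
    ∃ c : ℝ, 0 < c ∧ ∀ t ∈ Set.Icc 0 T, ∃ v : Phase → ℝ, f t =ᵐ[volume] v ∧ (∀ z, |v z| ≤ c) ∧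
      ∀ x y, |v x - v y| ≤ 6 * c * ‖x - y‖ := by
  obtain ⟨M, hM⟩ := hf.bounded T
  refine ⟨max M 0 + 1, by positivity, fun t ht => ?_⟩
  refine exists_lipschitz_of_sobolevNorm_top_lt
    (((le_add_left le_rfl).trans (hM t ht)).trans_lt ?_)
  exact (ENNReal.ofReal_lt_ofReal_iff (by positivity)).2 (by linarith [le_max_left M 0])

theorem tendsto_eLpNorm_abs (hf : IsGlobalSolution α lam f₀ f) (t : ℝ) :
    Tendsto (fun s => eLpNorm (f |s| - f |t|) 1 volume + eLpNorm (f |s| - f |t|) ⊤ volume)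
      (𝓝 t) (𝓝 0) := by
  refine (hf.continuous |t| (abs_nonneg t)).comp (tendsto_nhdsWithin_iff.2
    ⟨continuous_abs.tendsto t, Eventually.of_forall fun s => abs_nonneg s⟩)

theorem tendsto_setLIntegral_field (hf : IsGlobalSolution α lam f₀ f) (hα : 0 < α) (hα1 : α < 1)
    (hlam : |lam| = 1) (t : ℝ) (x₀ : E3) :
    Tendsto (fun s => ∫⁻ x in Metric.ball x₀ 1,
      ‖field α lam (f |s|) x - field α lam (f |t|) x‖ₑ) (𝓝 t) (𝓝 0) := by
  have h1 : Tendsto (fun s => localForceConst α * (eLpNorm (f |s| - f |t|) 1 volume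
      + eLpNorm (f |s| - f |t|) ⊤ volume)) (𝓝 t) (𝓝 0) := by
    have := ENNReal.Tendsto.const_mul (a := localForceConst α) (hf.tendsto_eLpNorm_abs t)
      (Or.inr (localForceConst_lt_top hα1).ne)
    rwa [mul_zero] at this
  refine tendsto_of_tendsto_of_tendsto_of_le_of_le tendsto_const_nhds h1 (fun _ => bot_le)
    fun s => ?_
  refine (setLIntegral_field_sub_le hα hα1 hlam (hf.integrable (abs_nonneg s))
    (hf.integrable (abs_nonneg t)) x₀).trans ?_
  gcongr
  refine le_trans (le_of_eq ?_) le_self_add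
  rw [eLpNorm_one_eq_lintegral_enorm]
  rfl

/-- The force field of a dispersive solution has a continuous representative. -/
theorem exists_decayingForce (hf : IsGlobalSolution α lam f₀ f) (hα : 1 / 2 < α) (hα1 : α < 1)
    (hlam : |lam| = 1) {K : ℝ} (hK : 0 < K) (hd : DispersionBound α lam f K) :
    ∃ E : ℝ → E3 → E3, DecayingForce α (48 * K) E ∧
      ∀ t, 0 ≤ t → field α lam (f t) =ᵐ[volume] E t := by
  have h0 : 0 < α := by linarith
  -- Evaluating at |t| extends the force evenly to all real times, so trajectories are global in
  -- both time directions.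
  choose E hEf hEb hEL using fun t : ℝ => hd.exists_lipschitz_field h0 hα1 hK (abs_nonneg t)
  simp only [abs_abs] at hEb hEL
  have hL : ∀ t x y, ‖E t x - E t y‖ ≤ 48 * K * ‖x - y‖ := fun t x y => by
    refine (hEL t x y).trans ?_
    have := rpow_one_add_abs_le_one (β := 2 + α) (by linarith) t
    exact mul_le_mul_of_nonneg_right (mul_le_of_le_one_right (by positivity) this)
      (norm_nonneg _)
  have hcont : ∀ x, Continuous fun t => E t x := fun x => by
    rw [continuous_iff_continuousAt]
    intro t
    refine tendsto_of_tendsto_setLIntegral (L := 48 * K) (by positivity)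
      (Eventually.of_forall fun s => hL s) (hL t) x ?_
    refine (hf.tendsto_setLIntegral_field h0 hα1 hlam t x).congr fun s => ?_
    refine lintegral_congr_ae (ae_restrict_of_ae ?_)
    filter_upwards [hEf s, hEf t] with y h1 h2
    rw [h1, h2]
  refine ⟨E, ⟨hα, hα1, by positivity, ?_, hEb, hEL⟩, fun t ht => ?_⟩
  · refine continuous_prod_of_continuous_lipschitzWith' (fun p : ℝ × E3 => E p.1 p.2)
      ⟨48 * K, by positivity⟩ (fun t => ?_) hcont
    exact LipschitzWith.of_dist_le_mul fun x y => by
      rw [dist_eq_norm, dist_eq_norm]; exact hL t x y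
  · have := hEf t
    rwa [abs_of_nonneg ht] at this

/-- A dispersive solution is transported along the trajectories of its force field. -/
theorem ae_eq_comp_flow (hf : IsGlobalSolution α lam f₀ f) {K : ℝ} {E : ℝ → E3 → E3}
    (hE : DecayingForce α K E) (hEf : ∀ t, 0 ≤ t → field α lam (f t) =ᵐ[volume] E t)
    {G : Phase → ℝ} (hG : Continuous G) (hfG : f₀ =ᵐ[volume] G) {T : ℝ} (hT : 0 ≤ T) :
    f T =ᵐ[volume] fun z => G (hE.flow 0 T z) := by
  have hrep : ∀ t : ℝ, ∃ v : Phase → ℝ, f |t| =ᵐ[volume] v ∧ Continuous v := fun t => by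
    obtain ⟨c, hc, h⟩ := hf.exists_lipschitz |t|
    obtain ⟨v, hv, -, hvL⟩ := h |t| ⟨abs_nonneg t, le_rfl⟩
    exact ⟨v, hv, (LipschitzWith.of_dist_le_mul (K := ⟨6 * c, by positivity⟩)
      fun x y => by rw [dist_eq_norm, dist_eq_norm]; exact hvL x y).continuous⟩
  choose F hfF hFc using hrep
  have hfF' : ∀ t, 0 ≤ t → f t =ᵐ[volume] F t := fun t ht => by
    have := hfF t
    rwa [abs_of_nonneg ht] at this
  obtain ⟨c, hc, hcb⟩ := hf.exists_lipschitz T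
  -- Continuous representatives are unique, so the one chosen at each time inherits the Lipschitz
  -- bound uniform on [0, T].
  have hFbd : ∀ t ∈ Set.Icc 0 T, (∀ z, |F t z| ≤ c) ∧
      ∀ x y, |F t x - F t y| ≤ 6 * c * ‖x - y‖ := fun t ht => by
    obtain ⟨v, hv, hvb, hvL⟩ := hcb t ht
    have hvc : Continuous v := (LipschitzWith.of_dist_le_mul (K := ⟨6 * c, by positivity⟩)
      fun x y => by rw [dist_eq_norm, dist_eq_norm]; exact hvL x y).continuous
    have : F t = v := (Continuous.ae_eq_iff_eq volume (hFc t) hvc).1 ((hfF' t ht.1).symm.trans hv)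
    rw [this]
    exact ⟨hvb, hvL⟩
  have hF0 : F 0 = G := (Continuous.ae_eq_iff_eq volume (hFc 0) hG).1
    ((hfF' 0 le_rfl).symm.trans (hf.initial.trans hfG))
  have hcont : ∀ z, Continuous fun t => F t z := fun z => by
    rw [continuous_iff_continuousAt]
    intro t
    rw [ContinuousAt, tendsto_iff_edist_tendsto_0]
    refine tendsto_of_tendsto_of_tendsto_of_le_of_le tendsto_const_nhds
      (hf.tendsto_eLpNorm_abs t) (fun _ => bot_le) fun s => ?_
    -- Continuity in time with values in L^∞ becomes pointwise continuity for continuous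
    -- representatives.
    have h1 := (le_iSup (fun z => ‖F s z - F t z‖ₑ) z).trans
      (iSup_enorm_le_eLpNorm_top ((hFc s).sub (hFc t)))
    simp only [edist_eq_enorm_sub]
    refine (h1.trans (le_of_eq ?_)).trans le_add_self
    refine eLpNorm_congr_ae ?_
    filter_upwards [hfF s, hfF t] with y h1 h2
    simp only [Pi.sub_apply, h1, h2]
  have hsol : TransportSolution E F T c ⟨6 * c, by positivity⟩ := by
    refine ⟨fun t ht => LipschitzWith.of_dist_le_mul fun x y => ?_, fun t ht => (hFbd t ht).1,
      fun z => (hcont z).continuousOn, fun φ hφ hφc t ht => ?_⟩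
    · rw [dist_eq_norm, dist_eq_norm]
      exact (hFbd t ht).2 x y
    · have h := ((hf.equation φ hφ hφc).2 t ht.1).2
      have e1 : ∫ z, f t z * φ z = ∫ z, F t z * φ z := integral_congr_ae (by
        filter_upwards [hfF' t ht.1] with z hz; rw [hz])
      have e2 : ∫ z, f₀ z * φ z = ∫ z, F 0 z * φ z := integral_congr_ae (by
        rw [hF0]
        filter_upwards [hfG] with z hz; rw [hz])
      rw [← e1, ← e2, h]
      congr 1
      refine intervalIntegral.integral_congr fun s hs => ?_
      rw [Set.uIcc_of_le ht.1] at hs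
      refine integral_congr_ae ?_
      have hEs : ∀ᵐ z : E3 × E3 ∂(volume.prod volume), field α lam (f s) z.1 = E s z.1 :=
        Measure.quasiMeasurePreserving_fst.ae (hEf s hs.1)
      filter_upwards [hfF' s hs.1, hEs] with z h1 h2
      simp only [phaseField, h1, h2]
  filter_upwards [hfF' T hT] with z hz
  have := hsol.apply_flow hE hT (hE.flow 0 T z)
  rw [hE.flow_flow, hE.flow_self, hF0] at this
  rw [hz, this]

end IsGlobalSolution

/-! ### The force field along the flow -/

theorem density_ae_eq {h₁ h₂ : Phase → ℝ} (h : h₁ =ᵐ[volume] h₂) :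
    density h₁ =ᵐ[volume] density h₂ := by
  have h' : ∀ᵐ z ∂((volume : Measure E3).prod (volume : Measure E3)), h₁ z = h₂ z := h
  filter_upwards [Measure.ae_ae_of_ae_prod h'] with x hx
  exact integral_congr_ae hx

theorem field_eq_integral_phase {α lam : ℝ} {h : Phase → ℝ} {x : E3}
    (hi : Integrable fun z => h z • gradient (potential α lam) (x - z.1)) :
    field α lam h x = -∫ z, h z • gradient (potential α lam) (x - z.1) := by
  have hi' : Integrable (fun z => h z • gradient (potential α lam) (x - z.1))
    ((volume : Measure E3).prod (volume : Measure E3)) := hi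
  have hp : ∫ z, h z • gradient (potential α lam) (x - z.1)
      = ∫ y, ∫ v, h (y, v) • gradient (potential α lam) (x - y) := integral_prod _ hi'
  rw [field, hp]
  congr 1
  refine integral_congr_ae (Eventually.of_forall fun y => ?_)
  simp only [density]
  rw [integral_smul_const]

theorem field_congr_ae {α lam : ℝ} {h₁ h₂ : Phase → ℝ} (h : h₁ =ᵐ[volume] h₂) (x : E3) :
    field α lam h₁ x = field α lam h₂ x := by
  unfold field
  congr 1
  refine integral_congr_ae ?_
  filter_upwards [density_ae_eq h] with y hy
  rw [hy]

namespace DecayingForce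

variable {α K lam η : ℝ} {E : ℝ → E3 → E3} {F : Phase → ℝ}

/-- The field generated by a transported density. -/
theorem field_comp_flow (hE : DecayingForce α K E) (hlam : |lam| = 1) {G : Phase → ℝ}
    (hG : Continuous G) {t : ℝ} (ht : 0 ≤ t) {x : E3}
    (hi : Integrable fun z => G z • gradient (potential α lam) (x - (hE.flow t 0 z).1)) :
    field α lam (fun z => G (hE.flow 0 t z)) x
      = -∫ z, G z • gradient (potential α lam) (x - (hE.flow t 0 z).1) := by
  have hmp := hE.measurePreserving_flow ht
  have hm := measurable_gradient_potential hE.alpha_pos hlam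
  set Q : Phase → E3 := fun z => G (hE.flow 0 t z) • gradient (potential α lam) (x - z.1) with hQ
  have hQm : Measurable Q := (hG.measurable.comp (hE.continuous_flow 0 t).measurable).smul
    (hm.comp (by fun_prop))
  have hcomp : ∀ z, Q (hE.flow t 0 z)
      = G z • gradient (potential α lam) (x - (hE.flow t 0 z).1) := fun z => by
    simp only [hQ, hE.flow_flow, hE.flow_self]
  have hQi : Integrable Q := by
    rw [← hmp.integrable_comp hQm.aestronglyMeasurable]
    exact hi.congr (Eventually.of_forall fun z => (hcomp z).symm)
  rw [field_eq_integral_phase hQi]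
  congr 1
  calc ∫ z, Q z = ∫ z, Q z ∂(Measure.map (hE.flow t 0) volume) := by rw [hmp.map_eq]
    _ = ∫ z, Q (hE.flow t 0 z) := integral_map hmp.aemeasurable hQm.aestronglyMeasurable
    _ = _ := by simp only [hcomp]

/-- Positions with the same starting point separate at least like t/2 times the velocity difference,
so the rescaled position is an expanding function of velocity, uniformly in t. -/
theorem hasRieszBounds_fst_flow (hE : DecayingForce α K E) (hK : K ≤ 1 / 8) (hF : NiceDatum η F)
    {t : ℝ} (ht : 0 < t) : HasRieszBounds η F fun z => t⁻¹ • (hE.flow t 0 z).1 := by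
  refine hF.hasRieszBounds_of_expanding
    ((hE.continuous_flow t 0).fst.const_smul t⁻¹) fun x v v' => ?_
  have h := (hE.isTrajectory_flow 0 (x, v)).forward_fst_expanding (hE.isTrajectory_flow 0 (x, v'))
    hE hK (by simp only [hE.flow_self]) ht.le
  simp only [hE.flow_self] at h
  rw [← smul_sub, norm_smul, norm_inv, Real.norm_of_nonneg ht.le]
  calc ‖v - v'‖ = t⁻¹ * (t * ‖v - v'‖) := by field_simp
    _ ≤ t⁻¹ * (2 * ‖(hE.flow t 0 (x, v)).1 - (hE.flow t 0 (x, v')).1‖) := by gcongr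
    _ = _ := by ring

theorem hasRieszBounds_snd_flow (hE : DecayingForce α K E) (hK : K ≤ 1 / 8) (hF : NiceDatum η F)
    {t : ℝ} (ht : 0 ≤ t) : HasRieszBounds η F fun z => (hE.flow t 0 z).2 := by
  refine hF.hasRieszBounds_of_expanding
    (continuous_snd.comp (hE.continuous_flow t 0)) fun x v v' => ?_
  have h := (hE.isTrajectory_flow 0 (x, v)).forward_snd_expanding (hE.isTrajectory_flow 0 (x, v'))
    hE hK (by simp only [hE.flow_self]) ht
  simpa only [hE.flow_self] using h

theorem gradient_potential_sub_eq (hα : 0 < α) (hlam : |lam| = 1) {t : ℝ} (ht : 0 < t) (x y : E3) :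
    gradient (potential α lam) (x - y)
      = t ^ (-(α + 1)) • gradient (potential α lam) (t⁻¹ • x - t⁻¹ • y) := by
  rw [← gradient_potential_smul hα hlam ht, ← smul_sub, smul_inv_smul₀ ht.ne']

/-- Liouville's theorem moves the integral to the initial data, and homogeneity of the kernel
extracts the power of t. -/
theorem field_eq_kernelAverage (hE : DecayingForce α K E) (hK : K ≤ 1 / 8) (hlam : |lam| = 1)
    (hF : NiceDatum η F) {t : ℝ} (ht : 0 < t) (x : E3) :
    field α lam (fun z => F (hE.flow 0 t z) / jap (hE.flow 0 t z).1) x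
      = -(t ^ (-(α + 1)) • kernelAverage α lam F (fun z => t⁻¹ • (hE.flow t 0 z).1) (t⁻¹ • x)) := by
  have hi := (hF.integrable_kernel (hE.hasRieszBounds_fst_flow hK hF ht) hE.alpha_pos hE.lt_one
    hlam (t⁻¹ • x)).smul (t ^ (-(α + 1)))
  have he : ∀ z, t ^ (-(α + 1)) • ((F z / jap z.1) •
      gradient (potential α lam) (t⁻¹ • x - t⁻¹ • (hE.flow t 0 z).1))
      = (F z / jap z.1) • gradient (potential α lam) (x - (hE.flow t 0 z).1) := fun z => by
    rw [gradient_potential_sub_eq hE.alpha_pos hlam ht x, smul_comm]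
  rw [hE.field_comp_flow hlam hF.continuous_div_jap ht.le
    (hi.congr (Eventually.of_forall he)), kernelAverage, ← integral_smul]
  simp only [he]

/-- Averages of the kernel are Lipschitz. Time 0 is separate because the rescaling by t⁻¹
degenerates; there the Riesz bounds in the position variable take over. -/
theorem continuous_field_comp_flow (hE : DecayingForce α K E) (hK : K ≤ 1 / 8) (hlam : |lam| = 1)
    (hF : NiceDatum η F) {t : ℝ} (ht : 0 ≤ t) :
    Continuous (field α lam fun z => F (hE.flow 0 t z) / jap (hE.flow 0 t z).1) := by
  have hc : ∀ Y : Phase → E3, HasRieszBounds η F Y → Continuous (kernelAverage α lam F Y) := by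
    intro Y hY
    have := NiceDatum.singularConst_pos (α + 2)
    have := hF.pos
    have := hE.alpha_pos
    exact (LipschitzWith.of_dist_le_mul
      (K := ⟨8 * α * NiceDatum.singularConst (α + 2) * η, by positivity⟩) fun x y => by
        rw [dist_eq_norm, dist_eq_norm]
        exact hF.norm_kernelAverage_sub_le_norm_sub hY hE.alpha_pos hE.lt_one hlam x y).continuous
  rcases ht.eq_or_lt with rfl | ht
  · have he : ∀ x, field α lam (fun z => F (hE.flow 0 0 z) / jap (hE.flow 0 0 z).1) x
        = -kernelAverage α lam F Prod.fst x := fun x => by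
      have hi := hF.integrable_kernel hF.hasRieszBounds_fst hE.alpha_pos hE.lt_one hlam x
      rw [hE.field_comp_flow hlam hF.continuous_div_jap le_rfl
        (by simpa only [hE.flow_self] using hi), kernelAverage]
      simp only [hE.flow_self]
    exact (hc _ hF.hasRieszBounds_fst).neg.congr fun x => (he x).symm
  · refine Continuous.congr ?_ fun x => (hE.field_eq_kernelAverage hK hlam hF ht x).symm
    exact (((hc _ (hE.hasRieszBounds_fst_flow hK hF ht)).comp
      (continuous_const_smul t⁻¹)).const_smul (t ^ (-(α + 1)))).neg

end DecayingForce

namespace IsGlobalSolution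

variable {α lam K η : ℝ} {f₀ : Phase → ℝ} {f : ℝ → Phase → ℝ} {E : ℝ → E3 → E3} {F : Phase → ℝ}

theorem ae_eq_datum_comp_flow (hf : IsGlobalSolution α lam f₀ f)
    (hE : DecayingForce α K E) (hEf : ∀ t, 0 ≤ t → field α lam (f t) =ᵐ[volume] E t)
    (hF : NiceDatum η F) (hfF : ∀ᵐ z, f₀ z = F z / jap z.1) {t : ℝ} (ht : 0 ≤ t) :
    f t =ᵐ[volume] fun z => F (hE.flow 0 t z) / jap (hE.flow 0 t z).1 :=
  hf.ae_eq_comp_flow hE hEf hF.continuous_div_jap hfF ht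

/-- The force field is continuous: it equals its continuous representative everywhere. -/
theorem field_eq (hf : IsGlobalSolution α lam f₀ f)
    (hE : DecayingForce α K E) (hK : K ≤ 1 / 8) (hlam : |lam| = 1)
    (hEf : ∀ t, 0 ≤ t → field α lam (f t) =ᵐ[volume] E t)
    (hF : NiceDatum η F) (hfF : ∀ᵐ z, f₀ z = F z / jap z.1) {t : ℝ} (ht : 0 ≤ t) :
    field α lam (f t) = E t := by
  have he : field α lam (f t)
      = field α lam fun z => F (hE.flow 0 t z) / jap (hE.flow 0 t z).1 := by
    funext x; exact field_congr_ae (hf.ae_eq_datum_comp_flow hE hEf hF hfF ht) x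
  have hc : Continuous (field α lam (f t)) := by
    rw [he]; exact hE.continuous_field_comp_flow hK hlam hF ht
  exact (Continuous.ae_eq_iff_eq volume hc (hE.continuous_apply t)).1 (hEf t ht)

/-- The scaled force field is an average of the interaction kernel. -/
theorem force_eq_kernelAverage (hf : IsGlobalSolution α lam f₀ f)
    (hE : DecayingForce α K E) (hK : K ≤ 1 / 8) (hlam : |lam| = 1)
    (hEf : ∀ t, 0 ≤ t → field α lam (f t) =ᵐ[volume] E t)
    (hF : NiceDatum η F) (hfF : ∀ᵐ z, f₀ z = F z / jap z.1) {t : ℝ} (ht : 0 < t) (x : E3) :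
    E t x = -(t ^ (-(α + 1)) •
      kernelAverage α lam F (fun z => t⁻¹ • (hE.flow t 0 z).1) (t⁻¹ • x)) := by
  rw [← hf.field_eq hE hK hlam hEf hF hfF ht.le, ← hE.field_eq_kernelAverage hK hlam hF ht]
  exact field_congr_ae (hf.ae_eq_datum_comp_flow hE hEf hF hfF ht.le) x

end IsGlobalSolution

/-- The characteristic equations see the field pointwise, so almost everywhere equality with E would
not do; given equality everywhere this is uniqueness for the Lipschitz equation. -/
theorem IsCharacteristicFlow.eq_flow {α lam K : ℝ} {f : ℝ → Phase → ℝ} {E : ℝ → E3 → E3}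
    {Φ : ℝ → Phase → Phase} (hΦ : IsCharacteristicFlow α lam f Φ) (hE : DecayingForce α K E)
    (hEf : ∀ t, 0 ≤ t → field α lam (f t) = E t) {t : ℝ} (ht : 0 ≤ t) (z : Phase) :
    Φ t z = hE.flow t 0 z := by
  obtain ⟨h0, hd⟩ := hΦ z
  have hγ := hE.isTrajectory_flow 0 z
  refine ODE_solution_unique (v := phaseField E) (K := hE.lip) (a := 0) (b := t)
    (f := fun s => Φ s z) (g := fun s => hE.flow s 0 z)
    (fun s => hE.lipschitzWith_phaseField s)
    (fun s hs => ((hd s hs.1).continuousWithinAt).mono fun r hr => hr.1)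
    (fun s hs => ?_) (hE.continuous_flow_time 0 z).continuousOn
    (fun s _ => (hγ s).hasDerivWithinAt) (by simp only [h0, hE.flow_self]) ⟨ht, le_rfl⟩
  have := (hd s hs.1).mono (Set.Ici_subset_Ici.2 hs.1)
  rw [hEf s hs.1] at this
  exact this

theorem correction_eq {α lam K : ℝ} {f₀ : Phase → ℝ} {E : ℝ → E3 → E3} {F : Phase → ℝ}
    {Φ : ℝ → Phase → Phase} (hE : DecayingForce α K E) (hfF : ∀ᵐ z, f₀ z = F z / jap z.1)
    {t : ℝ} (hΦ : ∀ z, Φ t z = hE.flow t 0 z) (v : E3) :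
    correction α lam f₀ Φ t v = -kernelAverage α lam F (fun z => (hE.flow t 0 z).2) v := by
  unfold correction kernelAverage
  congr 1
  refine integral_congr_ae ?_
  filter_upwards [hfF] with z hz
  rw [hz, hΦ]

/-! ### Compensation of the long range drift -/

theorem integral_one_add_abs_rpow_tail_le {α s t : ℝ} (hα : 1 / 2 < α) (hs : 1 ≤ s) (hst : s ≤ t) :
    ∫ r in s..t, (1 + |r|) ^ (-(1 + α)) ≤ 2 * s ^ (-α) := by
  have hi : ∀ a b, IntervalIntegrable (fun r : ℝ => (1 + |r|) ^ (-(1 + α))) volume a b :=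
    fun a b => (continuous_one_add_abs_rpow _).intervalIntegrable a b
  rw [← intervalIntegral.integral_interval_sub_left (hi 0 t) (hi 0 s),
    integral_one_add_abs_rpow (by linarith) (by linarith),
    integral_one_add_abs_rpow (by linarith) (by linarith), ← sub_div]
  have h2 : -(1 + α) + 1 = -α := by ring
  rw [h2, div_neg, ← neg_div, div_le_iff₀ (by linarith)]
  have h1 : 0 ≤ (1 + t) ^ (-α) := by
    have : 0 ≤ 1 + t := by linarith
    positivity
  have h3 : (1 + s) ^ (-α) ≤ s ^ (-α) :=
    Real.rpow_le_rpow_of_nonpos (by linarith) (by linarith) (by linarith)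
  have h4 : 0 ≤ s ^ (-α) := by positivity
  nlinarith

namespace IsTrajectory

variable {α K : ℝ} {E : ℝ → E3 → E3} {γ : ℝ → Phase}

/-- The derivative of X - σV is -σE, so the drift away from free transport is the first time moment
of the force. -/
theorem fst_sub_smul_snd (h : IsTrajectory E γ) (hE : DecayingForce α K E) (s : ℝ) :
    (γ s).1 - s • (γ s).2 = (γ 0).1 - ∫ σ in (0 : ℝ)..s, σ • E σ (γ σ).1 := by
  have h1 := h.fst_eq hE 0 s
  rw [intervalIntegral.integral_symm] at h1
  simp only [zero_sub, neg_smul, intervalIntegral.integral_neg, neg_neg] at h1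
  rw [h1]
  abel

theorem norm_smul_force_le (hE : DecayingForce α K E) {σ : ℝ} (hσ : 0 ≤ σ) (x : E3) :
    ‖σ • E σ x‖ ≤ K * (1 + |σ|) ^ (-α) := by
  rw [norm_smul, Real.norm_of_nonneg hσ]
  have h0 : (0 : ℝ) < 1 + |σ| := by positivity
  have h1 : (1 + |σ|) * (1 + |σ|) ^ (-(1 + α)) = (1 + |σ|) ^ (-α) := by
    have := Real.rpow_one_add' h0.le (y := -(1 + α)) (by linarith [hE.alpha_pos])
    rw [← this]; ring_nf
  have h2 : σ ≤ 1 + |σ| := by linarith [le_abs_self σ]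
  have hK := hE.nonneg
  calc σ * ‖E σ x‖ ≤ (1 + |σ|) * (K * (1 + |σ|) ^ (-(1 + α))) := by
        gcongr; exact hE.decay_le σ x
    _ = K * ((1 + |σ|) * (1 + |σ|) ^ (-(1 + α))) := by ring
    _ = _ := by rw [h1]

/-- The drift up to time s is at most a multiple of s^{1-α}, and replacing V(s) by the later V(t)
costs s times the tail of the force, of the same size. Hence a single velocity, that at time t,
serves all intermediate s. -/
theorem norm_fst_sub_smul_snd_le (h : IsTrajectory E γ) (hE : DecayingForce α K E)
    (hK : K ≤ (1 - α) / 16) {s t : ℝ} (hs : 1 ≤ s) (hst : s ≤ t) :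
    ‖(γ s).1 - s • (γ t).2‖ ≤ ‖(γ 0).1‖ + s ^ (1 - α) := by
  have hα := hE.alpha_pos
  have hα1 := hE.lt_one
  have h0 := hE.nonneg
  have hs0 : 0 < s := by linarith
  have e : (γ s).1 - s • (γ t).2 = (γ 0).1 - (∫ σ in (0 : ℝ)..s, σ • E σ (γ σ).1)
      - s • ∫ σ in s..t, E σ (γ σ).1 := by
    rw [← h.fst_sub_smul_snd hE s, h.snd_eq hE t s]
    module
  have h1 : ‖∫ σ in (0 : ℝ)..s, σ • E σ (γ σ).1‖ ≤ 1 / 8 * s ^ (1 - α) := by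
    calc _ ≤ ∫ σ in (0 : ℝ)..s, K * (1 + |σ|) ^ (-α) :=
          intervalIntegral.norm_integral_le_of_norm_le hs0.le
            (Eventually.of_forall fun σ hσ => norm_smul_force_le hE hσ.1.le _)
            (((continuous_one_add_abs_rpow _).const_mul K).intervalIntegrable _ _)
      _ = K * ∫ σ in (0 : ℝ)..s, (1 + |σ|) ^ (-α) := intervalIntegral.integral_const_mul _ _
      _ ≤ (1 - α) / 16 * (2 / (1 - α) * s ^ (1 - α)) := by
          have hnn : 0 ≤ ∫ σ in (0 : ℝ)..s, (1 + |σ|) ^ (-α) :=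
            intervalIntegral.integral_nonneg hs0.le fun σ _ => by positivity
          exact mul_le_mul hK (integral_one_add_abs_rpow_neg_le hα hα1 hs) hnn (by linarith)
      _ = _ := by
          have : 1 - α ≠ 0 := by linarith
          field_simp; ring
  have h2 : ‖∫ σ in s..t, E σ (γ σ).1‖ ≤ K * (2 * s ^ (-α)) := by
    calc _ ≤ ∫ σ in s..t, K * (1 + |σ|) ^ (-(1 + α)) :=
          intervalIntegral.norm_integral_le_of_norm_le hst
            (Eventually.of_forall fun σ _ => hE.decay_le σ _)
            (((continuous_one_add_abs_rpow _).const_mul K).intervalIntegrable _ _)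
      _ = K * ∫ σ in s..t, (1 + |σ|) ^ (-(1 + α)) := intervalIntegral.integral_const_mul _ _
      _ ≤ _ := by
          gcongr
          exact integral_one_add_abs_rpow_tail_le hE.half_lt hs hst
  have h3 : s * s ^ (-α) = s ^ (1 - α) := by
    rw [sub_eq_add_neg, Real.rpow_add hs0, Real.rpow_one]
  have h4 : 0 ≤ s ^ (1 - α) := by positivity
  have h5 : ‖s • ∫ σ in s..t, E σ (γ σ).1‖ ≤ 1 / 8 * s ^ (1 - α) := by
    rw [norm_smul, Real.norm_of_nonneg hs0.le]
    calc _ ≤ s * (K * (2 * s ^ (-α))) := by gcongr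
      _ = 2 * K * (s * s ^ (-α)) := by ring
      _ ≤ _ := by
          rw [h3]
          gcongr
          linarith
  rw [e]
  have h6 := norm_sub_le ((γ 0).1 - ∫ σ in (0 : ℝ)..s, σ • E σ (γ σ).1)
    (s • ∫ σ in s..t, E σ (γ σ).1)
  have h7 := norm_sub_le (γ 0).1 (∫ σ in (0 : ℝ)..s, σ • E σ (γ σ).1)
  linarith

end IsTrajectory

theorem norm_le_jap (x : E3) : ‖x‖ ≤ jap x := by
  unfold jap
  exact Real.le_sqrt_of_sq_le (by linarith)

theorem jap_le_one_add_norm (x : E3) : jap x ≤ 1 + ‖x‖ := by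
  unfold jap
  rw [Real.sqrt_le_left (by positivity)]
  nlinarith [norm_nonneg x]

namespace DecayingForce

variable {α K lam η : ℝ} {E : ℝ → E3 → E3} {F : Phase → ℝ}

/-- The force, rescaled by time, is close to the velocity correction. -/
theorem norm_force_sub_correction_le (hE : DecayingForce α K E) (hK : K ≤ (1 - α) / 16)
    (hlam : |lam| = 1) (hF : NiceDatum η F)
    (hEk : ∀ t, 0 < t → ∀ x, E t x = -(t ^ (-(α + 1)) •
      kernelAverage α lam F (fun z => t⁻¹ • (hE.flow t 0 z).1) (t⁻¹ • x)))
    {s t : ℝ} (hs : 1 ≤ s) (hst : s ≤ t) {γ : ℝ → Phase} (hγ : IsTrajectory E γ) :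
    ‖s • E s (γ s).1 + s ^ (-α) • kernelAverage α lam F (fun z => (hE.flow t 0 z).2) (γ t).2‖
      ≤ 32 * α * NiceDatum.singularConst (α + 2) * η * jap (γ 0).1 * s ^ (-(2 * α)) := by
  have hα := hE.alpha_pos
  have hα1 := hE.lt_one
  have hs0 : 0 < s := by linarith
  have hK8 : K ≤ 1 / 8 := by linarith
  have hS := NiceDatum.singularConst_pos (α + 2)
  have hη := hF.pos
  have hj := jap_pos (γ 0).1
  have e1 : s * s ^ (-(α + 1)) = s ^ (-α) := by
    have := Real.rpow_one_add' hs0.le (y := -(α + 1)) (by linarith)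
    rw [← this]; ring_nf
  have e2 : s ^ (-α) * s ^ (-α) = s ^ (-(2 * α)) := by
    rw [← Real.rpow_add hs0]; ring_nf
  have e3 : s⁻¹ * s ^ (1 - α) = s ^ (-α) := by
    rw [← Real.rpow_neg_one, ← Real.rpow_add hs0]; ring_nf
  have e4 : s⁻¹ ≤ s ^ (-α) := by
    rw [← Real.rpow_neg_one]
    exact Real.rpow_le_rpow_of_exponent_le hs (by linarith)
  have hmain := hF.norm_kernelAverage_sub_le (α := α) (lam := lam)
    (hE.hasRieszBounds_fst_flow hK8 hF hs0)
    (hE.hasRieszBounds_snd_flow hK8 hF (t := t) (by linarith)) hα hα1 hlam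
    -- The two drifts contribute s⁻¹(|X(0)| + |x| + 2s^{1-α}). As brackets are at least 1, the
    -- product of both brackets dominates everything, and the one of z is left to the datum.
    (a := s⁻¹ • (γ s).1) (b := (γ t).2) (D := 4 * jap (γ 0).1 * s ^ (-α)) fun z => by
      have h1 := hγ.norm_fst_sub_smul_snd_le hE hK hs hst
      have h2 := (hE.isTrajectory_flow 0 z).norm_fst_sub_smul_snd_le hE hK hs hst
      simp only [hE.flow_self] at h2
      have e5 : s⁻¹ • (γ s).1 - s⁻¹ • (hE.flow s 0 z).1 - ((γ t).2 - (hE.flow t 0 z).2)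
          = s⁻¹ • (((γ s).1 - s • (γ t).2)
            - ((hE.flow s 0 z).1 - s • (hE.flow t 0 z).2)) := by
        simp only [smul_sub, inv_smul_smul₀ hs0.ne']
        abel
      rw [e5, norm_smul, norm_inv, Real.norm_of_nonneg hs0.le]
      have h3 := norm_sub_le ((γ s).1 - s • (γ t).2) ((hE.flow s 0 z).1 - s • (hE.flow t 0 z).2)
      have h4 := norm_le_jap (γ 0).1
      have h5 := norm_le_jap z.1
      have h6 := one_le_jap (γ 0).1
      have h7 := one_le_jap z.1
      have h8 : 1 ≤ jap (γ 0).1 * jap z.1 := one_le_mul_of_one_le_of_one_le h6 h7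
      have h9 : jap (γ 0).1 + jap z.1 ≤ 2 * (jap (γ 0).1 * jap z.1) := by nlinarith
      have h10 : 0 ≤ s ^ (1 - α) := by positivity
      have h11 : 0 ≤ s ^ (-α) := by positivity
      calc _ ≤ s⁻¹ * (2 * (jap (γ 0).1 * jap z.1) + 2 * s ^ (1 - α)) := by
            gcongr; linarith
        _ = 2 * (jap (γ 0).1 * jap z.1) * s⁻¹ + 2 * (s⁻¹ * s ^ (1 - α)) := by ring
        _ ≤ 2 * (jap (γ 0).1 * jap z.1) * s ^ (-α)
            + 2 * ((jap (γ 0).1 * jap z.1) * s ^ (-α)) := by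
            rw [e3]
            gcongr
            exact le_mul_of_one_le_left h11 h8
        _ = _ := by ring
  rw [hEk s hs0, smul_neg, smul_smul, e1, neg_add_eq_sub, ← smul_sub, norm_smul,
    Real.norm_of_nonneg (by positivity), norm_sub_rev]
  calc _ ≤ s ^ (-α) * (8 * α * NiceDatum.singularConst (α + 2) * η
        * (4 * jap (γ 0).1 * s ^ (-α))) := by gcongr
    _ = 32 * α * NiceDatum.singularConst (α + 2) * η * jap (γ 0).1
        * (s ^ (-α) * s ^ (-α)) := by ring
    _ = _ := by rw [e2]

/-- The constant in the weight comparison. -/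
noncomputable def weightConst (α : ℝ) : ℝ :=
  3 + 32 * α * NiceDatum.singularConst (α + 2) / (2 * α - 1)

theorem weightConst_pos {α : ℝ} (hα : 1 / 2 < α) : 0 < weightConst α := by
  have := NiceDatum.singularConst_pos (α + 2)
  have h2 : 0 < 2 * α - 1 := by linarith
  unfold weightConst
  have : 0 < α := by linarith
  positivity

/-- Along the modified reference flow the spatial weight is comparable to the initial one. -/
theorem jap_le_mul_jap (hE : DecayingForce α K E) (hK : K ≤ (1 - α) / 16)
    (hlam : |lam| = 1) (hF : NiceDatum η F) (hη : η ≤ 1)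
    (hEk : ∀ t, 0 < t → ∀ x, E t x = -(t ^ (-(α + 1)) •
      kernelAverage α lam F (fun z => t⁻¹ • (hE.flow t 0 z).1) (t⁻¹ • x)))
    {t : ℝ} (ht : 1 ≤ t) {γ : ℝ → Phase} (hγ : IsTrajectory E γ) {x : E3}
    (hx : (γ t).1 = x + t • (γ t).2 + ((t ^ (1 - α) - 1) / (1 - α)) •
      kernelAverage α lam F (fun z => (hE.flow t 0 z).2) (γ t).2) :
    jap x ≤ weightConst α * jap (γ 0).1 := by
  have hα := hE.alpha_pos
  have hα1 := hE.lt_one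
  have hhalf := hE.half_lt
  have hK0 := hE.nonneg
  have hS := NiceDatum.singularConst_pos (α + 2)
  have hη0 := hF.pos
  have hj := one_le_jap (γ 0).1
  set A := kernelAverage α lam F (fun z => (hE.flow t 0 z).2) (γ t).2 with hA
  have hc : Continuous fun σ : ℝ => σ • E σ (γ σ).1 :=
    continuous_id.smul (hγ.continuous_force hE)
  have hpos : ∀ {σ : ℝ}, σ ∈ Set.uIcc 1 t → σ ≠ 0 := fun {σ} hσ => by
    rw [Set.uIcc_of_le ht] at hσ
    linarith [hσ.1]
  have hri : ∀ β : ℝ, IntervalIntegrable (fun σ : ℝ => σ ^ β) volume 1 t := fun β =>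
    ContinuousOn.intervalIntegrable fun σ hσ =>
      (Real.continuousAt_rpow_const σ β (Or.inl (hpos hσ))).continuousWithinAt
  have h0t : (0 : ℝ) ∉ Set.uIcc 1 t := fun h => hpos h rfl
  -- The time factor of the reference map is exactly the integral of σ^{-α} from 1, so the
  -- correction can be subtracted under the time integral; A carries the sign opposite to the
  -- velocity correction.
  have hτ : ((t ^ (1 - α) - 1) / (1 - α)) • A = ∫ σ in (1 : ℝ)..t, σ ^ (-α) • A := by
    rw [intervalIntegral.integral_smul_const, integral_rpow (Or.inr ⟨by linarith, h0t⟩),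
      Real.one_rpow]
    have : -α + 1 = 1 - α := by ring
    rw [this]
  have e : x = (γ 0).1 - (∫ σ in (0 : ℝ)..1, σ • E σ (γ σ).1)
      - ∫ σ in (1 : ℝ)..t, (σ • E σ (γ σ).1 + σ ^ (-α) • A) := by
    have h1 := hγ.fst_sub_smul_snd hE t
    rw [← intervalIntegral.integral_add_adjacent_intervals (b := 1)
      (hc.intervalIntegrable _ _) (hc.intervalIntegrable _ _)] at h1
    have hrA : IntervalIntegrable (fun σ : ℝ => σ ^ (-α) • A) volume 1 t :=
      ContinuousOn.intervalIntegrable fun σ hσ => ((Real.continuousAt_rpow_const σ (-α)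
        (Or.inl (hpos hσ))).smul continuousAt_const).continuousWithinAt
    rw [intervalIntegral.integral_add (hc.intervalIntegrable _ _) hrA, ← hτ]
    rw [hx] at h1
    have h2 : x = (x + t • (γ t).2 + ((t ^ (1 - α) - 1) / (1 - α)) • A - t • (γ t).2)
        - ((t ^ (1 - α) - 1) / (1 - α)) • A := by abel
    rw [h1] at h2
    rw [h2]
    abel
  have h1 : ‖∫ σ in (0 : ℝ)..1, σ • E σ (γ σ).1‖ ≤ 1 := by
    have := intervalIntegral.norm_integral_le_of_norm_le_const (a := 0) (b := 1) (C := 1)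
      (f := fun σ : ℝ => σ • E σ (γ σ).1) fun σ hσ => by
        rw [Set.uIoc_of_le zero_le_one] at hσ
        refine (IsTrajectory.norm_smul_force_le hE hσ.1.le _).trans ?_
        have h1 := rpow_one_add_abs_le_one hα.le σ
        calc K * (1 + |σ|) ^ (-α) ≤ K * 1 := by gcongr
          _ ≤ 1 := by linarith
    simpa using this
  set c := 32 * α * NiceDatum.singularConst (α + 2) * η * jap (γ 0).1 with hcdef
  have hc0 : 0 ≤ c := by positivity
  -- The compensated integrand decays like σ^{-2α}; convergence uniformly in t is where α > 1/2 is
  -- decisive.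
  have h2 : ‖∫ σ in (1 : ℝ)..t, (σ • E σ (γ σ).1 + σ ^ (-α) • A)‖ ≤ c * (1 / (2 * α - 1)) := by
    calc _ ≤ ∫ σ in (1 : ℝ)..t, c * σ ^ (-(2 * α)) :=
          intervalIntegral.norm_integral_le_of_norm_le ht
            (Eventually.of_forall fun σ hσ =>
              hE.norm_force_sub_correction_le hK hlam hF hEk hσ.1.le hσ.2 hγ)
            ((hri _).const_mul c)
      _ = c * ((t ^ (-(2 * α) + 1) - 1) / (-(2 * α) + 1)) := by
          rw [intervalIntegral.integral_const_mul, integral_rpow (Or.inr ⟨by linarith, h0t⟩),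
            Real.one_rpow]
      _ ≤ _ := by
          refine mul_le_mul_of_nonneg_left ?_ hc0
          have h3 : 0 ≤ t ^ (-(2 * α) + 1) := by positivity
          have h4 : -(2 * α) + 1 = -(2 * α - 1) := by ring
          rw [h4] at h3 ⊢
          rw [div_neg, ← neg_div]
          exact div_le_div_of_nonneg_right (by linarith) (by linarith)
  have h3 := norm_sub_le ((γ 0).1 - (∫ σ in (0 : ℝ)..1, σ • E σ (γ σ).1))
    (∫ σ in (1 : ℝ)..t, (σ • E σ (γ σ).1 + σ ^ (-α) • A))
  have h4 := norm_sub_le (γ 0).1 (∫ σ in (0 : ℝ)..1, σ • E σ (γ σ).1)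
  rw [← e] at h3
  have h5 := norm_le_jap (γ 0).1
  have h6 : 0 < 2 * α - 1 := by linarith
  have h7 : c * (1 / (2 * α - 1)) ≤ 32 * α * NiceDatum.singularConst (α + 2) / (2 * α - 1)
      * jap (γ 0).1 := by
    calc c * (1 / (2 * α - 1)) = 32 * α * NiceDatum.singularConst (α + 2) / (2 * α - 1)
          * jap (γ 0).1 * η := by rw [hcdef]; ring
      _ ≤ _ := mul_le_of_le_one_right (by positivity) hη
  refine (jap_le_one_add_norm x).trans ?_
  unfold weightConst
  linarith

end DecayingForce

/-! ### The modified distribution -/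

theorem jap_le_add_norm_sub (x y : E3) : jap x ≤ jap y + ‖x - y‖ := by
  have hy := jap_pos y
  have h1 : jap y ^ 2 = 1 + ‖y‖ ^ 2 := by
    unfold jap; exact Real.sq_sqrt (by positivity)
  have h2 := norm_le_jap y
  have h3 : ‖x‖ ≤ ‖y‖ + ‖x - y‖ := by
    have := norm_add_le y (x - y)
    rwa [add_sub_cancel] at this
  have h4 := norm_nonneg (x - y)
  rw [jap, Real.sqrt_le_left (by positivity)]
  nlinarith [norm_nonneg x, norm_nonneg y, mul_le_mul_of_nonneg_right h2 h4]

/-- The bracket is 1-Lipschitz, so dividing by it adds 2η to the Lipschitz constant 12η of F while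
gaining the decay 1/⟨x⟩ at p. -/
theorem NiceDatum.abs_div_jap_sub_le {η : ℝ} {F : Phase → ℝ} (hF : NiceDatum η F) (p q : Phase) :
    |F p / jap p.1 - F q / jap q.1| ≤ 14 * η / jap p.1 * ‖p - q‖ := by
  have hp := jap_pos p.1
  have hq := jap_pos q.1
  have hη := hF.pos
  have h1 := hF.lipschitz p q
  have h2 : |jap q.1 - jap p.1| ≤ ‖p - q‖ := by
    have h3 := norm_fst_le (p - q)
    rw [Prod.fst_sub] at h3
    refine le_trans (abs_sub_le_iff.2 ⟨?_, ?_⟩) h3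
    · have := jap_le_add_norm_sub q.1 p.1
      rw [norm_sub_rev] at this
      linarith
    · linarith [jap_le_add_norm_sub p.1 q.1]
  have h3 : F q / jap q.1 ≤ 2 * η := (hF.div_jap_le q).trans (hF.le q)
  have h4 := hF.div_jap_nonneg q
  have e : F p / jap p.1 - F q / jap q.1
      = ((F p - F q) + F q / jap q.1 * (jap q.1 - jap p.1)) / jap p.1 := by
    field_simp; ring
  rw [e, abs_div, abs_of_pos hp, div_mul_eq_mul_div (14 * η)]
  refine div_le_div_of_nonneg_right ?_ hp.le
  have h5 : |F q / jap q.1 * (jap q.1 - jap p.1)| ≤ 2 * η * ‖p - q‖ := by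
    rw [abs_mul, abs_of_nonneg h4]
    gcongr
  linarith [abs_add_le (F p - F q) (F q / jap q.1 * (jap q.1 - jap p.1))]

namespace DecayingForce

variable {α K lam η : ℝ} {E : ℝ → E3 → E3} {F : Phase → ℝ}

/-- The modified reference map followed by the backward flow. -/
noncomputable def pullback (hE : DecayingForce α K E) (lam : ℝ) (F : Phase → ℝ) (t : ℝ)
    (z : Phase) : Phase :=
  hE.flow 0 t (z.1 + t • z.2 + ((t ^ (1 - α) - 1) / (1 - α)) •
    kernelAverage α lam F (fun z => (hE.flow t 0 z).2) z.2, z.2)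

/-- The constant in the estimate of the velocity derivatives of the pullback. -/
noncomputable def shearConst (α : ℝ) : ℝ := 8 * NiceDatum.singularConst (α + 2) / (1 - α)

theorem shearConst_nonneg {α : ℝ} (hα1 : α < 1) : 0 ≤ shearConst α := by
  have := NiceDatum.singularConst_pos (α + 2)
  have h2 : 0 < 1 - α := by linarith
  unfold shearConst
  positivity

/-- The correction depends on v alone, so at fixed v the final data differ only by x - x' in
position. -/
theorem norm_pullback_sub_le_of_snd_eq (hE : DecayingForce α K E) (hK : K ≤ 1 / 8) {t : ℝ}
    (ht : 0 ≤ t) (x x' v : E3) :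
    ‖hE.pullback lam F t (x, v) - hE.pullback lam F t (x', v)‖ ≤ 2 * ‖x - x'‖ := by
  have h := (hE.isTrajectory_flow t (x + t • v + ((t ^ (1 - α) - 1) / (1 - α)) •
    kernelAverage α lam F (fun z => (hE.flow t 0 z).2) v, v)).backward_sub_le_of_snd_eq
    (hE.isTrajectory_flow t (x' + t • v + ((t ^ (1 - α) - 1) / (1 - α)) •
    kernelAverage α lam F (fun z => (hE.flow t 0 z).2) v, v)) hE hK ht
    (by simp only [hE.flow_self])
  simp only [hE.flow_self, add_sub_add_right_eq_sub] at h
  exact h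

/-- At fixed x the final data differ by free transport of v - v' plus the shear of the correction.
That shear is a Lipschitz function of v multiplied by a time factor of size t^{1-α}, which is what
backward stability tolerates. -/
theorem norm_pullback_sub_le_of_fst_eq (hE : DecayingForce α K E) (hK : K ≤ (1 - α) / 16)
    (hlam : |lam| = 1) (hF : NiceDatum η F) (hη : η ≤ 1) {t : ℝ} (ht : 1 ≤ t) (x v v' : E3) :
    ‖hE.pullback lam F t (x, v) - hE.pullback lam F t (x, v')‖
      ≤ 2 * (1 + shearConst α) * t ^ (1 - α) * ‖v - v'‖ := by
  have hα := hE.alpha_pos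
  have hα1 := hE.lt_one
  have hα1' : 0 < 1 - α := by linarith
  have hS := NiceDatum.singularConst_pos (α + 2)
  have hη0 := hF.pos
  set A := kernelAverage α lam F (fun z => (hE.flow t 0 z).2) with hA
  set τ := (t ^ (1 - α) - 1) / (1 - α) with hτ
  have h1 : 1 ≤ t ^ (1 - α) := Real.one_le_rpow ht hα1'.le
  have hτ0 : 0 ≤ τ := div_nonneg (by linarith) hα1'.le
  have hτle : τ ≤ t ^ (1 - α) / (1 - α) := by
    rw [hτ]; gcongr; linarith
  have hL := hF.norm_kernelAverage_sub_le_norm_sub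
    (hE.hasRieszBounds_snd_flow (by linarith) hF (t := t) (by linarith)) hα hα1 hlam v v'
  have h := (hE.isTrajectory_flow t (x + t • v + τ • A v, v)).backward_sub_le_of_fst_sub
    (hE.isTrajectory_flow t (x + t • v' + τ • A v', v')) hE hK ht (shearConst_nonneg hα1)
  simp only [hE.flow_self] at h
  refine h ?_
  have e : x + t • v + τ • A v - (x + t • v' + τ • A v') - t • (v - v')
      = τ • (A v - A v') := by module
  rw [e, norm_smul, Real.norm_of_nonneg hτ0]
  calc τ * ‖A v - A v'‖
      ≤ t ^ (1 - α) / (1 - α) * (8 * α * NiceDatum.singularConst (α + 2) * η * ‖v - v'‖) := by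
        gcongr
    _ = 8 * NiceDatum.singularConst (α + 2) / (1 - α) * t ^ (1 - α) * ‖v - v'‖ * (α * η) := by
        ring
    _ ≤ _ := by
        unfold shearConst
        exact mul_le_of_le_one_right (by positivity) (mul_le_one₀ hα1.le hη0.le hη)

theorem abs_comp_pullback_sub_le (hE : DecayingForce α K E) (hF : NiceDatum η F) {W t : ℝ}
    {p q : Phase} (hp : jap p.1 ≤ W * jap (hE.pullback lam F t p).1) {B : ℝ}
    (hB : ‖hE.pullback lam F t q - hE.pullback lam F t p‖ ≤ B) :
    |F (hE.pullback lam F t q) / jap (hE.pullback lam F t q).1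
      - F (hE.pullback lam F t p) / jap (hE.pullback lam F t p).1|
      ≤ 14 * W * η / jap p.1 * B := by
  have h := hF.abs_div_jap_sub_le (hE.pullback lam F t p) (hE.pullback lam F t q)
  have hη := hF.pos
  have hp0 := jap_pos p.1
  have hq0 := jap_pos (hE.pullback lam F t p).1
  have hB0 := (norm_nonneg _).trans hB
  rw [abs_sub_comm, norm_sub_rev] at h
  refine h.trans ?_
  have h2 : 14 * η / jap (hE.pullback lam F t p).1 ≤ 14 * W * η / jap p.1 := by
    rw [div_le_div_iff₀ hq0 hp0]
    nlinarith
  have h3 : 0 ≤ 14 * η / jap (hE.pullback lam F t p).1 := by positivity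
  exact mul_le_mul h2 hB (norm_nonneg _) (h3.trans h2)

end DecayingForce

/-- The constant in the final estimate. -/
noncomputable def dispersionConst (α : ℝ) : ℝ :=
  DecayingForce.weightConst α * (170 + 84 * DecayingForce.shearConst α)

theorem dispersionConst_pos {α : ℝ} (hα : 1 / 2 < α) (hα1 : α < 1) : 0 < dispersionConst α := by
  have := DecayingForce.weightConst_pos hα
  have := DecayingForce.shearConst_nonneg hα1
  unfold dispersionConst
  positivity

/-- Weighted bounds for functions which agree almost everywhere with the transported datum. -/
theorem DecayingForce.weighted_bounds {α K lam η : ℝ} {E : ℝ → E3 → E3} {F : Phase → ℝ}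
    (hE : DecayingForce α K E) (hK : K ≤ (1 - α) / 16) (hlam : |lam| = 1) (hF : NiceDatum η F)
    (hη : η ≤ 1) (hEk : ∀ t, 0 < t → ∀ x, E t x = -(t ^ (-(α + 1)) •
      kernelAverage α lam F (fun z => t⁻¹ • (hE.flow t 0 z).1) (t⁻¹ • x)))
    {t : ℝ} (ht : 1 ≤ t) {g : Phase → ℝ} (hg : g =ᵐ[volume] fun z =>
      F (hE.pullback lam F t z) / jap (hE.pullback lam F t z).1) :
    weightedSup g + (∑ i, weakDerivNorm weightedSup [dirX i] g)
        + ENNReal.ofReal (1 / t ^ (1 - α)) * (∑ i, weakDerivNorm weightedSup [dirV i] g)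
      ≤ ENNReal.ofReal (dispersionConst α * η) := by
  have hα1 := hE.lt_one
  have hη0 := hF.pos
  set W := weightConst α with hW
  set a := shearConst α with ha
  have hW0 : 0 < W := weightConst_pos hE.half_lt
  have ha0 : 0 ≤ a := shearConst_nonneg hα1
  have htp : 0 < t ^ (1 - α) := by positivity
  set P := hE.pullback lam F t with hP
  set G : Phase → ℝ := fun z => F (P z) / jap (P z).1 with hG
  have hw : ∀ z, jap z.1 ≤ W * jap (P z).1 := fun z => by
    refine hE.jap_le_mul_jap hK hlam hF hη hEk ht (hE.isTrajectory_flow t _) ?_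
    simp only [hE.flow_self]
  have hGX : ∀ x x' v, |G (x', v) - G (x, v)| ≤ 28 * W * η / jap x * ‖x' - x‖ := fun x x' v => by
    refine (hE.abs_comp_pullback_sub_le hF (hw (x, v))
      (hE.norm_pullback_sub_le_of_snd_eq (by linarith [hE.alpha_pos]) (by linarith) x' x v)).trans
      (le_of_eq ?_)
    ring
  have hGV : ∀ x v v', |G (x, v') - G (x, v)|
      ≤ 28 * W * η * (1 + a) * t ^ (1 - α) / jap x * ‖v' - v‖ := fun x v v' => by
    refine (hE.abs_comp_pullback_sub_le hF (hw (x, v))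
      (hE.norm_pullback_sub_le_of_fst_eq hK hlam hF hη ht x v' v)).trans (le_of_eq ?_)
    ring
  have hBX : 0 ≤ 28 * W * η := by positivity
  have hBV : 0 ≤ 28 * W * η * (1 + a) * t ^ (1 - α) := by positivity
  -- Used only qualitatively, to make line derivatives weak derivatives; its growth in t is
  -- harmless.
  have hLip : LipschitzWith ⟨28 * W * η + 28 * W * η * (1 + a) * t ^ (1 - α), by positivity⟩ G := by
    refine LipschitzWith.of_dist_le_mul fun z z' => ?_
    rw [Real.dist_eq, dist_eq_norm]
    have h1 := hGX z'.1 z.1 z.2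
    have h2 := hGV z'.1 z'.2 z.2
    have h3 : ‖z.1 - z'.1‖ ≤ ‖z - z'‖ := norm_fst_le (z - z')
    have h4 : ‖z.2 - z'.2‖ ≤ ‖z - z'‖ := norm_snd_le (z - z')
    have hj := one_le_jap z'.1
    have h5 : 28 * W * η / jap z'.1 * ‖z.1 - z'.1‖ ≤ 28 * W * η * ‖z - z'‖ := by
      gcongr
      exact div_le_self hBX hj
    have h6 : 28 * W * η * (1 + a) * t ^ (1 - α) / jap z'.1 * ‖z.2 - z'.2‖
        ≤ 28 * W * η * (1 + a) * t ^ (1 - α) * ‖z - z'‖ := by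
      gcongr
      exact div_le_self hBV hj
    have h7 := abs_sub_le (G z) (G (z'.1, z.2)) (G z')
    change |G z - G z'| ≤ (28 * W * η + 28 * W * η * (1 + a) * t ^ (1 - α)) * ‖z - z'‖
    linarith
  have hdir : ∀ i, ‖dir i‖ = 1 := fun i => by simp [dir]
  have b0 : weightedSup g ≤ ENNReal.ofReal (2 * W * η) := by
    refine weightedSup_le ?_
    filter_upwards [hg] with z hz
    have hj := jap_pos z.1
    have hPz := jap_pos (P z).1
    have h0 : 0 ≤ G z := hF.div_jap_nonneg _
    rw [hz, abs_of_nonneg (mul_nonneg hj.le h0)]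
    calc jap z.1 * G z ≤ W * jap (P z).1 * (F (P z) / jap (P z).1) := by
          gcongr
          exact hw z
      _ = W * F (P z) := by field_simp
      _ ≤ W * (2 * η) := by gcongr; exact hF.le _
      _ = _ := by ring
  have bX : ∀ i, weakDerivNorm weightedSup [dirX i] g ≤ ENNReal.ofReal (28 * W * η) := fun i => by
    refine weakDerivNorm_weightedSup_le hLip hg hBX fun z h => ?_
    have := hGX z.1 (z.1 + h • dir i) z.2
    rw [add_sub_cancel_left, norm_smul, hdir, mul_one, Real.norm_eq_abs] at this
    have e : z + h • dirX i = (z.1 + h • dir i, z.2) := Prod.ext (by simp [dirX]) (by simp [dirX])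
    rw [e]
    exact this
  have bV : ∀ i, weakDerivNorm weightedSup [dirV i] g
      ≤ ENNReal.ofReal (28 * W * η * (1 + a) * t ^ (1 - α)) := fun i => by
    refine weakDerivNorm_weightedSup_le hLip hg hBV fun z h => ?_
    have := hGV z.1 z.2 (z.2 + h • dir i)
    rw [add_sub_cancel_left, norm_smul, hdir, mul_one, Real.norm_eq_abs] at this
    have e : z + h • dirV i = (z.1, z.2 + h • dir i) := Prod.ext (by simp [dirV]) (by simp [dirV])
    rw [e]
    exact this
  have h3 : ((3 : ℕ) : ℝ≥0∞) = ENNReal.ofReal 3 := by simp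
  -- Each derivative costs 28 = 14 · 2 and there are three in x and three in v, so 170 = 2 + 84 +
  -- 84, plus 84 a from the shear.
  calc _ ≤ ENNReal.ofReal (2 * W * η) + (∑ _i : Fin 3, ENNReal.ofReal (28 * W * η))
        + ENNReal.ofReal (1 / t ^ (1 - α)) *
          (∑ _i : Fin 3, ENNReal.ofReal (28 * W * η * (1 + a) * t ^ (1 - α))) :=
        add_le_add (add_le_add b0 (Finset.sum_le_sum fun i _ => bX i))
          (mul_le_mul_right (Finset.sum_le_sum fun i _ => bV i) _)
    _ = ENNReal.ofReal (2 * W * η + 3 * (28 * W * η)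
        + 1 / t ^ (1 - α) * (3 * (28 * W * η * (1 + a) * t ^ (1 - α)))) := by
        simp only [Finset.sum_const, Finset.card_univ, Fintype.card_fin, nsmul_eq_mul]
        rw [h3, ← ENNReal.ofReal_mul (by norm_num), ← ENNReal.ofReal_mul (by norm_num),
          ← ENNReal.ofReal_mul (by positivity), ← ENNReal.ofReal_add (by positivity)
          (by positivity), ← ENNReal.ofReal_add (by positivity) (by positivity)]
    _ = _ := by
        congr 1
        unfold dispersionConst
        rw [← hW, ← ha]
        field_simp
        ring

/-- The reference map is a shear in x by a continuous function of v. It preserves measure, so it can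
be substituted into an identity for f(t) that holds only almost everywhere. -/
theorem modifiedDistribution_ae_eq {α K lam η : ℝ} {f₀ : Phase → ℝ} {f : ℝ → Phase → ℝ}
    {E : ℝ → E3 → E3} {F : Phase → ℝ} {Φ : ℝ → Phase → Phase} (hE : DecayingForce α K E)
    (hK : K ≤ 1 / 8) (hlam : |lam| = 1) (hF : NiceDatum η F) (hfF : ∀ᵐ z, f₀ z = F z / jap z.1)
    {t : ℝ} (ht : 0 ≤ t) (hΦ : ∀ z, Φ t z = hE.flow t 0 z)
    (hft : f t =ᵐ[volume] fun z => F (hE.flow 0 t z) / jap (hE.flow 0 t z).1) :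
    modifiedDistribution α lam f₀ f Φ t =ᵐ[volume] fun z =>
      F (hE.pullback lam F t z) / jap (hE.pullback lam F t z).1 := by
  set A := kernelAverage α lam F (fun z => (hE.flow t 0 z).2) with hA
  have hS := NiceDatum.singularConst_pos (α + 2)
  have hη0 := hF.pos
  have hα := hE.alpha_pos
  have hAc : Continuous A := (LipschitzWith.of_dist_le_mul
    (K := ⟨8 * α * NiceDatum.singularConst (α + 2) * η, by positivity⟩) fun x y => by
      rw [dist_eq_norm, dist_eq_norm]
      exact hF.norm_kernelAverage_sub_le_norm_sub (hE.hasRieszBounds_snd_flow hK hF ht)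
        hα hE.lt_one hlam x y).continuous
  have hR : refFlow α lam f₀ Φ t = fun z : Phase =>
      (z.1 + (t • z.2 + ((t ^ (1 - α) - 1) / (1 - α)) • A z.2), z.2) := by
    funext z
    rw [refFlow, correction_eq hE hfF hΦ, smul_neg, sub_neg_eq_add, add_assoc]
  have hmp : MeasurePreserving (refFlow α lam f₀ Φ t) volume volume := by
    rw [hR]
    refine measurePreserving_shear_fst (g := fun v => t • v + ((t ^ (1 - α) - 1) / (1 - α)) • A v)
      ?_
    exact ((continuous_id.const_smul t).add (hAc.const_smul ((t ^ (1 - α) - 1) / (1 - α)))).measurable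
  filter_upwards [hmp.quasiMeasurePreserving.ae hft] with z hz
  rw [modifiedDistribution, hz, hR]
  simp only [DecayingForce.pullback, ← add_assoc]
  rfl

end VlasovRiesz

/-! ### The main theorem. -/

open VlasovRiesz
theorem proposition4p1 (α lam : ℝ) (hα : 1 / 2 < α) (hα' : α < 1) (hlam : lam = 1 ∨ lam = -1)
    (C₀ : ℝ) (hC₀ : 0 < C₀) :
    ∃ η₀ : ℝ, 0 < η₀ ∧ ∃ C : ℝ, 0 < C ∧
      ∀ η : ℝ, 0 < η → η ≤ η₀ →
      ∀ f₀ : Phase → ℝ, (∀ᵐ z, 0 ≤ f₀ z) →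
        dataNorm (fun z => jap z.1 * f₀ z) ≤ ENNReal.ofReal η →
      ∀ f : ℝ → Phase → ℝ, IsGlobalSolution α lam f₀ f → DispersionBound α lam f (C₀ * η) →
      ∀ Φ : ℝ → Phase → Phase, IsCharacteristicFlow α lam f Φ →
      ∀ t : ℝ, 1 ≤ t →
        weightedSup (modifiedDistribution α lam f₀ f Φ t)
          + (∑ i, weakDerivNorm weightedSup [dirX i] (modifiedDistribution α lam f₀ f Φ t))
          + ENNReal.ofReal (1 / t ^ (1 - α)) *
              (∑ i, weakDerivNorm weightedSup [dirV i] (modifiedDistribution α lam f₀ f Φ t))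
        ≤ ENNReal.ofReal (C * η) := by
  have hα1 : 0 < 1 - α := by linarith
  have hl : |lam| = 1 := by rcases hlam with rfl | rfl <;> simp
  -- Here 768 = 48 · 16: the force has constant 48 C₀ η, which must not exceed (1-α)/16. The bound η
  -- ≤ 1 keeps the weight and shear constants independent of η.
  refine ⟨min 1 ((1 - α) / (768 * C₀)), by positivity, dispersionConst α,
    dispersionConst_pos hα hα', fun η hη hη₀ f₀ hf₀ hd f hf hb Φ hΦ t ht => ?_⟩
  have hK : 48 * (C₀ * η) ≤ (1 - α) / 16 := by
    have h := hη₀.trans (min_le_right _ _)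
    rw [le_div_iff₀ (by positivity)] at h
    linarith
  have hK8 : 48 * (C₀ * η) ≤ 1 / 8 := by linarith
  have ht0 : 0 ≤ t := by linarith
  obtain ⟨F, hF, hfF⟩ := exists_niceDatum hη hf₀ hd
  obtain ⟨E, hE, hEf⟩ := hf.exists_decayingForce hα hα' hl (by positivity) hb
  refine hE.weighted_bounds hK hl hF (hη₀.trans (min_le_left _ _))
    (fun s hs x => hf.force_eq_kernelAverage hE hK8 hl hEf hF hfF hs x) ht ?_
  exact modifiedDistribution_ae_eq hE hK8 hl hF hfF ht0
    (fun z => hΦ.eq_flow hE (fun s hs => hf.field_eq hE hK8 hl hEf hF hfF hs) ht0 z)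
    (hf.ae_eq_datum_comp_flow hE hEf hF hfF ht0)
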